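/- Graphs are countable, connected, locally finite and simple. Let $\mathcal G_\bullet$ be the space of isomorphism classes of rooted graphs $(G,\rho)$ and $\vec{\mathcal G}$ the space of isomorphism classes of graphs with a semi-infinite path $(G,(x_n)_{n\ge 0})$, both with the local distance (the infimum of $1/(r+1)$ over those $r\ge 0$ for which the balls of radius $r$ around the root, respectively around $x_0$ together with $x_0,\dots,x_r$, are isomorphic) and its Borel $\sigma$-algebra. Let $(G,\rho)$ be a random rooted graph, that is, a random variable in $\mathcal G_\bullet$ with law $\mathbf P$ and expectation $\mathbf E$. Conditionally on $(G,\rho)$ let $(X_n)_{n\ge0}$ be the simple random walk on $G$ started at $X_0=\rho$ (on the one-vertex graph the walk stays put, and its path is the constant one), with conditional law $P^G_\rho$, and let $\mathbb P$, $\mathbb E$ be the law of $(G,(X_n)_{n\ge 0})\in\vec{\mathcal G}$ and the corresponding expectation. Assume that $(G,\rho)$ is stationary, i.e. $(G,X_n)=(G,\rho)$ in distribution in $\mathcal G_\bullet$ for all $n\ge1$; that it is ergodic, i.e. every Borel set of $\vec{\mathcal G}$ that is invariant under the shift $(G,(x_n)_{n\ge 0})\mapsto(G,(x_{n+1})_{n\ge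 0})$ has $\mathbb P$-probability $0$ or $1$; and that for some $M>0$, almost surely all vertices of $G$ have degree at most $M$. Put $$H_n(G,\rho)=-\sum_{x\in V(G)}P^G_\rho(X_n=x)\log P^G_\rho(X_n=x),\qquad h_n=\mathbf E[H_n(G,\rho)],$$ with the convention $0\log 0=0$, and $$s=\limsup_{n\to\infty}\frac1n\,\mathbb E\big[d^G_{\mathrm{gr}}(X_0,X_n)\big],\qquad v=\limsup_{n\to\infty}\frac1n\,\mathbf E\big[\log \#B_G(\rho,n)\big],$$ where $d^G_{\mathrm{gr}}$ is the graph distance and $\#B_G(\rho,n)$ is the number of vertices within distance $n$ from $\rho$. **Proposition 3.5.** The random variables $H_n(G,\rho)$, $d^G_{\mathrm{gr}}(X_0,X_n)$ and $\log\#B_G(\rho,n)$ are integrable for every $n\ge0$, the limit $h=\lim_{n\to\infty}h_n/n$ (the mean entropy of $(G,\rho)$) exists and is finite, and $$\frac{s^2}{2}\le h\le v\,s .$$ In particular $h=0$ if and only if $s=0$; and if $s=0$ or $v=0$, then almost surely $G$ is Liouville, that is, every bounded harmonic function $V(G)\to\mathbb R$ is constant. -/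

import Mathlib

open MeasureTheory ProbabilityTheory Filter Topology

noncomputable section

namespace RandomGraph

/-! ### Graphs, balls, degrees -/

/-- A countable, connected, locally finite simple graph. -/
structure LFGraph : Type 1 where
  V : Type
  graph : SimpleGraph V
  countable : Countable V
  connected : graph.Connected
  locallyFinite : ∀ x : V, (graph.neighborSet x).Finite

namespace LFGraph

instance (G : LFGraph) : Countable G.V := G.countable

/-- The vertex set carries the discrete `σ`-algebra. -/
instance (G : LFGraph) : MeasurableSpace G.V := ⊤

instance (G : LFGraph) : DiscreteMeasurableSpace G.V := ⟨fun _ => trivial⟩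

/-- The number of neighbours of `x`. -/
def degree (G : LFGraph) (x : G.V) : ℕ := (G.graph.neighborSet x).ncard

/-- The set of vertices at graph distance at most `r` from `x`. -/
def ball (G : LFGraph) (x : G.V) (r : ℕ) : Set G.V := {y | G.graph.dist x y ≤ r}

/-- `f` is harmonic: its value at every vertex is the average of its values at the neighbours. -/
def IsHarmonic (G : LFGraph) (f : G.V → ℝ) : Prop :=
  ∀ x, f x = (∑ y ∈ (G.locallyFinite x).toFinset, f y) / (G.degree x : ℝ)

/-- Every bounded harmonic function is constant. -/
def IsLiouville (G : LFGraph) : Prop :=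
  ∀ f : G.V → ℝ, (∃ C : ℝ, ∀ x, |f x| ≤ C) → G.IsHarmonic f → ∀ x y, f x = f y

/-! ### Simple random walk on a fixed graph -/

/-- The possible positions of the simple random walk one step after `x`: the neighbours of `x`.
(The graph with a single vertex is the only connected graph that has a vertex without neighbours;
there the walk stays where it is.) -/
def stepSet (G : LFGraph) (x : G.V) : Set G.V :=
  {y | G.graph.Adj x y ∨ (y = x ∧ ∀ z, ¬ G.graph.Adj x z)}

theorem stepSet_nonempty (G : LFGraph) (x : G.V) : (G.stepSet x).Nonempty := by
  by_cases h : ∃ z, G.graph.Adj x z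
  · obtain ⟨z, hz⟩ := h
    exact ⟨z, Or.inl hz⟩
  · exact ⟨x, Or.inr ⟨rfl, not_exists.mp h⟩⟩

theorem stepSet_finite (G : LFGraph) (x : G.V) : (G.stepSet x).Finite := by
  refine ((G.locallyFinite x).union (Set.finite_singleton x)).subset ?_
  rintro y (h | h)
  · exact Or.inl h
  · exact Or.inr h.1

/-- The transition kernel of the simple random walk, in the form required by the
Ionescu-Tulcea construction: given the positions up to time `n`, the position at time `n + 1` is
uniform among the neighbours of the position at time `n`. -/
def stepKernel (G : LFGraph) (n : ℕ) : Kernel (Finset.Iic n → G.V) G.V where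
  toFun ω := uniformOn (G.stepSet (ω ⟨n, Finset.mem_Iic.2 le_rfl⟩))
  measurable' :=
    (measurable_from_top (f := fun x : G.V => uniformOn (G.stepSet x))).comp (measurable_pi_apply _)

instance (G : LFGraph) (n : ℕ) : IsMarkovKernel (G.stepKernel n) :=
  ⟨fun _ => isProbabilityMeasure_uniformOn (G.stepSet_finite _) (G.stepSet_nonempty _)⟩

/-- The law of the simple random walk `(X_n)_{n ≥ 0}` on `G` started at `x`. -/
def walk (G : LFGraph) (x : G.V) : Measure (ℕ → G.V) :=
  Kernel.traj (X := fun _ => G.V) G.stepKernel 0 (fun _ => x)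

/-- `ω` is a semi-infinite path of `G`. -/
def IsPath (G : LFGraph) (ω : ℕ → G.V) : Prop := ∀ n, ω (n + 1) ∈ G.stepSet (ω n)

/-- The entropy of the position at time `n` of the simple random walk on `G` started at `x`. -/
def entropy (G : LFGraph) (x : G.V) (n : ℕ) : ℝ :=
  ∑' y : G.V, Real.negMulLog ((G.walk x).real {ω | ω n = y})

/-- Two graphs-with-sequence have isomorphic balls of radius `r` (as induced subgraphs) around the
initial points, by an isomorphism that respects the terms of index at most `k`. -/
def BallIso (G₁ G₂ : LFGraph) (ω₁ : ℕ → G₁.V) (ω₂ : ℕ → G₂.V) (r k : ℕ) : Prop :=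
  ∃ e : G₁.graph.induce (G₁.ball (ω₁ 0) r) ≃g G₂.graph.induce (G₂.ball (ω₂ 0) r),
    ∀ i ≤ k, ∃ h : ω₁ i ∈ G₁.ball (ω₁ 0) r, (e ⟨ω₁ i, h⟩ : G₂.V) = ω₂ i

end LFGraph

/-! ### The space of rooted graphs -/

/-- A graph with a root. -/
structure RootedRep : Type 1 extends LFGraph where
  root : V

/-- Isomorphism of rooted graphs. -/
instance RootedRep.setoid : Setoid RootedRep where
  r a b := ∃ e : a.graph ≃g b.graph, e a.root = b.root
  iseqv :=
    { refl := fun _ => ⟨SimpleGraph.Iso.refl, rfl⟩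
      symm := fun ⟨e, he⟩ => ⟨e.symm, by rw [← he]; exact e.symm_apply_apply _⟩
      trans := fun ⟨e, he⟩ ⟨f, hf⟩ => ⟨e.trans f, by rw [← hf, ← he]; rfl⟩ }

/-- The set of isomorphism classes of rooted graphs. -/
def RootedGraph : Type 1 := Quotient RootedRep.setoid

namespace RootedGraph

/-- A representative, chosen once for all, of an isomorphism class. -/
def rep (g : RootedGraph) : RootedRep := Quotient.out g

/-- The local distance between rooted graphs. -/
def dloc (g₁ g₂ : RootedGraph) : ℝ :=
  sInf {t | ∃ r : ℕ, t = 1 / ((r : ℝ) + 1) ∧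
    LFGraph.BallIso g₁.rep.toLFGraph g₂.rep.toLFGraph
      (fun _ => g₁.rep.root) (fun _ => g₂.rep.root) r 0}

/-- The topology of the distance `dloc`. -/
instance : TopologicalSpace RootedGraph where
  IsOpen U := ∀ g ∈ U, ∃ ε > 0, ∀ g', dloc g g' < ε → g' ∈ U
  isOpen_univ := fun _ _ => ⟨1, one_pos, fun _ _ => trivial⟩
  isOpen_inter := fun _ _ hs ht g hg => by
    obtain ⟨ε, hε, h⟩ := hs g hg.1
    obtain ⟨δ, hδ, h'⟩ := ht g hg.2
    exact ⟨min ε δ, lt_min hε hδ, fun g' hg' =>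
      ⟨h g' (hg'.trans_le (min_le_left _ _)), h' g' (hg'.trans_le (min_le_right _ _))⟩⟩
  isOpen_sUnion := fun _ hS g ⟨U, hU, hg⟩ => by
    obtain ⟨ε, hε, h⟩ := hS U hU g hg
    exact ⟨ε, hε, fun g' hg' => ⟨U, hU, h g' hg'⟩⟩

instance : MeasurableSpace RootedGraph := borel RootedGraph

instance : BorelSpace RootedGraph := ⟨rfl⟩

/-- The entropy `H_n(G, ρ)` of the simple random walk at time `n` started from the root. -/
def entropy (g : RootedGraph) (n : ℕ) : ℝ := g.rep.toLFGraph.entropy g.rep.root n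

/-- The number of vertices within distance `n` from the root. -/
def ballCard (g : RootedGraph) (n : ℕ) : ℕ := (g.rep.toLFGraph.ball g.rep.root n).ncard

end RootedGraph

/-! ### The space of graphs with a semi-infinite path -/

/-- A graph with a semi-infinite path. -/
structure PathRep : Type 1 extends LFGraph where
  path : ℕ → V
  isPath : toLFGraph.IsPath path

/-- Isomorphism of graphs with a path. -/
instance PathRep.setoid : Setoid PathRep where
  r a b := ∃ e : a.graph ≃g b.graph, ∀ n, e (a.path n) = b.path n
  iseqv :=
    { refl := fun _ => ⟨SimpleGraph.Iso.refl, fun _ => rfl⟩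
      symm := fun ⟨e, he⟩ => ⟨e.symm, fun n => by rw [← he]; exact e.symm_apply_apply _⟩
      trans := fun ⟨e, he⟩ ⟨f, hf⟩ => ⟨e.trans f, fun n => by rw [← hf, ← he]; rfl⟩ }

/-- The set of isomorphism classes of graphs with a semi-infinite path. -/
def PathGraph : Type 1 := Quotient PathRep.setoid

namespace PathGraph

/-- The isomorphism class of the graph `G` with the path `ω`. -/
def mk (G : LFGraph) (ω : {ω : ℕ → G.V // G.IsPath ω}) : PathGraph :=
  Quotient.mk PathRep.setoid { toLFGraph := G, path := ω.1, isPath := ω.2 }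

/-- A representative, chosen once for all, of an isomorphism class. -/
def rep (q : PathGraph) : PathRep := Quotient.out q

/-- The local distance between graphs with a path: for each radius `r` one compares the balls of
radius `r` around the starting points together with the first `r` steps of the paths. -/
def dloc (q₁ q₂ : PathGraph) : ℝ :=
  sInf {t | ∃ r : ℕ, t = 1 / ((r : ℝ) + 1) ∧
    LFGraph.BallIso q₁.rep.toLFGraph q₂.rep.toLFGraph q₁.rep.path q₂.rep.path r r}

/-- The topology of the distance `dloc`. -/
instance : TopologicalSpace PathGraph where
  IsOpen U := ∀ g ∈ U, ∃ ε > 0, ∀ g', dloc g g' < ε → g' ∈ U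
  isOpen_univ := fun _ _ => ⟨1, one_pos, fun _ _ => trivial⟩
  isOpen_inter := fun _ _ hs ht g hg => by
    obtain ⟨ε, hε, h⟩ := hs g hg.1
    obtain ⟨δ, hδ, h'⟩ := ht g hg.2
    exact ⟨min ε δ, lt_min hε hδ, fun g' hg' =>
      ⟨h g' (hg'.trans_le (min_le_left _ _)), h' g' (hg'.trans_le (min_le_right _ _))⟩⟩
  isOpen_sUnion := fun _ hS g ⟨U, hU, hg⟩ => by
    obtain ⟨ε, hε, h⟩ := hS U hU g hg
    exact ⟨ε, hε, fun g' hg' => ⟨U, hU, h g' hg'⟩⟩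

instance : MeasurableSpace PathGraph := borel PathGraph

instance : BorelSpace PathGraph := ⟨rfl⟩

/-- The shift `θ (G, (x_n)_{n ≥ 0}) = (G, (x_{n+1})_{n ≥ 0})`. -/
def shift : PathGraph → PathGraph :=
  Quotient.map
    (fun a : PathRep => ({ a with path := fun n => a.path (n + 1)
                                  isPath := fun n => a.isPath (n + 1) } : PathRep))
    (fun _ _ ⟨e, he⟩ => ⟨e, fun n => he (n + 1)⟩)

/-- The graph rooted at the position of the path at time `n`: `(G, x_n)`. -/
def rootAt (n : ℕ) : PathGraph → RootedGraph :=
  Quotient.map (fun a : PathRep => ({ a with root := a.path n } : RootedRep))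
    (fun _ _ ⟨e, he⟩ => ⟨e, he n⟩)

/-- The graph distance between the positions of the path at times `0` and `n`. -/
def displacement (q : PathGraph) (n : ℕ) : ℕ := q.rep.graph.dist (q.rep.path 0) (q.rep.path n)

end PathGraph

/-! ### Random rooted graphs -/

/-- The law of `(G, (X_n)_{n ≥ 0})`, where `(X_n)` is the simple random walk on the fixed rooted
graph `(G, ρ)` started from `ρ` (whose law is carried by the set of paths of `G`). -/
def RootedGraph.pathLaw (g : RootedGraph) : Measure PathGraph :=
  (Measure.comap (Subtype.val : {ω : ℕ → g.rep.V // g.rep.toLFGraph.IsPath ω} → ℕ → g.rep.V)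
    (g.rep.toLFGraph.walk g.rep.root)).map
    (PathGraph.mk g.rep.toLFGraph)

/-- If `P` is the law of the random rooted graph `(G, ρ)`, this is the law of
`(G, (X_n)_{n ≥ 0})`, where, conditionally on `(G, ρ)`, `(X_n)` is the simple random walk on `G`
started from `ρ`. -/
def pathLaw (P : Measure RootedGraph) : Measure PathGraph := P.bind RootedGraph.pathLaw

/-- `(G, X_n) = (G, ρ)` in distribution for all `n ≥ 1`. -/
def IsStationary (P : Measure RootedGraph) : Prop :=
  ∀ n : ℕ, 1 ≤ n → (pathLaw P).map (PathGraph.rootAt n) = P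

/-- For stationary `P`: the law of `(G, (X_n)_{n ≥ 0})` is ergodic for the shift, that is, every
shift-invariant Borel set has measure zero or full measure. -/
def IsErgodic (P : Measure RootedGraph) : Prop := PreErgodic PathGraph.shift (pathLaw P)

/-- The expected entropy `h_n = E[H_n(G, ρ)]`. -/
def expEntropy (P : Measure RootedGraph) (n : ℕ) : ℝ := ∫ g, g.entropy n ∂P

/-- The mean entropy `h` of `P` is the limit of `h_n / n`. -/
def HasMeanEntropy (P : Measure RootedGraph) (h : ℝ) : Prop :=
  Tendsto (fun n : ℕ => expEntropy P n / n) atTop (𝓝 h)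

/-- The speed `s` of the simple random walk. -/
def speed (P : Measure RootedGraph) : ℝ :=
  limsup (fun n : ℕ => (∫ q, (q.displacement n : ℝ) ∂(pathLaw P)) / n) atTop

/-- The exponential volume growth `v`. -/
def volumeGrowth (P : Measure RootedGraph) : ℝ :=
  limsup (fun n : ℕ => (∫ g, Real.log (g.ballCard n) ∂P) / n) atTop

end RandomGraph

end

/-!
# Entropy, speed and volume growth of stationary random graphs

*The mean entropy.* The mutual information of `X_1` and `X_{n+1}` under the walk from `x` equals
`H_{n+1}(x)` minus the mean of `H_n` over the possible positions of `X_1`; call it the entropy gain.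
By data processing it is nonnegative and nonincreasing in `n` (`LFGraph.gain_nonneg`,
`LFGraph.gain_antitone`). Stationarity turns its expectation into `h_{n+1} - h_n`
(`integral_gain`), so these increments converge, and `h_n / n` has the same limit `h`
(`exists_hasMeanEntropy`).

*Lower bound.* The Varopoulos–Carne bound `p_n(x, y) ≤ 2 √(deg y / deg x) exp (-d(x, y)² / 2n)`
(`LFGraph.prob_le_exp`) holds because `T_k(P)`, the Chebyshev polynomials in the Markov operator
`P`, are contractions that propagate over distance at most `k`, and `P^n` is the mean of the
`T_{|S_n|}(P)` for the simple random walk `S` on `ℤ`. Averaging `-log p_n(ρ, X_n)` gives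
`h_n ≥ E[d(ρ, X_n)²] / 2n - O(1) ≥ E[d(ρ, X_n)]² / 2n - O(1)` (`sq_meanDisplacement_le`), and hence
`s² / 2 ≤ h`.

*Upper bound.* For `a > s` the walk is within distance `a n` from the root with probability tending
to one. Indeed, choose `m` with `E[d(X_0, X_m)] < a m`. By the triangle inequality
`m d(X_0, X_n)` is, up to a constant, at most the sum of `d(X_t, X_{t+m})` over `t < n`
(`mul_dist_le`), to which the mean ergodic theorem for the shift applies
(`tendsto_measure_displacement`). So `X_n` carries at most
`log #B(ρ, a n) + o(n)` of entropy, which is bounded by `w a n + o(n)` in expectation for every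
`w > v` (`expEntropy_le`, `le_volumeGrowth_mul_speed`).

*Liouville property.* If `h = 0`, then the expected entropy gain tends to `0`; by monotonicity it
does so almost surely at the root, and by stationarity at all vertices. By Pinsker's inequality the
laws of `X_{n+1}` given `X_1` and of `X_{n+1}` approach each other in total variation, so a
bounded harmonic function takes the same value at `x` and at each of its neighbours
(`LFGraph.isLiouville_of_gain_tendsto`).

*Measurability.* A function of a rooted graph that depends only on a ball of fixed radius around
the root is measurable (`RootedGraph.measurable_of_near`). As the space of graphs with a path has a
countable base of sets that depend on finite balls, the law of the walk is a measurable function of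
the rooted graph (`RootedGraph.measurable_pathLaw`), which makes `pathLaw P` the mixture that it is
meant to be.
-/

noncomputable section

namespace RandomGraph

/-! ### Entropy inequalities for finite sums -/

/-- The summand `a log (a / b)` of the relative entropy of two measures with point masses `a`
and `b`; written with a difference of logarithms so that `0 log (0 / 0) = 0`. -/
def klTerm (a b : ℝ) : ℝ := a * (Real.log a - Real.log b)

theorem le_klTerm {a b t : ℝ} (ha : 0 ≤ a) (hb : 0 ≤ b) (hab : b = 0 → a = 0) (ht : 0 < t) :
    a * Real.log t + a - b * t ≤ klTerm a b := by
  unfold klTerm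
  rcases ha.eq_or_lt with rfl | ha'
  · simp; positivity
  · have hb' : 0 < b := hb.lt_of_ne fun h => ha'.ne' (hab h.symm)
    have h1 := Real.log_le_sub_one_of_pos (show 0 < b * t / a by positivity)
    rw [Real.log_div (by positivity) ha'.ne', Real.log_mul hb'.ne' ht.ne'] at h1
    have h2 := mul_le_mul_of_nonneg_left h1 ha
    have h3 : a * (b * t / a - 1) = b * t - a := by field_simp
    linarith

/-- The log-sum inequality. -/
theorem klTerm_sum_le {ι : Type*} (s : Finset ι) (a b : ι → ℝ) (ha : ∀ i ∈ s, 0 ≤ a i)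
    (hb : ∀ i ∈ s, 0 ≤ b i) (hab : ∀ i ∈ s, b i = 0 → a i = 0) :
    klTerm (∑ i ∈ s, a i) (∑ i ∈ s, b i) ≤ ∑ i ∈ s, klTerm (a i) (b i) := by
  rcases (Finset.sum_nonneg ha).eq_or_lt with hA | hA
  · have h0 := (Finset.sum_eq_zero_iff_of_nonneg ha).1 hA.symm
    rw [← hA, Finset.sum_eq_zero (f := fun i => klTerm (a i) (b i)) fun i hi => by
      rw [klTerm, h0 i hi, zero_mul]]
    simp [klTerm]
  · have hB : 0 < ∑ i ∈ s, b i := by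
      refine (Finset.sum_nonneg hb).lt_of_ne fun h => hA.ne' ?_
      have h0 := (Finset.sum_eq_zero_iff_of_nonneg hb).1 h.symm
      exact Finset.sum_eq_zero fun i hi => hab i hi (h0 i hi)
    have ht := div_pos hA hB
    have := Finset.sum_le_sum fun i hi => le_klTerm (ha i hi) (hb i hi) (hab i hi) ht
    refine le_trans (le_of_eq ?_) this
    rw [Finset.sum_sub_distrib, Finset.sum_add_distrib, ← Finset.sum_mul, ← Finset.sum_mul,
      klTerm, Real.log_div hA.ne' hB.ne', mul_div_cancel₀ _ hB.ne']
    ring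

/-- Data processing: relative entropy does not increase under a Markov kernel. -/
theorem sum_klTerm_kernel_le {ι κ : Type*} (s : Finset ι) (t : Finset κ) (a b : ι → ℝ)
    (K : ι → κ → ℝ) (ha : ∀ i ∈ s, 0 ≤ a i) (hb : ∀ i ∈ s, 0 ≤ b i)
    (hab : ∀ i ∈ s, b i = 0 → a i = 0) (hK : ∀ i ∈ s, ∀ j ∈ t, 0 ≤ K i j)
    (hK1 : ∀ i ∈ s, ∑ j ∈ t, K i j = 1) :
    ∑ j ∈ t, klTerm (∑ i ∈ s, a i * K i j) (∑ i ∈ s, b i * K i j) ≤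
      ∑ i ∈ s, klTerm (a i) (b i) := by
  have hterm : ∀ i ∈ s, ∀ j ∈ t, klTerm (a i * K i j) (b i * K i j) = klTerm (a i) (b i) * K i j := by
    intro i hi j hj
    rcases (ha i hi).eq_or_lt with h | h
    · simp [klTerm, ← h]
    · have hb' : b i ≠ 0 := fun h' => h.ne' (hab i hi h')
      by_cases hk : K i j = 0
      · simp [klTerm, hk]
      · rw [klTerm, klTerm, Real.log_mul h.ne' hk, Real.log_mul hb' hk]
        ring
  calc ∑ j ∈ t, klTerm (∑ i ∈ s, a i * K i j) (∑ i ∈ s, b i * K i j)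
      ≤ ∑ j ∈ t, ∑ i ∈ s, klTerm (a i * K i j) (b i * K i j) := by
        refine Finset.sum_le_sum fun j hj => klTerm_sum_le s _ _
          (fun i hi => mul_nonneg (ha i hi) (hK i hi j hj))
          (fun i hi => mul_nonneg (hb i hi) (hK i hi j hj)) fun i hi h => ?_
        rcases mul_eq_zero.1 h with h | h
        · rw [hab i hi h, zero_mul]
        · rw [h, mul_zero]
    _ = ∑ i ∈ s, ∑ j ∈ t, klTerm (a i) (b i) * K i j := by
        rw [Finset.sum_comm]
        exact Finset.sum_congr rfl fun i hi => Finset.sum_congr rfl fun j hj => hterm i hi j hj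
    _ = ∑ i ∈ s, klTerm (a i) (b i) := by
        refine Finset.sum_congr rfl fun i hi => ?_
        rw [← Finset.mul_sum, hK1 i hi, mul_one]

/-- A Pinsker inequality, with a constant that is not optimal. It comes from comparing both sides
with the squared Hellinger distance `∑ (√a - √b)²`. -/
theorem sq_sum_abs_sub_le {ι : Type*} (s : Finset ι) (a b : ι → ℝ) (ha : ∀ i ∈ s, 0 ≤ a i)
    (hb : ∀ i ∈ s, 0 ≤ b i) (hab : ∀ i ∈ s, b i = 0 → a i = 0) (ha1 : ∑ i ∈ s, a i = 1)
    (hb1 : ∑ i ∈ s, b i = 1) :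
    (∑ i ∈ s, |a i - b i|) ^ 2 ≤ 4 * ∑ i ∈ s, klTerm (a i) (b i) := by
  have hterm : ∀ i ∈ s, (√(a i) - √(b i)) ^ 2 + (a i - b i) ≤ klTerm (a i) (b i) := by
    intro i hi
    have hsa := Real.sq_sqrt (ha i hi)
    have hsb := Real.sq_sqrt (hb i hi)
    have hne : √(b i) = 0 → √(a i) = 0 := fun h => by
      rw [hab i hi ((Real.sqrt_eq_zero (hb i hi)).1 h), Real.sqrt_zero]
    rcases (Real.sqrt_nonneg (a i)).eq_or_lt with h | h
    · have : a i = 0 := (Real.sqrt_eq_zero (ha i hi)).1 h.symm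
      rw [← h, zero_sub, neg_sq, hsb, this, klTerm]; simp
    · have hb' : 0 < √(b i) :=
        (Real.sqrt_nonneg _).lt_of_ne fun h' => h.ne' (hne h'.symm)
      have h1 := Real.log_le_sub_one_of_pos (div_pos hb' h)
      rw [Real.log_div hb'.ne' h.ne'] at h1
      have h2 := mul_le_mul_of_nonneg_left h1 (show 0 ≤ 2 * √(a i) ^ 2 by positivity)
      have h3 : 2 * √(a i) ^ 2 * (√(b i) / √(a i) - 1) = 2 * (√(a i) * √(b i)) - 2 * √(a i) ^ 2 := by
        field_simp
      have la : Real.log (a i) = 2 * Real.log √(a i) := by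
        rw [Real.log_sqrt (ha i hi)]; ring
      have lb : Real.log (b i) = 2 * Real.log √(b i) := by
        rw [Real.log_sqrt (hb i hi)]; ring
      have h4 : (√(a i) - √(b i)) ^ 2 = √(a i) ^ 2 - 2 * (√(a i) * √(b i)) + √(b i) ^ 2 := by ring
      rw [h3, hsa] at h2
      rw [klTerm, la, lb, h4, hsa, hsb]
      linarith
  have hH : ∑ i ∈ s, (√(a i) - √(b i)) ^ 2 ≤ ∑ i ∈ s, klTerm (a i) (b i) := by
    have := Finset.sum_le_sum hterm
    rw [Finset.sum_add_distrib, Finset.sum_sub_distrib, ha1, hb1] at this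
    linarith
  have hS : ∑ i ∈ s, (√(a i) + √(b i)) ^ 2 ≤ 4 := by
    have : ∀ i ∈ s, (√(a i) + √(b i)) ^ 2 ≤ 2 * a i + 2 * b i := fun i hi => by
      nlinarith [Real.sq_sqrt (ha i hi), Real.sq_sqrt (hb i hi), sq_nonneg (√(a i) - √(b i))]
    have := Finset.sum_le_sum this
    rw [Finset.sum_add_distrib, ← Finset.mul_sum, ← Finset.mul_sum, ha1, hb1] at this
    linarith
  have hCS := Finset.sum_mul_sq_le_sq_mul_sq s (fun i => |√(a i) - √(b i)|)
    (fun i => √(a i) + √(b i))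
  have heq : ∑ i ∈ s, |√(a i) - √(b i)| * (√(a i) + √(b i)) = ∑ i ∈ s, |a i - b i| := by
    refine Finset.sum_congr rfl fun i hi => ?_
    have h0 : 0 ≤ √(a i) + √(b i) := by positivity
    nth_rw 1 [← abs_of_nonneg h0]
    rw [← abs_mul]
    congr 1
    nlinarith [Real.sq_sqrt (ha i hi), Real.sq_sqrt (hb i hi)]
  rw [heq] at hCS
  simp only [sq_abs] at hCS
  have h0 : 0 ≤ ∑ i ∈ s, (√(a i) - √(b i)) ^ 2 := Finset.sum_nonneg fun i _ => sq_nonneg _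
  nlinarith

/-- Among the measures of mass `S` on a finite set the uniform one has the largest entropy. -/
theorem sum_negMulLog_le {ι : Type*} (s : Finset ι) (a : ι → ℝ) (ha : ∀ i ∈ s, 0 ≤ a i) :
    ∑ i ∈ s, Real.negMulLog (a i) ≤
      (∑ i ∈ s, a i) * Real.log s.card + Real.negMulLog (∑ i ∈ s, a i) := by
  have := klTerm_sum_le s a (fun _ => 1) ha (fun _ _ => zero_le_one) (by simp)
  simp only [klTerm, Finset.sum_const, nsmul_eq_mul, mul_one, Real.log_one, sub_zero] at this
  simp only [Real.negMulLog, neg_mul, Finset.sum_neg_distrib]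
  linarith

theorem negMulLog_le_one {a : ℝ} (ha : 0 ≤ a) : Real.negMulLog a ≤ 1 := by
  have := Real.negMulLog_le_one_sub_self ha
  linarith

/-- The entropy of a mixture exceeds the mean entropy of its components by the mean relative
entropy of the components with respect to the mixture. -/
theorem sum_negMulLog_mean {ι κ : Type*} (s : Finset ι) (t : Finset κ) (c : ℝ) (a : ι → κ → ℝ)
    (b : κ → ℝ) (hb : ∀ j ∈ t, b j = (∑ i ∈ s, a i j) / c) :
    ∑ j ∈ t, Real.negMulLog (b j) - (∑ i ∈ s, ∑ j ∈ t, Real.negMulLog (a i j)) / c =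
      (∑ i ∈ s, ∑ j ∈ t, klTerm (a i j) (b j)) / c := by
  have h1 : ∑ i ∈ s, ∑ j ∈ t, klTerm (a i j) (b j) =
      -(∑ i ∈ s, ∑ j ∈ t, Real.negMulLog (a i j)) - ∑ j ∈ t, (∑ i ∈ s, a i j) * Real.log (b j) := by
    simp only [klTerm, Real.negMulLog, mul_sub, Finset.sum_sub_distrib, neg_mul,
      Finset.sum_neg_distrib, neg_neg, Finset.sum_mul]
    rw [Finset.sum_comm (s := s) (f := fun i j => a i j * Real.log (b j))]
  have h2 : ∑ j ∈ t, Real.negMulLog (b j) = -(∑ j ∈ t, (∑ i ∈ s, a i j) * Real.log (b j)) / c := by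
    rw [← Finset.sum_neg_distrib, Finset.sum_div]
    refine Finset.sum_congr rfl fun j hj => ?_
    nth_rw 1 [hb j hj]
    rw [hb j hj, Real.negMulLog]
    ring
  rw [h1, h2]
  ring

/-! ### The simple random walk: cylinders and the first step -/

/-- Two finite measures on sequences in a countable set agree if they agree on cylinders. -/
theorem ext_of_cylinder {V : Type*} [Countable V] [MeasurableSpace V] [DiscreteMeasurableSpace V]
    (μ ν : Measure (ℕ → V)) [IsFiniteMeasure μ]
    (h : ∀ (a : ℕ → V) (n : ℕ), μ {ω | ∀ i ≤ n, ω i = a i} = ν {ω | ∀ i ≤ n, ω i = a i}) :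
    μ = ν := by
  have hIic : ∀ n, μ.map (Finset.restrict (Finset.Iic n)) = ν.map (Finset.restrict (Finset.Iic n)) := by
    intro n
    refine Measure.ext_of_singleton fun y => ?_
    have hm : Measurable (Finset.restrict (π := fun _ => V) (Finset.Iic n)) :=
      Finset.measurable_restrict _
    rw [Measure.map_apply hm (measurableSet_singleton y),
      Measure.map_apply hm (measurableSet_singleton y)]
    have : Finset.restrict (π := fun _ => V) (Finset.Iic n) ⁻¹' {y} =
        {ω : ℕ → V | ∀ i ≤ n, ω i = if hi : i ≤ n then y ⟨i, Finset.mem_Iic.2 hi⟩ else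
          y ⟨0, Finset.mem_Iic.2 zero_le⟩} := by
      ext ω
      simp only [Set.mem_preimage, Set.mem_singleton_iff, Set.mem_ofPred_eq]
      refine ⟨fun hω i hi => by rw [dif_pos hi, ← hω]; rfl, fun hω => ?_⟩
      funext ⟨i, hi⟩
      have := hω i (Finset.mem_Iic.1 hi)
      rw [dif_pos (Finset.mem_Iic.1 hi)] at this
      exact this
    rw [this]
    exact h _ _
  have hμ : IsProjectiveLimit μ fun I => μ.map (Finset.restrict (π := fun _ : ℕ => V) I) :=
    fun I => rfl
  refine hμ.unique fun I => ?_
  have hI : I ⊆ Finset.Iic (I.sup id) := fun i hi => Finset.mem_Iic.2 (Finset.le_sup (f := id) hi)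
  have key : ∀ ρ : Measure (ℕ → V), ρ.map (Finset.restrict (π := fun _ : ℕ => V) I) =
      (ρ.map (Finset.restrict (Finset.Iic (I.sup id)))).map
        (Finset.restrict₂ (π := fun _ : ℕ => V) hI) := fun ρ => by
    rw [Measure.map_map (Finset.measurable_restrict₂ _) (Finset.measurable_restrict _)]
    rfl
  exact (key ν).trans ((congrArg _ (hIic _)).symm.trans (key μ).symm)

namespace LFGraph

variable (G : LFGraph)

/-- The finite set of possible positions one step after `x`. -/
def stepFin (x : G.V) : Finset G.V := (G.stepSet_finite x).toFinset

@[simp] theorem mem_stepFin {x y : G.V} : y ∈ G.stepFin x ↔ y ∈ G.stepSet x := by simp [stepFin]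

theorem stepFin_card_pos (x : G.V) : 0 < (G.stepFin x).card :=
  Finset.card_pos.2 <| (G.stepSet_nonempty x).imp fun _ h => G.mem_stepFin.2 h

theorem uniformOn_stepSet_singleton [DecidableEq G.V] (x y : G.V) :
    uniformOn (G.stepSet x) {y} =
      if y ∈ G.stepFin x then ((G.stepFin x).card : ENNReal)⁻¹ else 0 := by
  have h : G.stepSet x = (G.stepFin x : Set G.V) := by ext; simp
  rw [h, ← Finset.coe_singleton, uniformOn_apply_finset]
  split_ifs with hy
  · rw [Finset.inter_singleton_of_mem hy]; simp
  · rw [Finset.inter_singleton_of_notMem hy]; simp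

theorem mem_stepSet_comm {x y : G.V} : y ∈ G.stepSet x ↔ x ∈ G.stepSet y := by
  constructor <;>
  · rintro (h | ⟨rfl, h⟩)
    · exact Or.inl h.symm
    · exact Or.inr ⟨rfl, h⟩

theorem dist_le_one_of_mem_stepSet {x y : G.V} (h : y ∈ G.stepSet x) : G.graph.dist x y ≤ 1 := by
  rcases h with h | ⟨rfl, -⟩
  · exact (SimpleGraph.dist_eq_one_iff_adj.2 h).le
  · simp

theorem dist_triangle (x y z : G.V) :
    G.graph.dist x z ≤ G.graph.dist x y + G.graph.dist y z := G.connected.dist_triangle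

instance (x : G.V) : IsProbabilityMeasure (G.walk x) := by
  unfold walk; infer_instance

theorem walk_cylinder_zero [DecidableEq G.V] (x : G.V) (a : ℕ → G.V) :
    G.walk x {ω | ∀ i ≤ 0, ω i = a i} = if a 0 = x then 1 else 0 := by
  have h := Kernel.traj_map_frestrictLe_apply (X := fun _ => G.V) (κ := G.stepKernel) 0 0
    (fun _ => x)
  rw [Kernel.partialTraj_self, Kernel.id_apply] at h
  have h2 := congrArg (fun μ => μ {fun _ => a 0}) h
  rw [Measure.map_apply (by fun_prop) (measurableSet_singleton _)] at h2
  have h3 : {ω : ℕ → G.V | ∀ i ≤ 0, ω i = a i} =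
      Preorder.frestrictLe (π := fun _ => G.V) 0 ⁻¹' {fun _ => a 0} := by
    ext ω
    simp only [Set.mem_ofPred_eq, Set.mem_preimage, Set.mem_singleton_iff]
    constructor
    · intro h
      funext ⟨i, hi⟩
      have : i = 0 := by simpa using hi
      subst this
      exact h 0 le_rfl
    · intro h i hi
      have : i = 0 := by omega
      subst this
      exact congrFun h ⟨0, by simp⟩
  rw [h3, walk, h2, Measure.dirac_apply' _ (measurableSet_singleton _), Set.indicator_apply]
  simp only [Set.mem_singleton_iff, Pi.one_apply]
  refine if_congr ⟨fun h => (congrFun h ⟨0, by simp⟩).symm, fun h => by rw [h]⟩ rfl rfl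

theorem walk_cylinder_succ (x : G.V) (a : ℕ → G.V) (n : ℕ) :
    G.walk x {ω | ∀ i ≤ n + 1, ω i = a i} =
      G.walk x {ω | ∀ i ≤ n, ω i = a i} * uniformOn (G.stepSet (a n)) {a (n + 1)} := by
  have h := Kernel.partialTraj_compProd_eq_map_traj (X := fun _ => G.V) (κ := G.stepKernel)
    (zero_le (a := n)) (x₀ := fun _ => x)
  have h0 := Kernel.traj_map_frestrictLe_apply (X := fun _ => G.V) (κ := G.stepKernel) 0 n
    (fun _ => x)
  set b : Finset.Iic n → G.V := fun i => a i with hb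
  have h2 := congrArg (fun μ => μ ({b} ×ˢ {a (n + 1)})) h
  rw [Measure.compProd_apply_prod (measurableSet_singleton _) (measurableSet_singleton _),
    Measure.restrict_singleton, lintegral_smul_measure, lintegral_dirac, ← h0,
    Measure.map_apply (by fun_prop) (measurableSet_singleton _),
    Measure.map_apply (by fun_prop) ((measurableSet_singleton _).prod (measurableSet_singleton _))]
    at h2
  have e1 : {ω : ℕ → G.V | ∀ i ≤ n, ω i = a i} =
      Preorder.frestrictLe (π := fun _ => G.V) n ⁻¹' {b} := by
    ext ω
    simp only [Set.mem_ofPred_eq, Set.mem_preimage, Set.mem_singleton_iff]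
    constructor
    · intro h
      funext ⟨i, hi⟩
      exact h i (by simpa using hi)
    · intro h i hi
      exact congrFun h ⟨i, by simpa using hi⟩
  have e2 : {ω : ℕ → G.V | ∀ i ≤ n + 1, ω i = a i} =
      (fun ω : ℕ → G.V => (Preorder.frestrictLe (π := fun _ => G.V) n ω, ω (n + 1))) ⁻¹'
        ({b} ×ˢ {a (n + 1)}) := by
    ext ω
    have := Set.ext_iff.1 e1 ω
    simp only [Set.mem_ofPred_eq, Set.mem_preimage, Set.mem_singleton_iff, Set.mem_prod] at this ⊢
    rw [← this]
    constructor
    · exact fun h => ⟨fun i hi => h i (by omega), h _ le_rfl⟩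
    · rintro ⟨h, h'⟩ i hi
      rcases Nat.le_succ_iff.1 hi with hi | rfl
      · exact h i hi
      · exact h'
  rw [e2, e1, walk, ← h2]
  rfl

/-- The sequence `x, ω 0, ω 1, …`. -/
def cons {V : Type*} (x : V) (ω : ℕ → V) : ℕ → V
  | 0 => x
  | n + 1 => ω n

theorem measurable_cons {V : Type*} [MeasurableSpace V] (x : V) : Measurable (cons x) := by
  refine measurable_pi_lambda _ fun n => ?_
  cases n with
  | zero => exact measurable_const
  | succ n => exact measurable_pi_apply n

/-- First step decomposition of the walk. -/
theorem walk_eq_sum (x : G.V) :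
    G.walk x = ∑ z ∈ G.stepFin x,
      ((G.stepFin x).card : ENNReal)⁻¹ • (G.walk z).map (cons x) := by
  classical
  refine ext_of_cylinder _ _ fun a n => ?_
  have hcyl : ∀ n, MeasurableSet {ω : ℕ → G.V | ∀ i ≤ n, ω i = a i} := fun n => by
    have : {ω : ℕ → G.V | ∀ i ≤ n, ω i = a i} = ⋂ i, ⋂ _ : i ≤ n, {ω | ω i = a i} := by
      ext; simp
    rw [this]
    exact MeasurableSet.iInter fun i => MeasurableSet.iInter fun _ =>
      measurable_pi_apply i (measurableSet_singleton _)
  simp only [Measure.finsetSum_apply, Measure.smul_apply, smul_eq_mul,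
    Measure.map_apply (measurable_cons x) (hcyl n)]
  have hc : ((G.stepFin x).card : ENNReal) * ((G.stepFin x).card : ENNReal)⁻¹ = 1 :=
    ENNReal.mul_inv_cancel (by simpa using (G.stepFin_card_pos x).ne') (by simp)
  by_cases hx : a 0 = x
  · induction n with
    | zero =>
      rw [walk_cylinder_zero, if_pos hx]
      have : cons x ⁻¹' {ω : ℕ → G.V | ∀ i ≤ 0, ω i = a i} = Set.univ := by
        ext ω
        simp [cons, hx]
      simp only [this, measure_univ, mul_one, Finset.sum_const, nsmul_eq_mul, hc]
    | succ n ih =>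
      have hpre : ∀ n, cons x ⁻¹' {ω : ℕ → G.V | ∀ i ≤ n + 1, ω i = a i} =
          {ω | ∀ i ≤ n, ω i = a (i + 1)} := fun n => by
        ext ω
        simp only [Set.mem_preimage, Set.mem_ofPred_eq]
        refine ⟨fun h i hi => h (i + 1) (by omega), fun h i hi => ?_⟩
        cases i with
        | zero => exact hx.symm
        | succ i => exact h i (by omega)
      rw [hpre, walk_cylinder_succ]
      cases n with
      | zero =>
        simp only [walk_cylinder_zero, uniformOn_stepSet_singleton, hx, zero_add, mul_ite, mul_one,
          mul_zero, if_true, one_mul, Finset.sum_ite_eq]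
      | succ n =>
        rw [ih, hpre, Finset.sum_mul]
        refine Finset.sum_congr rfl fun z _ => ?_
        rw [walk_cylinder_succ, mul_assoc]
  · have hle : G.walk x {ω | ∀ i ≤ n, ω i = a i} ≤ G.walk x {ω | ∀ i ≤ 0, ω i = a i} :=
      measure_mono fun ω h i hi => h i (by omega)
    rw [walk_cylinder_zero, if_neg hx] at hle
    rw [le_antisymm hle zero_le]
    refine (Finset.sum_eq_zero fun z _ => ?_).symm
    have : cons x ⁻¹' {ω : ℕ → G.V | ∀ i ≤ n, ω i = a i} = ∅ := by
      ext ω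
      simp only [Set.mem_preimage, Set.mem_ofPred_eq, Set.mem_empty_iff_false, iff_false]
      exact fun h => hx (h 0 zero_le).symm
    simp [this]

theorem walk_apply (x : G.V) {A : Set (ℕ → G.V)} (hA : MeasurableSet A) :
    G.walk x A = ∑ z ∈ G.stepFin x, ((G.stepFin x).card : ENNReal)⁻¹ * G.walk z (cons x ⁻¹' A) := by
  conv_lhs => rw [walk_eq_sum]
  simp only [Measure.finsetSum_apply, Measure.smul_apply, smul_eq_mul,
    Measure.map_apply (measurable_cons x) hA]

theorem walk_ae_zero (x : G.V) : ∀ᵐ ω ∂G.walk x, ω 0 = x := by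
  classical
  have h := G.walk_cylinder_zero x (fun _ => x)
  rw [if_pos rfl] at h
  have h2 : {ω : ℕ → G.V | ∀ i ≤ 0, ω i = x} = {ω | ω 0 = x} := by ext; simp
  rw [h2] at h
  exact (prob_compl_eq_zero_iff
    ((measurable_pi_apply 0 : Measurable fun ω : ℕ → G.V => ω 0) (measurableSet_singleton x))).2 h

theorem measurableSet_isPath : MeasurableSet {ω : ℕ → G.V | G.IsPath ω} := by
  have : {ω : ℕ → G.V | G.IsPath ω} = ⋂ n, (fun ω => (ω n, ω (n + 1))) ⁻¹'
      {p : G.V × G.V | p.2 ∈ G.stepSet p.1} := by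
    ext; simp [IsPath]
  rw [this]
  exact MeasurableSet.iInter fun n =>
    (by fun_prop : Measurable fun ω : ℕ → G.V => (ω n, ω (n + 1)))
      (Set.to_countable _).measurableSet

theorem walk_ae_isPath (x : G.V) : ∀ᵐ ω ∂G.walk x, G.IsPath ω := by
  refine ae_all_iff.2 fun n => ?_
  have hm : ∀ n, MeasurableSet {ω : ℕ → G.V | ω (n + 1) ∈ G.stepSet (ω n)}ᶜ := fun n =>
    ((by fun_prop : Measurable fun ω : ℕ → G.V => (ω n, ω (n + 1)))
      (Set.to_countable {p : G.V × G.V | p.2 ∈ G.stepSet p.1}).measurableSet).compl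
  change G.walk x {ω | ω (n + 1) ∈ G.stepSet (ω n)}ᶜ = 0
  induction n generalizing x with
  | zero =>
    rw [walk_apply _ _ (hm 0)]
    refine Finset.sum_eq_zero fun z hz => mul_eq_zero_of_right _ ?_
    refine measure_mono_null (fun ω hω => ?_) (G.walk_ae_zero z)
    simp only [Set.mem_preimage, Set.mem_compl_iff, Set.mem_ofPred_eq, cons] at hω ⊢
    rintro rfl
    exact hω (G.mem_stepFin.1 hz)
  | succ n ih =>
    rw [walk_apply _ _ (hm (n + 1))]
    exact Finset.sum_eq_zero fun z _ => mul_eq_zero_of_right _ (ih z)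

/-- A map that respects the possible steps from all points at distance less than `n` from `x`
carries the walk up to time `n` to the walk up to time `n`. -/
theorem walk_map_min {G G' : LFGraph} (φ : G.V → G'.V) (n : ℕ) (x : G.V)
    (h : ∀ y, G.graph.dist x y < n → Set.BijOn φ (G.stepSet y) (G'.stepSet (φ y))) :
    (G.walk x).map (fun ω i => φ (ω (min i n))) =
      (G'.walk (φ x)).map (fun ω i => ω (min i n)) := by
  have hφ : Measurable φ := measurable_from_top
  have hm : ∀ n, Measurable fun (ω : ℕ → G.V) i => φ (ω (min i n)) := fun n =>
    measurable_pi_lambda _ fun i => hφ.comp (measurable_pi_apply _)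
  have hm' : ∀ n, Measurable fun (ω : ℕ → G'.V) i => ω (min i n) := fun n =>
    measurable_pi_lambda _ fun i => measurable_pi_apply _
  induction n generalizing x with
  | zero =>
    have h1 : (fun (ω : ℕ → G.V) (i : ℕ) => φ (ω (min i 0))) =ᵐ[G.walk x] fun _ _ => φ x := by
      filter_upwards [G.walk_ae_zero x] with ω hω
      simp [hω]
    have h2 : (fun (ω : ℕ → G'.V) (i : ℕ) => ω (min i 0)) =ᵐ[G'.walk (φ x)] fun _ _ => φ x := by
      filter_upwards [G'.walk_ae_zero (φ x)] with ω hω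
      simp [hω]
    rw [Measure.map_congr h1, Measure.map_congr h2]
    simp
  | succ n ih =>
    have hb := h x (by simp)
    rw [walk_eq_sum, walk_eq_sum, Measure.map_finset_sum (hm _).aemeasurable,
      Measure.map_finset_sum (hm' _).aemeasurable]
    have hcard : (G.stepFin x).card = (G'.stepFin (φ x)).card :=
      Finset.card_nbij φ (fun z hz => by simpa using hb.mapsTo (by simpa using hz))
        (fun z hz w hw => hb.injOn (by simpa using hz) (by simpa using hw))
        (fun z hz => by
          obtain ⟨w, hw, rfl⟩ := hb.surjOn (by simpa using hz)
          exact ⟨w, by simpa using hw, rfl⟩)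
    refine Finset.sum_nbij φ (fun z hz => by simpa using hb.mapsTo (by simpa using hz))
        (fun z hz w hw => hb.injOn (by simpa using hz) (by simpa using hw))
        (fun z hz => by
          obtain ⟨w, hw, rfl⟩ := hb.surjOn (by simpa using hz)
          exact ⟨w, by simpa using hw, rfl⟩) fun z hz => ?_
    rw [Measure.map_smul, Measure.map_smul, hcard, Measure.map_map (hm _) (measurable_cons _),
      Measure.map_map (hm' _) (measurable_cons _)]
    have e1 : (fun (ω : ℕ → G.V) (i : ℕ) => φ (ω (min i (n + 1)))) ∘ cons x =
        cons (φ x) ∘ fun ω i => φ (ω (min i n)) := by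
      funext ω i
      cases i with
      | zero => simp [cons]
      | succ i => simp [cons]
    have e2 : (fun (ω : ℕ → G'.V) (i : ℕ) => ω (min i (n + 1))) ∘ cons (φ x) =
        cons (φ x) ∘ fun ω i => ω (min i n) := by
      funext ω i
      cases i with
      | zero => simp [cons]
      | succ i => simp [cons]
    rw [e1, e2, ← Measure.map_map (measurable_cons _) (hm _),
      ← Measure.map_map (measurable_cons _) (hm' _), ih z fun y hy => h y ?_]
    have := G.dist_triangle x z y
    have := G.dist_le_one_of_mem_stepSet (G.mem_stepFin.1 hz)
    omega

end LFGraph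

namespace LFGraph

variable (G : LFGraph)

/-! ### Balls -/

theorem exists_adj_dist {x z : G.V} {r : ℕ} (h : G.graph.dist x z = r + 1) :
    ∃ y, G.graph.Adj y z ∧ G.graph.dist x y = r := by
  obtain ⟨p, hp⟩ := G.connected.exists_walk_length_eq_dist z x
  rw [SimpleGraph.dist_comm, h] at hp
  cases p with
  | nil => simp at hp
  | @cons _ y _ hzy q =>
    refine ⟨y, hzy.symm, ?_⟩
    have h1 : G.graph.dist y x ≤ r := by
      have := SimpleGraph.dist_le q
      simp only [SimpleGraph.Walk.length_cons] at hp
      omega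
    have h2 := G.dist_triangle x y z
    have h3 : G.graph.dist y z = 1 := SimpleGraph.dist_eq_one_iff_adj.2 hzy.symm
    rw [SimpleGraph.dist_comm] at h1
    omega

theorem ball_zero (x : G.V) : G.ball x 0 = {x} := by
  ext y
  simp only [ball, nonpos_iff_eq_zero, Set.mem_ofPred_eq, Set.mem_singleton_iff]
  rw [G.connected.dist_eq_zero_iff]
  exact eq_comm

theorem ball_succ_subset (x : G.V) (r : ℕ) :
    G.ball x (r + 1) ⊆ ⋃ y ∈ G.ball x r, insert y (G.stepSet y) := by
  intro z hz
  simp only [Set.mem_iUnion, Set.mem_insert_iff]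
  rcases Nat.le_succ_iff.1 (show G.graph.dist x z ≤ r + 1 from hz) with h | h
  · exact ⟨z, h, Or.inl rfl⟩
  · obtain ⟨y, hyz, hy⟩ := G.exists_adj_dist h
    exact ⟨y, hy.le, Or.inr (Or.inl hyz)⟩

theorem ball_finite (x : G.V) (r : ℕ) : (G.ball x r).Finite := by
  induction r with
  | zero => rw [ball_zero]; exact Set.finite_singleton x
  | succ r ih =>
    exact (ih.biUnion fun y _ => (G.stepSet_finite y).insert y).subset (G.ball_succ_subset x r)

/-- The ball as a finite set. -/
def ballFin (x : G.V) (r : ℕ) : Finset G.V := (G.ball_finite x r).toFinset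

@[simp] theorem mem_ballFin {x y : G.V} {r : ℕ} : y ∈ G.ballFin x r ↔ G.graph.dist x y ≤ r := by
  simp [ballFin, ball]

theorem card_ballFin (x : G.V) (r : ℕ) : (G.ballFin x r).card = (G.ball x r).ncard :=
  (Set.ncard_eq_toFinset_card _ (G.ball_finite x r)).symm

theorem card_ballFin_pos (x : G.V) (r : ℕ) : 0 < (G.ballFin x r).card :=
  Finset.card_pos.2 ⟨x, by simp⟩

theorem card_stepFin_le {x : G.V} {K : ℕ} (hK : 1 ≤ K) (h : G.degree x ≤ K) :
    (G.stepFin x).card ≤ K := by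
  rw [stepFin, ← Set.ncard_eq_toFinset_card _ (G.stepSet_finite x)]
  by_cases hx : ∃ z, G.graph.Adj x z
  · have : G.stepSet x = G.graph.neighborSet x := by
      ext y
      obtain ⟨z, hz⟩ := hx
      exact ⟨fun hy => hy.elim id fun hy => absurd hz (hy.2 z), Or.inl⟩
    rw [this]
    exact h
  · have : G.stepSet x ⊆ {x} := by
      rintro y (hy | hy)
      · exact absurd ⟨y, hy⟩ hx
      · exact hy.1
    exact (Set.ncard_le_ncard this).trans (by simpa using hK)

theorem card_ballFin_le {K : ℕ} (hK : 1 ≤ K) (h : ∀ y, G.degree y ≤ K) (x : G.V) (r : ℕ) :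
    (G.ballFin x r).card ≤ (K + 1) ^ r := by
  classical
  induction r with
  | zero =>
    have : G.ballFin x 0 = {x} := by
      ext y
      have := Set.ext_iff.1 (G.ball_zero x) y
      simpa [ball] using this
    simp [this]
  | succ r ih =>
    have hsub : G.ballFin x (r + 1) ⊆ (G.ballFin x r).biUnion fun y => insert y (G.stepFin y) := by
      intro z hz
      have := G.ball_succ_subset x r (show z ∈ G.ball x (r + 1) from G.mem_ballFin.1 hz)
      simpa [ball] using this
    calc (G.ballFin x (r + 1)).card ≤ _ := Finset.card_le_card hsub
      _ ≤ (G.ballFin x r).card * (K + 1) := Finset.card_biUnion_le_card_mul _ _ _ fun y _ =>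
          (Finset.card_insert_le _ _).trans (Nat.add_le_add_right (G.card_stepFin_le hK (h y)) 1)
      _ ≤ (K + 1) ^ (r + 1) := by rw [pow_succ]; exact Nat.mul_le_mul_right _ ih

/-! ### Transition probabilities -/

/-- The Markov operator of the simple random walk: averages over one step. -/
def avg (f : G.V → ℝ) (x : G.V) : ℝ := (∑ z ∈ G.stepFin x, f z) / (G.stepFin x).card

/-- The probability that the walk started from `x` is at `y` at time `n`. -/
def prob (n : ℕ) (x y : G.V) : ℝ := (G.walk x).real {ω | ω n = y}

theorem cast_card_stepFin_pos (x : G.V) : (0 : ℝ) < (G.stepFin x).card :=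
  Nat.cast_pos.2 (G.stepFin_card_pos x)

theorem avg_const (c : ℝ) (x : G.V) : G.avg (fun _ => c) x = c := by
  have := (G.cast_card_stepFin_pos x).ne'
  simp only [avg, Finset.sum_const, nsmul_eq_mul]
  field_simp

theorem avg_mono {f g : G.V → ℝ} {x : G.V} (h : ∀ z ∈ G.stepFin x, f z ≤ g z) :
    G.avg f x ≤ G.avg g x :=
  div_le_div_of_nonneg_right (Finset.sum_le_sum h) (Nat.cast_nonneg _)

theorem prob_nonneg (n : ℕ) (x y : G.V) : 0 ≤ G.prob n x y := measureReal_nonneg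

theorem measurableSet_coord (n : ℕ) (y : G.V) : MeasurableSet {ω : ℕ → G.V | ω n = y} :=
  (measurable_pi_apply n : Measurable fun ω : ℕ → G.V => ω n) (measurableSet_singleton y)

theorem prob_zero [DecidableEq G.V] (x y : G.V) : G.prob 0 x y = if y = x then 1 else 0 := by
  have h := G.walk_cylinder_zero x (fun _ => y)
  have h2 : {ω : ℕ → G.V | ∀ i ≤ 0, ω i = y} = {ω | ω 0 = y} := by ext; simp
  rw [h2] at h
  rw [prob, measureReal_def, h]
  split_ifs <;> simp

theorem prob_succ (n : ℕ) (x y : G.V) :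
    G.prob (n + 1) x y = G.avg (fun z => G.prob n z y) x := by
  rw [prob, measureReal_def, walk_apply _ _ (G.measurableSet_coord _ _), ENNReal.toReal_sum]
  · rw [avg, Finset.sum_div]
    refine Finset.sum_congr rfl fun z _ => ?_
    rw [ENNReal.toReal_mul, ENNReal.toReal_inv, ENNReal.toReal_natCast, mul_comm, ← div_eq_mul_inv]
    rfl
  · intro z _
    exact ENNReal.mul_ne_top (by simpa using (G.stepFin_card_pos x).ne') (measure_ne_top _ _)

theorem prob_eq_zero {n : ℕ} {x y : G.V} (h : n < G.graph.dist x y) : G.prob n x y = 0 := by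
  classical
  induction n generalizing x with
  | zero =>
    rw [prob_zero, if_neg]
    rintro rfl
    simp at h
  | succ n ih =>
    rw [prob_succ, avg, Finset.sum_eq_zero, zero_div]
    intro z hz
    refine ih ?_
    have := G.dist_triangle x z y
    have := G.dist_le_one_of_mem_stepSet (G.mem_stepFin.1 hz)
    omega

/-- The powers of the Markov operator are given by the transition probabilities. -/
theorem avg_iterate (f : G.V → ℝ) (n : ℕ) (x : G.V) (t : Finset G.V) (ht : G.ballFin x n ⊆ t) :
    G.avg^[n] f x = ∑ y ∈ t, G.prob n x y * f y := by
  classical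
  induction n generalizing x with
  | zero =>
    have hx : x ∈ t := ht (by simp)
    simp [prob_zero, hx]
  | succ n ih =>
    rw [Function.iterate_succ_apply']
    have h1 : ∀ z ∈ G.stepFin x, G.avg^[n] f z = ∑ y ∈ t, G.prob n z y * f y := fun z hz => by
      refine ih z fun y hy => ht ?_
      have := G.dist_triangle x z y
      have := G.dist_le_one_of_mem_stepSet (G.mem_stepFin.1 hz)
      rw [mem_ballFin] at hy ⊢
      omega
    rw [avg, Finset.sum_congr rfl h1, Finset.sum_comm, Finset.sum_div]
    refine Finset.sum_congr rfl fun y _ => ?_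
    rw [prob_succ, avg, ← Finset.sum_mul]
    ring

theorem sum_prob (n : ℕ) (x : G.V) (t : Finset G.V) (ht : G.ballFin x n ⊆ t) :
    ∑ y ∈ t, G.prob n x y = 1 := by
  have h := G.avg_iterate (fun _ => 1) n x t ht
  have h2 : G.avg (fun _ => 1) = fun _ => 1 := funext fun x => G.avg_const 1 x
  rw [Function.iterate_fixed h2] at h
  simpa using h.symm

theorem prob_le_one (n : ℕ) (x y : G.V) : G.prob n x y ≤ 1 := measureReal_le_one

theorem prob_eq_iterate [DecidableEq G.V] (n : ℕ) (x y : G.V) :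
    G.prob n x y = G.avg^[n] (Pi.single y 1) x := by
  rw [G.avg_iterate _ n x (insert y (G.ballFin x n)) (Finset.subset_insert _ _)]
  simp [Pi.single_apply]

/-- The walk takes its last step from its position at time `n`. -/
theorem prob_succ' [DecidableEq G.V] (n : ℕ) (x y : G.V) (t : Finset G.V)
    (ht : G.ballFin x n ⊆ t) :
    G.prob (n + 1) x y = ∑ z ∈ t, G.prob n x z * G.avg (Pi.single y 1) z := by
  rw [prob_eq_iterate, Function.iterate_succ_apply, G.avg_iterate _ n x t ht]

theorem prob_dist_pos {n : ℕ} {x y : G.V} (h : G.graph.dist x y = n) : 0 < G.prob n x y := by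
  classical
  induction n generalizing x with
  | zero =>
    rw [G.connected.dist_eq_zero_iff] at h
    simp [prob_zero, h]
  | succ n ih =>
    rw [SimpleGraph.dist_comm] at h
    obtain ⟨z, hzx, hz⟩ := G.exists_adj_dist h
    rw [SimpleGraph.dist_comm] at hz
    rw [prob_succ]
    exact div_pos (Finset.sum_pos' (fun w _ => G.prob_nonneg n w y)
      ⟨z, G.mem_stepFin.2 (Or.inl hzx.symm), ih hz⟩) (G.cast_card_stepFin_pos x)

/-! ### Entropy of the walk and the entropy gained in the first step -/

theorem entropy_eq_sum (n : ℕ) (x : G.V) (t : Finset G.V) (ht : G.ballFin x n ⊆ t) :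
    G.entropy x n = ∑ y ∈ t, Real.negMulLog (G.prob n x y) := by
  refine tsum_eq_sum fun y hy => ?_
  have : G.prob n x y = 0 := G.prob_eq_zero (by
    by_contra! h
    exact hy (ht (G.mem_ballFin.2 h)))
  change Real.negMulLog (G.prob n x y) = 0
  simp [this]

theorem entropy_nonneg (n : ℕ) (x : G.V) : 0 ≤ G.entropy x n := by
  rw [G.entropy_eq_sum n x _ subset_rfl]
  exact Finset.sum_nonneg fun y _ =>
    Real.negMulLog_nonneg (G.prob_nonneg n x y) (G.prob_le_one n x y)

theorem entropy_zero (x : G.V) : G.entropy x 0 = 0 := by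
  classical
  rw [G.entropy_eq_sum 0 x _ subset_rfl]
  refine Finset.sum_eq_zero fun y _ => ?_
  rw [prob_zero]
  split_ifs <;> simp

theorem entropy_le_log_card (n : ℕ) (x : G.V) :
    G.entropy x n ≤ Real.log (G.ballFin x n).card := by
  rw [G.entropy_eq_sum n x _ subset_rfl]
  refine (sum_negMulLog_le _ _ fun y _ => G.prob_nonneg n x y).trans ?_
  simp [G.sum_prob n x _ subset_rfl]

/-- The mutual information of the first step and the position at time `n + 1` of the walk started
from `x`, written as a difference of entropies. -/
def gain (n : ℕ) (x : G.V) : ℝ := G.entropy x (n + 1) - G.avg (fun z => G.entropy z n) x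

theorem ballFin_subset_of_mem_stepFin {x z : G.V} (hz : z ∈ G.stepFin x) (n : ℕ) :
    G.ballFin z n ⊆ G.ballFin x (n + 1) := fun y hy => by
  have := G.dist_triangle x z y
  have := G.dist_le_one_of_mem_stepSet (G.mem_stepFin.1 hz)
  rw [mem_ballFin] at hy ⊢
  omega

theorem gain_eq (n : ℕ) (x : G.V) (t : Finset G.V) (ht : G.ballFin x (n + 1) ⊆ t) :
    G.gain n x =
      G.avg (fun z => ∑ y ∈ t, klTerm (G.prob n z y) (G.prob (n + 1) x y)) x := by
  rw [gain, avg, avg, ← sum_negMulLog_mean _ _ _ _ _ fun y _ => G.prob_succ n x y,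
    G.entropy_eq_sum _ x t ht]
  congr 2
  exact Finset.sum_congr rfl fun z hz =>
    G.entropy_eq_sum n z t ((G.ballFin_subset_of_mem_stepFin hz n).trans ht)

theorem prob_eq_zero_of_prob_succ {n : ℕ} {x z : G.V} (hz : z ∈ G.stepFin x) {y : G.V}
    (h : G.prob (n + 1) x y = 0) : G.prob n z y = 0 := by
  rw [prob_succ, avg, div_eq_zero_iff, or_iff_left (G.cast_card_stepFin_pos x).ne'] at h
  exact (Finset.sum_eq_zero_iff_of_nonneg fun w _ => G.prob_nonneg n w y).1 h z hz

theorem gain_antitone (x : G.V) : Antitone fun n => G.gain n x := by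
  classical
  refine antitone_nat_of_succ_le fun n => ?_
  rw [G.gain_eq n x _ subset_rfl, G.gain_eq (n + 1) x _ subset_rfl]
  refine G.avg_mono fun z hz => ?_
  have h1 := fun y => G.prob_succ' n z y _ (G.ballFin_subset_of_mem_stepFin hz n)
  have h2 := fun y => G.prob_succ' (n + 1) x y _ subset_rfl
  simp only [h1, h2]
  refine sum_klTerm_kernel_le _ _ _ _ (fun u y => G.avg (Pi.single y 1) u)
    (fun u _ => G.prob_nonneg n z u) (fun u _ => G.prob_nonneg (n + 1) x u)
    (fun u _ => G.prob_eq_zero_of_prob_succ hz) (fun u _ y _ => ?_) fun u hu => ?_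
  · exact div_nonneg (Finset.sum_nonneg fun w _ => by
      rw [Pi.single_apply]; split_ifs <;> simp) (Nat.cast_nonneg _)
  · have := fun y => (G.prob_eq_iterate 1 u y).symm
    simp only [Function.iterate_one] at this
    simp only [this]
    refine G.sum_prob 1 u _ fun y hy => ?_
    have := G.dist_triangle x u y
    rw [mem_ballFin] at hu hy ⊢
    omega

theorem sq_sum_abs_prob_sub_le (n : ℕ) {x z : G.V} (hz : z ∈ G.stepFin x) :
    (∑ y ∈ G.ballFin x (n + 1), |G.prob n z y - G.prob (n + 1) x y|) ^ 2 ≤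
      4 * (G.stepFin x).card * G.gain n x := by
  have hp : ∀ w ∈ G.stepFin x,
      (∑ y ∈ G.ballFin x (n + 1), |G.prob n w y - G.prob (n + 1) x y|) ^ 2 ≤
        4 * ∑ y ∈ G.ballFin x (n + 1), klTerm (G.prob n w y) (G.prob (n + 1) x y) := fun w hw =>
    sq_sum_abs_sub_le _ _ _ (fun y _ => G.prob_nonneg _ _ _) (fun y _ => G.prob_nonneg _ _ _)
      (fun y _ => G.prob_eq_zero_of_prob_succ hw)
      (G.sum_prob n w _ (G.ballFin_subset_of_mem_stepFin hw n)) (G.sum_prob _ x _ subset_rfl)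
  refine (hp z hz).trans ?_
  rw [G.gain_eq n x _ subset_rfl, avg, mul_assoc,
    mul_div_cancel₀ _ (G.cast_card_stepFin_pos x).ne']
  refine mul_le_mul_of_nonneg_left ?_ (by norm_num)
  refine Finset.single_le_sum (f := fun z =>
    ∑ y ∈ G.ballFin x (n + 1), klTerm (G.prob n z y) (G.prob (n + 1) x y)) (fun w hw => ?_) hz
  have := (sq_nonneg _).trans (hp w hw)
  linarith

theorem gain_nonneg (n : ℕ) (x : G.V) : 0 ≤ G.gain n x := by
  obtain ⟨z, hz⟩ := Finset.card_pos.1 (G.stepFin_card_pos x)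
  have h := (sq_nonneg _).trans (G.sq_sum_abs_prob_sub_le n hz)
  have := G.cast_card_stepFin_pos x
  by_contra! hneg
  have : 4 * ((G.stepFin x).card : ℝ) * G.gain n x < 0 := mul_neg_of_pos_of_neg (by positivity) hneg
  linarith

/-! ### The Liouville property -/

/-- If the information about the first step vanishes in the limit, then a bounded harmonic function
takes the same value before and after the first step. -/
theorem eq_of_gain_tendsto {f : G.V → ℝ} {C : ℝ} (hC : ∀ x, |f x| ≤ C) (hf : G.avg f = f)
    {x z : G.V} (hz : z ∈ G.stepFin x) (h : Tendsto (fun n => G.gain n x) atTop (𝓝 0)) :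
    f z = f x := by
  have hit : ∀ n, G.avg^[n] f = f := fun n => Function.iterate_fixed hf n
  have hb : ∀ n, (f z - f x) ^ 2 ≤ C ^ 2 * (4 * (G.stepFin x).card * G.gain n x) := by
    intro n
    have h1 := G.avg_iterate f n z _ (G.ballFin_subset_of_mem_stepFin hz n)
    have h2 := G.avg_iterate f (n + 1) x _ subset_rfl
    rw [hit] at h1 h2
    have h3 : |f z - f x| ≤
        C * ∑ y ∈ G.ballFin x (n + 1), |G.prob n z y - G.prob (n + 1) x y| := by
      rw [h1, h2, ← Finset.sum_sub_distrib, Finset.mul_sum]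
      refine (Finset.abs_sum_le_sum_abs _ _).trans (Finset.sum_le_sum fun y _ => ?_)
      rw [← sub_mul, abs_mul, mul_comm]
      exact mul_le_mul_of_nonneg_right (hC y) (abs_nonneg _)
    calc (f z - f x) ^ 2 = |f z - f x| ^ 2 := (sq_abs _).symm
      _ ≤ (C * ∑ y ∈ G.ballFin x (n + 1), |G.prob n z y - G.prob (n + 1) x y|) ^ 2 :=
        pow_le_pow_left₀ (abs_nonneg _) h3 2
      _ ≤ _ := by
        rw [mul_pow]
        exact mul_le_mul_of_nonneg_left (G.sq_sum_abs_prob_sub_le n hz) (sq_nonneg C)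
  have hlim := (h.const_mul (4 * ((G.stepFin x).card : ℝ))).const_mul (C ^ 2)
  rw [mul_zero, mul_zero] at hlim
  have := ge_of_tendsto' hlim hb
  have : f z - f x = 0 := pow_eq_zero_iff two_ne_zero |>.1 (le_antisymm this (sq_nonneg _))
  linarith

theorem isLiouville_of_gain_tendsto (h : ∀ x, Tendsto (fun n => G.gain n x) atTop (𝓝 0)) :
    G.IsLiouville := by
  rintro f ⟨C, hC⟩ hf
  by_cases hiso : ∃ x, ∀ z, ¬ G.graph.Adj x z
  · -- a connected graph with an isolated vertex has no other vertex
    obtain ⟨x, hx⟩ := hiso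
    have : ∀ y, y = x := fun y => by
      obtain ⟨p⟩ := G.connected x y
      cases p with
      | nil => rfl
      | cons hadj _ => exact absurd hadj (hx _)
    intro y z
    rw [this y, this z]
  · push Not at hiso
    have hstep : ∀ x, G.stepFin x = (G.locallyFinite x).toFinset := fun x => by
      ext y
      obtain ⟨w, hw⟩ := hiso x
      simp only [mem_stepFin, Set.Finite.mem_toFinset, SimpleGraph.mem_neighborSet]
      exact ⟨fun hy => hy.elim id fun hy => absurd hw (hy.2 w), Or.inl⟩
    have havg : G.avg f = f := funext fun x => by
      rw [hf x, avg, degree, Set.ncard_eq_toFinset_card _ (G.locallyFinite x), hstep]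
    intro x y
    obtain ⟨p⟩ := G.connected x y
    induction p with
    | nil => rfl
    | @cons u v w hadj _ ih =>
      rw [← ih]
      exact (G.eq_of_gain_tendsto hC havg (G.mem_stepFin.2 (Or.inl hadj)) (h u)).symm

/-! ### Splitting the entropy along a ball -/

/-- The walk is at distance greater than `r` with probability `1 - ∑ y ∈ B(x, r), p_n(x, y)`;
outside of `B(x, r)` the entropy is bounded through the size of `B(x, n)`. -/
theorem entropy_le_log_ball (n r : ℕ) (x : G.V) :
    G.entropy x n ≤ 2 + Real.log (G.ballFin x r).card +
      (1 - ∑ y ∈ G.ballFin x r, G.prob n x y) * Real.log (G.ballFin x n).card := by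
  classical
  set A := G.ballFin x r
  set B := G.ballFin x n \ A
  have hunion : G.ballFin x n ⊆ A ∪ B := by
    intro y hy
    by_cases h : y ∈ A <;> simp [B, h, hy]
  have hdisj : Disjoint A B := Finset.disjoint_sdiff
  have hsum := G.sum_prob n x _ hunion
  rw [Finset.sum_union hdisj] at hsum
  rw [G.entropy_eq_sum n x _ hunion, Finset.sum_union hdisj]
  have hA0 : 0 ≤ ∑ y ∈ A, G.prob n x y := Finset.sum_nonneg fun y _ => G.prob_nonneg n x y
  have hB0 : 0 ≤ ∑ y ∈ B, G.prob n x y := Finset.sum_nonneg fun y _ => G.prob_nonneg n x y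
  have hA := sum_negMulLog_le A (G.prob n x) fun y _ => G.prob_nonneg n x y
  have hB := sum_negMulLog_le B (G.prob n x) fun y _ => G.prob_nonneg n x y
  have hlA : 0 ≤ Real.log A.card := Real.log_natCast_nonneg _
  have hlB : Real.log B.card ≤ Real.log (G.ballFin x n).card := by
    rcases B.card.eq_zero_or_pos with h | h
    · rw [h]; simpa using Real.log_natCast_nonneg _
    · exact Real.log_le_log (Nat.cast_pos.2 h)
        (Nat.cast_le.2 (Finset.card_le_card Finset.sdiff_subset))
  have h1 : (∑ y ∈ A, G.prob n x y) * Real.log A.card ≤ Real.log A.card :=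
    mul_le_of_le_one_left hlA (by linarith)
  have h2 := mul_le_mul_of_nonneg_left hlB hB0
  have h3 := negMulLog_le_one hA0
  have h4 := negMulLog_le_one hB0
  have h5 : 1 - ∑ y ∈ A, G.prob n x y = ∑ y ∈ B, G.prob n x y := by linarith
  rw [h5]
  linarith

end LFGraph

/-! ### The Varopoulos–Carne bound -/

section Chebyshev

variable {E : Type*} [AddCommGroup E] [Module ℝ E] (P : E →ₗ[ℝ] E) (v : E)

/-- The vectors `(T_k(P) v, U_{k-1}(P) v)`, with `T` and `U` the Chebyshev polynomials of the first
and second kind, through the addition formulas of `cos` and `sin`. -/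
def chebyshevPair : ℕ → E × E
  | 0 => (v, 0)
  | k + 1 =>
    (P (chebyshevPair k).1 - ((chebyshevPair k).2 - P (P (chebyshevPair k).2)),
      (chebyshevPair k).1 + P (chebyshevPair k).2)

theorem map_chebyshevPair_zero : P (chebyshevPair P v 0).1 = (chebyshevPair P v 1).1 := by
  simp [chebyshevPair]

theorem map_chebyshevPair_succ (k : ℕ) : P (chebyshevPair P v (k + 1)).1 =
    (1 / 2 : ℝ) • ((chebyshevPair P v (k + 2)).1 + (chebyshevPair P v k).1) := by
  have h : (chebyshevPair P v k).1 = P (chebyshevPair P v (k + 1)).1 +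
      ((chebyshevPair P v (k + 1)).2 - P (P (chebyshevPair P v (k + 1)).2)) := by
    simp only [chebyshevPair, map_sub, map_add]
    abel
  have h2 : (chebyshevPair P v (k + 2)).1 = P (chebyshevPair P v (k + 1)).1 -
      ((chebyshevPair P v (k + 1)).2 - P (P (chebyshevPair P v (k + 1)).2)) := by
    rw [chebyshevPair]
  rw [h2, h]
  module

variable (B : E →ₗ[ℝ] E →ₗ[ℝ] ℝ)

/-- The form of the identity `T_k² + (1 - X²) U_{k-1}² = 1` for a symmetric operator. -/
theorem chebyshevPair_energy (hB : ∀ f g, B f g = B g f) (hP : ∀ f g, B (P f) g = B f (P g))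
    (k : ℕ) :
    B (chebyshevPair P v k).1 (chebyshevPair P v k).1 +
      (B (chebyshevPair P v k).2 (chebyshevPair P v k).2 -
        B (P (chebyshevPair P v k).2) (P (chebyshevPair P v k).2)) = B v v := by
  induction k with
  | zero => simp [chebyshevPair]
  | succ k ih =>
    rw [← ih]
    simp only [chebyshevPair]
    generalize (chebyshevPair P v k).1 = w
    generalize (chebyshevPair P v k).2 = u
    simp only [map_sub, map_add, LinearMap.sub_apply, LinearMap.add_apply]
    have h1 := hB w (P u)
    have h2 := hP w u
    have h3 := hB (P w) (P (P u))
    have h4 := hB (P w) u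
    have h5 := hP w (P (P u))
    have h6 := hP u (P (P u))
    have h7 := hP u (P u)
    have h8 := hP (P u) (P (P u))
    have h9 := hB u (P (P u))
    have h10 := hP (P u) u
    have h11 := hP (P w) (P u)
    linarith

variable {P v B}

/-- An abstract Varopoulos–Carne bound for a symmetric contraction `P`: the functional `ℓ` vanishes
on `T_k(P) v` for `k < d` and is bounded by `C` on all `T_k(P) v`. Writing `P^n` through the
`T_k(P)` by means of the simple random walk on `ℤ`, and estimating the latter by its exponential
moments, gives the Gaussian factor. -/
theorem abs_apply_pow_le (hB : ∀ f g, B f g = B g f) (hP : ∀ f g, B (P f) g = B f (P g))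
    (hcontr : ∀ f, B (P f) (P f) ≤ B f f) (ℓ : E →ₗ[ℝ] ℝ) {C : ℝ} (hC : 0 ≤ C)
    (hℓ : ∀ f, B f f ≤ B v v → |ℓ f| ≤ C) {d : ℕ}
    (h0 : ∀ k < d, ℓ (chebyshevPair P v k).1 = 0) {n : ℕ} (hn : 0 < n) :
    |ℓ ((P ^ n) v)| ≤ 2 * C * Real.exp (-(d : ℝ) ^ 2 / (2 * n)) := by
  have key : ∀ l : ℝ, 0 ≤ l → ∀ n k : ℕ, |ℓ ((P ^ n) (chebyshevPair P v k).1)| ≤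
      2 * C * Real.exp (-(l * d)) * Real.cosh l ^ n * Real.cosh (l * k) := by
    intro l hl n
    induction n with
    | zero =>
      intro k
      simp only [pow_zero, Module.End.one_apply, mul_one]
      rcases lt_or_ge k d with hk | hk
      · rw [h0 k hk, abs_zero]
        have := Real.cosh_pos (l * k)
        positivity
      · have h1 : |ℓ (chebyshevPair P v k).1| ≤ C := by
          refine hℓ _ ?_
          have := chebyshevPair_energy P v B hB hP k
          have := hcontr (chebyshevPair P v k).2
          linarith
        have h2 : 1 ≤ 2 * Real.exp (-(l * d)) * Real.cosh (l * k) := by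
          rw [Real.cosh_eq]
          have h3 : 1 ≤ Real.exp (-(l * d)) * Real.exp (l * k) := by
            rw [← Real.exp_add]
            refine Real.one_le_exp ?_
            have := mul_le_mul_of_nonneg_left (Nat.cast_le (α := ℝ).2 hk) hl
            linarith
          have h4 : 0 < Real.exp (-(l * d)) * Real.exp (-(l * k)) := by positivity
          linarith
        calc _ ≤ C * 1 := by linarith
          _ ≤ C * (2 * Real.exp (-(l * d)) * Real.cosh (l * k)) := mul_le_mul_of_nonneg_left h2 hC
          _ = _ := by ring
    | succ n ih =>
      intro k
      rw [pow_succ, Module.End.mul_apply]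
      cases k with
      | zero =>
        rw [map_chebyshevPair_zero]
        refine (ih 1).trans (le_of_eq ?_)
        simp
        ring
      | succ k =>
        rw [map_chebyshevPair_succ, map_smul, map_smul, map_add, map_add, smul_eq_mul, abs_mul,
          abs_of_nonneg (by norm_num : (0 : ℝ) ≤ 1 / 2)]
        have h1 := ih (k + 2)
        have h2 := ih k
        have h3 := abs_add_le (ℓ ((P ^ n) (chebyshevPair P v (k + 2)).1))
          (ℓ ((P ^ n) (chebyshevPair P v k).1))
        have h4 : Real.cosh (l * ((k + 2 : ℕ) : ℝ)) + Real.cosh (l * (k : ℝ)) =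
            2 * (Real.cosh l * Real.cosh (l * ((k + 1 : ℕ) : ℝ))) := by
          have e1 : l * ((k + 2 : ℕ) : ℝ) = l * ((k + 1 : ℕ) : ℝ) + l := by push_cast; ring
          have e2 : l * (k : ℝ) = l * ((k + 1 : ℕ) : ℝ) - l := by push_cast; ring
          rw [e1, e2, Real.cosh_add, Real.cosh_sub]
          ring
        have h5 : 2 * C * Real.exp (-(l * d)) * Real.cosh l ^ (n + 1) *
            Real.cosh (l * ((k + 1 : ℕ) : ℝ)) = 1 / 2 * (2 * C * Real.exp (-(l * d)) *
              Real.cosh l ^ n * (Real.cosh (l * ((k + 2 : ℕ) : ℝ)) + Real.cosh (l * (k : ℝ)))) := by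
          rw [h4]; ring
        rw [h5]
        linarith
  have hn' : (0 : ℝ) < n := Nat.cast_pos.2 hn
  -- the choice `l = d / n` is optimal
  have h := key (d / n) (by positivity) n 0
  simp only [chebyshevPair, Nat.cast_zero, mul_zero, Real.cosh_zero, mul_one] at h
  refine h.trans ?_
  rw [mul_assoc]
  refine mul_le_mul_of_nonneg_left ?_ (by positivity)
  calc Real.exp (-((d : ℝ) / n * d)) * Real.cosh ((d : ℝ) / n) ^ n
      ≤ Real.exp (-((d : ℝ) / n * d)) * Real.exp (((d : ℝ) / n) ^ 2 / 2) ^ n := by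
        gcongr
        exact Real.cosh_le_exp_half_sq _
    _ = Real.exp (-(d : ℝ) ^ 2 / (2 * n)) := by
        rw [← Real.exp_nat_mul, ← Real.exp_add]
        congr 1
        field_simp
        ring

end Chebyshev

namespace LFGraph

variable (G : LFGraph)

/-- The Markov operator on finitely supported functions. -/
def avgLin : (G.V →₀ ℝ) →ₗ[ℝ] (G.V →₀ ℝ) :=
  Finsupp.linearCombination ℝ fun y =>
    ∑ x ∈ G.stepFin y, Finsupp.single x ((G.stepFin x).card : ℝ)⁻¹

/-- The inner product of finitely supported functions for the reversible measure
`x ↦ #(G.stepFin x)` of the walk. -/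
def revForm : (G.V →₀ ℝ) →ₗ[ℝ] (G.V →₀ ℝ) →ₗ[ℝ] ℝ :=
  Finsupp.linearCombination ℝ fun y => ((G.stepFin y).card : ℝ) • Finsupp.lapply y

theorem avgLin_apply (f : G.V →₀ ℝ) (x : G.V) : G.avgLin f x = G.avg f x := by
  classical
  induction f using Finsupp.induction_linear with
  | zero => simp [avg]
  | add f g hf hg =>
    rw [map_add, Finsupp.add_apply, hf, hg]
    simp [avg, Finset.sum_add_distrib, add_div]
  | single y c =>
    have h : y ∈ G.stepFin x ↔ x ∈ G.stepFin y := by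
      rw [mem_stepFin, mem_stepFin, mem_stepSet_comm]
    simp only [avgLin, Finsupp.linearCombination_single, Finsupp.smul_apply,
      Finsupp.finsetSum_apply, Finsupp.single_apply, Finset.sum_ite_eq', avg, smul_eq_mul,
      Finset.sum_ite_eq, h]
    split_ifs
    · rw [div_eq_mul_inv]
    · simp

theorem coe_avgLin_pow (f : G.V →₀ ℝ) (n : ℕ) : ⇑((G.avgLin ^ n) f) = G.avg^[n] f := by
  induction n with
  | zero => rfl
  | succ n ih =>
    rw [pow_succ', Function.iterate_succ_apply', Module.End.mul_apply, ← ih]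
    exact funext fun x => G.avgLin_apply _ x

theorem revForm_apply (f g : G.V →₀ ℝ) (t : Finset G.V) (ht : f.support ⊆ t) :
    G.revForm f g = ∑ y ∈ t, ((G.stepFin y).card : ℝ) * (f y * g y) := by
  rw [revForm, Finsupp.linearCombination_apply, LinearMap.finsupp_sum_apply,
    Finsupp.sum_of_support_subset _ ht _ (by simp)]
  refine Finset.sum_congr rfl fun y _ => ?_
  simp only [LinearMap.smul_apply, Finsupp.lapply_apply, smul_eq_mul]
  ring

theorem revForm_comm (f g : G.V →₀ ℝ) : G.revForm f g = G.revForm g f := by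
  classical
  rw [G.revForm_apply f g (f.support ∪ g.support) Finset.subset_union_left,
    G.revForm_apply g f (f.support ∪ g.support) Finset.subset_union_right]
  exact Finset.sum_congr rfl fun y _ => by ring

theorem revForm_avgLin (f g : G.V →₀ ℝ) :
    G.revForm (G.avgLin f) g = G.revForm f (G.avgLin g) := by
  classical
  have h1 : ∀ (y z : G.V) (a b : ℝ), G.revForm (Finsupp.single y a)
      (G.avgLin (Finsupp.single z b)) = if z ∈ G.stepFin y then a * b else 0 := by
    intro y z a b
    rw [G.revForm_apply _ _ {y} Finsupp.support_single_subset, Finset.sum_singleton, avgLin_apply,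
      avg]
    have := (G.cast_card_stepFin_pos y).ne'
    simp only [Finsupp.single_apply, Finset.sum_ite_eq, if_true]
    split_ifs
    · field_simp
    · simp
  induction f using Finsupp.induction_linear with
  | zero => simp
  | add f₁ f₂ h₁ h₂ => simp only [map_add, LinearMap.add_apply, h₁, h₂]
  | single y a =>
    induction g using Finsupp.induction_linear with
    | zero => simp
    | add f₁ f₂ h₁ h₂ => simp only [map_add, h₁, h₂]
    | single z b =>
      rw [revForm_comm, h1, h1]
      simp only [mem_stepFin, G.mem_stepSet_comm (x := z)]
      split_ifs
      · ring
      · rfl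

/-- The Markov operator is a contraction, by the Cauchy–Schwarz inequality. -/
theorem revForm_avgLin_le (f : G.V →₀ ℝ) :
    G.revForm (G.avgLin f) (G.avgLin f) ≤ G.revForm f f := by
  classical
  set t := (G.avgLin f).support
  set s := f.support ∪ t.biUnion G.stepFin
  rw [G.revForm_apply _ _ t subset_rfl, G.revForm_apply f f s Finset.subset_union_left]
  calc ∑ x ∈ t, ((G.stepFin x).card : ℝ) * (G.avgLin f x * G.avgLin f x)
      ≤ ∑ x ∈ t, ∑ y ∈ G.stepFin x, f y ^ 2 := by
        refine Finset.sum_le_sum fun x _ => ?_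
        have hc := G.cast_card_stepFin_pos x
        have := sq_sum_le_card_mul_sum_sq (s := G.stepFin x) (f := f)
        rw [avgLin_apply, avg]
        have e : ((G.stepFin x).card : ℝ) * ((∑ z ∈ G.stepFin x, f z) / (G.stepFin x).card *
            ((∑ z ∈ G.stepFin x, f z) / (G.stepFin x).card)) =
            (∑ z ∈ G.stepFin x, f z) ^ 2 / (G.stepFin x).card := by
          field_simp
        rw [e, div_le_iff₀ hc]
        linarith
    _ = ∑ x ∈ t, ∑ y ∈ s, if y ∈ G.stepFin x then f y ^ 2 else 0 := by
        refine Finset.sum_congr rfl fun x hx => ?_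
        rw [Finset.sum_ite_mem, Finset.inter_eq_right.2]
        exact (Finset.subset_biUnion_of_mem G.stepFin hx).trans Finset.subset_union_right
    _ = ∑ y ∈ s, ∑ x ∈ t, if x ∈ G.stepFin y then f y ^ 2 else 0 := by
        rw [Finset.sum_comm]
        simp only [mem_stepFin]
        simp_rw [fun x y => G.mem_stepSet_comm (x := x) (y := y)]
    _ ≤ ∑ y ∈ s, ((G.stepFin y).card : ℝ) * (f y * f y) := by
        refine Finset.sum_le_sum fun y _ => ?_
        rw [Finset.sum_ite_mem, Finset.sum_const, nsmul_eq_mul, ← pow_two]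
        refine mul_le_mul_of_nonneg_right ?_ (sq_nonneg _)
        exact Nat.cast_le.2 (Finset.card_le_card Finset.inter_subset_right)

theorem avgLin_apply_eq_zero {f : G.V →₀ ℝ} {y : G.V} {r : ℕ}
    (h : ∀ z, r ≤ G.graph.dist y z → f z = 0) {z : G.V} (hz : r + 1 ≤ G.graph.dist y z) :
    G.avgLin f z = 0 := by
  rw [avgLin_apply, avg, Finset.sum_eq_zero, zero_div]
  intro w hw
  refine h w ?_
  have := G.dist_triangle y w z
  have := G.dist_le_one_of_mem_stepSet (G.mem_stepSet_comm.1 (G.mem_stepFin.1 hw))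
  omega

theorem chebyshevPair_apply_eq_zero (y : G.V) (k : ℕ) :
    (∀ z, k + 1 ≤ G.graph.dist y z →
      (chebyshevPair G.avgLin (Finsupp.single y 1) k).1 z = 0) ∧
    ∀ z, k ≤ G.graph.dist y z → (chebyshevPair G.avgLin (Finsupp.single y 1) k).2 z = 0 := by
  classical
  induction k with
  | zero =>
    refine ⟨fun z hz => ?_, fun z _ => rfl⟩
    rw [chebyshevPair, Finsupp.single_apply, if_neg]
    rintro rfl
    simp at hz
  | succ k ih =>
    refine ⟨fun z hz => ?_, fun z hz => ?_⟩
    · simp only [chebyshevPair, Finsupp.sub_apply]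
      rw [G.avgLin_apply_eq_zero ih.1 hz, ih.2 z (by omega), G.avgLin_apply_eq_zero
        (fun w hw => G.avgLin_apply_eq_zero ih.2 hw) hz]
      simp
    · simp only [chebyshevPair, Finsupp.add_apply]
      rw [ih.1 z hz, G.avgLin_apply_eq_zero ih.2 hz]
      simp

/-- The Varopoulos–Carne bound. -/
theorem prob_le_exp {n : ℕ} (hn : 0 < n) (x y : G.V) :
    G.prob n x y ≤ 2 * √((G.stepFin y).card / (G.stepFin x).card) *
      Real.exp (-(G.graph.dist x y : ℝ) ^ 2 / (2 * n)) := by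
  classical
  have hx := G.cast_card_stepFin_pos x
  have hvv : G.revForm (Finsupp.single y 1) (Finsupp.single y 1) = (G.stepFin y).card := by
    rw [G.revForm_apply _ _ {y} Finsupp.support_single_subset]
    simp
  have h := abs_apply_pow_le (v := Finsupp.single y 1) G.revForm_comm G.revForm_avgLin
    G.revForm_avgLin_le (Finsupp.lapply x)
    (Real.sqrt_nonneg ((G.stepFin y).card / (G.stepFin x).card))
    (fun f hf => ?_) (d := G.graph.dist x y) (fun k hk => ?_) hn
  · refine le_trans (le_trans (le_of_eq ?_) (le_abs_self _)) h
    rw [Finsupp.lapply_apply, coe_avgLin_pow, prob_eq_iterate, Finsupp.single_eq_pi_single]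
  · refine Real.abs_le_sqrt ?_
    rw [le_div_iff₀ hx]
    rw [hvv, G.revForm_apply f f (insert x f.support) (Finset.subset_insert _ _)] at hf
    refine le_trans (le_trans (le_of_eq ?_) (Finset.single_le_sum
      (f := fun y => ((G.stepFin y).card : ℝ) * (f y * f y))
      (fun z _ => mul_nonneg (Nat.cast_nonneg _) (mul_self_nonneg _))
      (Finset.mem_insert_self x _))) hf
    rw [Finsupp.lapply_apply]
    ring
  · exact (G.chebyshevPair_apply_eq_zero y k).1 x (by rw [SimpleGraph.dist_comm]; omega)

/-- The lower bound on the entropy that follows from the Varopoulos–Carne bound. The square of the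
distance is replaced by its tangent `2 c d - c²`. -/
theorem entropy_ge {K : ℕ} (hK : 1 ≤ K) (hdeg : ∀ y, G.degree y ≤ K) {n : ℕ} (hn : 0 < n)
    (x : G.V) (c : ℝ) :
    (2 * c * (∑ y ∈ G.ballFin x n, G.prob n x y * G.graph.dist x y) - c ^ 2) / (2 * n) -
      Real.log (2 * √K) ≤ G.entropy x n := by
  have hn' : (0 : ℝ) < n := Nat.cast_pos.2 hn
  have hK' : (0 : ℝ) < K := Nat.cast_pos.2 hK
  have hterm : ∀ y ∈ G.ballFin x n, G.prob n x y *
      ((2 * c * G.graph.dist x y - c ^ 2) / (2 * n) - Real.log (2 * √K)) ≤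
      Real.negMulLog (G.prob n x y) := by
    intro y _
    rcases (G.prob_nonneg n x y).eq_or_lt with h | h
    · simp [← h]
    · have hle : G.prob n x y ≤ 2 * √K * Real.exp (-(G.graph.dist x y : ℝ) ^ 2 / (2 * n)) := by
        refine (G.prob_le_exp hn x y).trans ?_
        have h1 : ((G.stepFin y).card : ℝ) / (G.stepFin x).card ≤ K := by
          rw [div_le_iff₀ (G.cast_card_stepFin_pos x)]
          have h2 : ((G.stepFin y).card : ℝ) ≤ K := Nat.cast_le.2 (G.card_stepFin_le hK (hdeg y))
          have h3 : (1 : ℝ) ≤ (G.stepFin x).card := Nat.one_le_cast.2 (G.stepFin_card_pos x)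
          nlinarith
        gcongr
      have hlog := Real.log_le_log h hle
      rw [Real.log_mul (by positivity) (Real.exp_pos _).ne', Real.log_exp] at hlog
      have hsq : (2 * c * G.graph.dist x y - c ^ 2) / (2 * n) ≤
          (G.graph.dist x y : ℝ) ^ 2 / (2 * n) := by
        refine div_le_div_of_nonneg_right ?_ (by positivity)
        nlinarith [sq_nonneg ((G.graph.dist x y : ℝ) - c)]
      rw [neg_div] at hlog
      rw [Real.negMulLog, neg_mul, ← mul_neg]
      exact mul_le_mul_of_nonneg_left (by linarith) h.le
  rw [G.entropy_eq_sum n x _ subset_rfl]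
  refine le_trans (le_of_eq ?_) (Finset.sum_le_sum hterm)
  have h1 := G.sum_prob n x _ subset_rfl
  have h2 : ∀ y, G.prob n x y * ((2 * c * G.graph.dist x y - c ^ 2) / (2 * n) - Real.log (2 * √K)) =
      2 * c / (2 * n) * (G.prob n x y * G.graph.dist x y) -
        G.prob n x y * (c ^ 2 / (2 * n) + Real.log (2 * √K)) := fun y => by ring
  simp only [h2, Finset.sum_sub_distrib, ← Finset.mul_sum, ← Finset.sum_mul, h1]
  ring

end LFGraph

namespace LFGraph

/-! ### Isomorphisms of balls -/

theorem dist_map_le {G G' : LFGraph} {S : Set G.V} {S' : Set G'.V}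
    (e : G.graph.induce S ≃g G'.graph.induce S') (x : S) {r : ℕ} (hS : G.ball x r ⊆ S) (y : S)
    (hy : G.graph.dist x y ≤ r) : G'.graph.dist (e x) (e y) ≤ G.graph.dist x y := by
  induction hk : G.graph.dist (x : G.V) y generalizing y with
  | zero =>
    rw [G.connected.dist_eq_zero_iff] at hk
    rw [Subtype.ext hk]
    simp
  | succ k ih =>
    obtain ⟨z, hzy, hz⟩ := G.exists_adj_dist hk
    have hzS : z ∈ S := hS (show _ ≤ r by omega)
    have h1 := ih ⟨z, hzS⟩ (by simp only; omega) hz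
    have h2 : G'.graph.Adj (e ⟨z, hzS⟩) (e y) := (e.map_adj_iff (v := ⟨z, hzS⟩) (w := y)).2 hzy
    have h3 := G'.dist_triangle (e x) (e ⟨z, hzS⟩) (e y)
    have h4 : G'.graph.dist (e ⟨z, hzS⟩ : G'.V) (e y) = 1 := SimpleGraph.dist_eq_one_iff_adj.2 h2
    omega

theorem dist_map_eq {G G' : LFGraph} {S : Set G.V} {S' : Set G'.V}
    (e : G.graph.induce S ≃g G'.graph.induce S') (x : S) {r : ℕ} (hS : G.ball x r ⊆ S)
    (hS' : G'.ball (e x) r ⊆ S') (y : S) (hy : G.graph.dist x y ≤ r) :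
    G'.graph.dist (e x) (e y) = G.graph.dist x y := by
  have h1 := dist_map_le e x hS y hy
  have h2 := dist_map_le e.symm (e x) hS' (e y) (by omega)
  rw [RelIso.symm_apply_apply, RelIso.symm_apply_apply] at h2
  omega

/-- An isomorphism of induced subgraphs restricts to every ball inside of them. -/
theorem exists_iso_ball {G G' : LFGraph} {S : Set G.V} {S' : Set G'.V}
    (e : G.graph.induce S ≃g G'.graph.induce S') (x : S) {x' : G'.V}
    (hx : (e x : G'.V) = x') {r : ℕ} (hS : G.ball x r ⊆ S) (hS' : G'.ball x' r ⊆ S') :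
    ∃ e' : G.graph.induce (G.ball x r) ≃g G'.graph.induce (G'.ball x' r),
      ∀ y (hy : y ∈ G.ball x r), (e' ⟨y, hy⟩ : G'.V) = e ⟨y, hS hy⟩ := by
  subst hx
  have h1 : ∀ y : S, (y : G.V) ∈ G.ball x r → (e y : G'.V) ∈ G'.ball (e x) r := fun y hy =>
    (dist_map_le e x hS y hy).trans hy
  have h2 : ∀ y : S', (y : G'.V) ∈ G'.ball (e x) r → (e.symm y : G.V) ∈ G.ball x r := fun y hy => by
    have := dist_map_le e.symm (e x) hS' y hy
    rw [RelIso.symm_apply_apply] at this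
    exact this.trans hy
  refine ⟨{ toFun := fun y => ⟨e ⟨y, hS y.2⟩, h1 _ y.2⟩
            invFun := fun y => ⟨e.symm ⟨y, hS' y.2⟩, h2 _ y.2⟩
            left_inv := fun y => by simp
            right_inv := fun y => by simp
            map_rel_iff' := fun {y z} => e.map_adj_iff (v := ⟨y, hS y.2⟩) (w := ⟨z, hS z.2⟩) },
    fun y hy => rfl⟩

theorem BallIso.symm {G G' : LFGraph} {ω : ℕ → G.V} {ω' : ℕ → G'.V} {r k : ℕ}
    (h : BallIso G G' ω ω' r k) : BallIso G' G ω' ω r k := by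
  obtain ⟨e, he⟩ := h
  refine ⟨e.symm, fun i hi => ?_⟩
  obtain ⟨hm, heq⟩ := he i hi
  have hm' : ω' i ∈ G'.ball (ω' 0) r := heq ▸ (e ⟨ω i, hm⟩).2
  refine ⟨hm', ?_⟩
  have : (⟨ω' i, hm'⟩ : G'.ball (ω' 0) r) = e ⟨ω i, hm⟩ := Subtype.ext heq.symm
  rw [this, RelIso.symm_apply_apply]

theorem BallIso.trans {G G' G'' : LFGraph} {ω : ℕ → G.V} {ω' : ℕ → G'.V} {ω'' : ℕ → G''.V}
    {r k : ℕ} (h : BallIso G G' ω ω' r k) (h' : BallIso G' G'' ω' ω'' r k) :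
    BallIso G G'' ω ω'' r k := by
  obtain ⟨e, he⟩ := h
  obtain ⟨f, hf⟩ := h'
  refine ⟨e.trans f, fun i hi => ?_⟩
  obtain ⟨hm, heq⟩ := he i hi
  obtain ⟨hm', heq'⟩ := hf i hi
  refine ⟨hm, ?_⟩
  have : (⟨ω' i, hm'⟩ : G'.ball (ω' 0) r) = e ⟨ω i, hm⟩ := Subtype.ext heq.symm
  rw [← heq', this]
  rfl

/-- Ball isomorphisms restrict to smaller balls, which may be centred at a later point. -/
theorem BallIso.restrict {G G' : LFGraph} {ω : ℕ → G.V} {ω' : ℕ → G'.V} {r k r' k' m : ℕ}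
    (h : BallIso G G' ω ω' r k) (hk : m + k' ≤ k) (hr : G.graph.dist (ω 0) (ω m) + r' ≤ r)
    (hω : ∀ i ≤ k', G.graph.dist (ω m) (ω (m + i)) ≤ r') :
    BallIso G G' (fun i => ω (m + i)) (fun i => ω' (m + i)) r' k' := by
  obtain ⟨e, he⟩ := h
  obtain ⟨h0, he0⟩ := he 0 zero_le
  obtain ⟨hm, hem⟩ := he m (by omega)
  have hS : G.ball (ω m) r' ⊆ G.ball (ω 0) r := fun y hy => by
    have := G.dist_triangle (ω 0) (ω m) y
    have : G.graph.dist (ω m) y ≤ r' := hy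
    change _ ≤ r
    omega
  have hd : G'.graph.dist (ω' 0) (ω' m) ≤ G.graph.dist (ω 0) (ω m) := by
    have := dist_map_le e ⟨ω 0, h0⟩ (r := r) subset_rfl ⟨ω m, hm⟩ hm
    rwa [he0, hem] at this
  have hS' : G'.ball (ω' m) r' ⊆ G'.ball (ω' 0) r := fun y hy => by
    have := G'.dist_triangle (ω' 0) (ω' m) y
    have : G'.graph.dist (ω' m) y ≤ r' := hy
    change _ ≤ r
    omega
  obtain ⟨e', he'⟩ := exists_iso_ball e ⟨ω m, hm⟩ hem hS hS'
  refine ⟨e', fun i hi => ⟨hω i hi,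
    (he' _ (hω i hi)).trans (he (m + i) (by omega)).2⟩⟩

theorem BallIso.mono {G G' : LFGraph} {ω : ℕ → G.V} {ω' : ℕ → G'.V} {r k r' k' : ℕ}
    (h : BallIso G G' ω ω' r k) (hk : k' ≤ k) (hr : r' ≤ r)
    (hω : ∀ i ≤ k', G.graph.dist (ω 0) (ω i) ≤ r') :
    BallIso G G' ω ω' r' k' := by
  have := BallIso.restrict (m := 0) (k' := k') (r' := r') h (by omega) (by simpa using hr)
    (by simpa using hω)
  simpa using this

theorem ballIso_of_iso {G G' : LFGraph} (e : G.graph ≃g G'.graph) {ω : ℕ → G.V} {ω' : ℕ → G'.V}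
    {r k : ℕ} (h : ∀ i ≤ k, e (ω i) = ω' i) (hω : ∀ i ≤ k, G.graph.dist (ω 0) (ω i) ≤ r) :
    BallIso G G' ω ω' r k := by
  have hd : ∀ x y, G'.graph.dist (e x) (e y) = G.graph.dist x y := fun x y => by
    let f : G.graph.induce Set.univ ≃g G'.graph.induce Set.univ :=
      (SimpleGraph.induceUnivIso G.graph).trans (e.trans (SimpleGraph.induceUnivIso G'.graph).symm)
    exact dist_map_eq f ⟨x, trivial⟩ (Set.subset_univ _) (Set.subset_univ _) ⟨y, trivial⟩ le_rfl
  unfold BallIso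
  rw [← h 0 zero_le]
  refine ⟨{ toFun := fun y => ⟨e y, (hd _ _).le.trans y.2⟩
            invFun := fun y => ⟨e.symm y, by
              have := hd (ω 0) (e.symm y)
              rw [RelIso.apply_symm_apply] at this
              exact this.symm.le.trans y.2⟩
            left_inv := fun y => by simp
            right_inv := fun y => by simp
            map_rel_iff' := fun {y z} => e.map_adj_iff (v := y) (w := z) },
    fun i hi => ⟨hω i hi, h i hi⟩⟩

theorem ballIso_zero {G G' : LFGraph} (ω : ℕ → G.V) (ω' : ℕ → G'.V) : BallIso G G' ω ω' 0 0 := by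
  unfold BallIso
  rw [ball_zero, ball_zero]
  refine ⟨{ toEquiv := Equiv.ofUnique _ _
            map_rel_iff' := fun {a b} => ?_ }, fun i hi => ?_⟩
  · rw [Subsingleton.elim a b]
    simp
  · obtain rfl : i = 0 := by omega
    exact ⟨rfl, rfl⟩

/-- The consequences of a ball isomorphism that matter for the random walk, stated for an extension
of the isomorphism to a map of all vertices. -/
theorem BallIso.exists_map {G G' : LFGraph} {ω : ℕ → G.V} {ω' : ℕ → G'.V} {r k : ℕ}
    (h : BallIso G G' ω ω' r k) :
    ∃ φ : G.V → G'.V, (∀ i ≤ k, φ (ω i) = ω' i) ∧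
      Set.BijOn φ (G.ball (ω 0) r) (G'.ball (ω' 0) r) ∧
      (∀ y ∈ G.ball (ω 0) r, G'.graph.dist (ω' 0) (φ y) = G.graph.dist (ω 0) y) ∧
      (∀ y, G.graph.dist (ω 0) y < r → Set.BijOn φ (G.stepSet y) (G'.stepSet (φ y))) ∧
      ∃ e : G.graph.induce (G.ball (ω 0) r) ≃g G'.graph.induce (G'.ball (ω' 0) r),
        ∀ y (hy : y ∈ G.ball (ω 0) r), φ y = e ⟨y, hy⟩ := by
  classical
  obtain ⟨e, he⟩ := h
  obtain ⟨h0, he0⟩ := he 0 zero_le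
  let φ : G.V → G'.V := fun y => if hy : y ∈ G.ball (ω 0) r then e ⟨y, hy⟩ else ω' 0
  have hφ : ∀ y (hy : y ∈ G.ball (ω 0) r), φ y = e ⟨y, hy⟩ := fun y hy => dif_pos hy
  have hdist : ∀ y ∈ G.ball (ω 0) r, G'.graph.dist (ω' 0) (φ y) = G.graph.dist (ω 0) y := by
    intro y hy
    have := dist_map_eq e ⟨ω 0, h0⟩ (r := r) subset_rfl (by rw [he0]) ⟨y, hy⟩ hy
    rw [hφ y hy]
    rwa [he0] at this
  have hinj : Set.InjOn φ (G.ball (ω 0) r) := fun y hy z hz hyz => by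
    rw [hφ y hy, hφ z hz] at hyz
    exact congrArg Subtype.val (e.injective (Subtype.ext hyz))
  have hsurj : ∀ z ∈ G'.ball (ω' 0) r, ∃ y ∈ G.ball (ω 0) r, φ y = z := fun z hz =>
    ⟨e.symm ⟨z, hz⟩, (e.symm ⟨z, hz⟩).2, by rw [hφ _ (e.symm ⟨z, hz⟩).2]; simp⟩
  have hadj : ∀ y ∈ G.ball (ω 0) r, ∀ z ∈ G.ball (ω 0) r,
      (G'.graph.Adj (φ y) (φ z) ↔ G.graph.Adj y z) := fun y hy z hz => by
    rw [hφ y hy, hφ z hz]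
    exact e.map_adj_iff (v := ⟨y, hy⟩) (w := ⟨z, hz⟩)
  have hnear : ∀ y, G.graph.dist (ω 0) y < r → ∀ z ∈ G.stepSet y, z ∈ G.ball (ω 0) r := by
    intro y hy z hz
    have := G.dist_triangle (ω 0) y z
    have := G.dist_le_one_of_mem_stepSet hz
    change _ ≤ r
    omega
  have hnear' : ∀ y, G.graph.dist (ω 0) y < r → ∀ z ∈ G'.stepSet (φ y), z ∈ G'.ball (ω' 0) r := by
    intro y hy z hz
    have := G'.dist_triangle (ω' 0) (φ y) z
    have := G'.dist_le_one_of_mem_stepSet hz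
    have := hdist y hy.le
    change _ ≤ r
    omega
  have hiso : ∀ y, G.graph.dist (ω 0) y < r →
      ((∀ z, ¬ G.graph.Adj y z) ↔ ∀ z, ¬ G'.graph.Adj (φ y) z) := by
    intro y hy
    constructor
    · intro h z hz
      obtain ⟨w, hw, rfl⟩ := hsurj z (hnear' y hy z (Or.inl hz))
      exact h w ((hadj y hy.le w hw).1 hz)
    · intro h z hz
      exact h (φ z) ((hadj y hy.le z (hnear y hy z (Or.inl hz))).2 hz)
  refine ⟨φ, fun i hi => ?_, ⟨fun y hy => ?_, hinj, fun z hz => hsurj z hz⟩, hdist,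
    fun y hy => ⟨fun z hz => ?_, hinj.mono (hnear y hy), fun z hz => ?_⟩, e, hφ⟩
  · obtain ⟨hi', hei⟩ := he i hi
    rw [hφ _ hi', hei]
  · rw [hφ y hy]
    exact (e ⟨y, hy⟩).2
  · rcases hz with hz' | ⟨rfl, hz'⟩
    · exact Or.inl ((hadj y hy.le z (hnear y hy z (Or.inl hz'))).2 hz')
    · exact Or.inr ⟨rfl, (hiso _ hy).1 hz'⟩
  · rcases hz with hz' | ⟨rfl, hz'⟩
    · obtain ⟨w, hw, rfl⟩ := hsurj z (hnear' y hy z (Or.inl hz'))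
      exact ⟨w, Or.inl ((hadj y hy.le w hw).1 hz'), rfl⟩
    · exact ⟨y, Or.inr ⟨rfl, (hiso _ hy).2 hz'⟩, rfl⟩

theorem IsPath.dist_le {G : LFGraph} {ω : ℕ → G.V} (h : G.IsPath ω) (m n : ℕ) :
    G.graph.dist (ω m) (ω (m + n)) ≤ n := by
  induction n with
  | zero => simp
  | succ n ih =>
    have := G.dist_triangle (ω m) (ω (m + n)) (ω (m + (n + 1)))
    have := G.dist_le_one_of_mem_stepSet (h (m + n))
    rw [add_assoc] at this
    omega

theorem IsPath.dist_zero_le {G : LFGraph} {ω : ℕ → G.V} (h : G.IsPath ω) (n : ℕ) :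
    G.graph.dist (ω 0) (ω n) ≤ n := by
  simpa using h.dist_le 0 n

/-- The law of the walk is invariant under isomorphisms. -/
theorem walk_map_iso {G G' : LFGraph} (e : G.graph ≃g G'.graph) (x : G.V) :
    (G.walk x).map (fun ω i => e (ω i)) = G'.walk (e x) := by
  have he : Measurable e := measurable_from_top
  have hm : Measurable fun (ω : ℕ → G.V) i => e (ω i) :=
    measurable_pi_lambda _ fun i => he.comp (measurable_pi_apply _)
  have := Measure.isProbabilityMeasure_map (μ := G.walk x) hm.aemeasurable
  refine ext_of_cylinder _ _ fun a n => ?_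
  have h := walk_map_min e n x fun y _ => ?_
  · have hm1 : Measurable fun (ω : ℕ → G.V) i => e (ω (min i n)) :=
      measurable_pi_lambda _ fun i => he.comp (measurable_pi_apply _)
    have hm2 : Measurable fun (ω : ℕ → G'.V) i => ω (min i n) :=
      measurable_pi_lambda _ fun i => measurable_pi_apply _
    have hcyl : MeasurableSet {ω : ℕ → G'.V | ∀ i ≤ n, ω i = a i} := by
      have : {ω : ℕ → G'.V | ∀ i ≤ n, ω i = a i} = ⋂ i, ⋂ _ : i ≤ n, {ω | ω i = a i} := by
        ext; simp
      rw [this]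
      exact MeasurableSet.iInter fun i => MeasurableSet.iInter fun _ => G'.measurableSet_coord _ _
    have h2 := congrArg (fun μ => μ {ω : ℕ → G'.V | ∀ i ≤ n, ω i = a i}) h
    rw [Measure.map_apply hm1 hcyl, Measure.map_apply hm2 hcyl] at h2
    rw [Measure.map_apply hm hcyl]
    convert h2 using 2
    · ext ω
      simp only [Set.mem_preimage, Set.mem_ofPred_eq]
      exact forall₂_congr fun i hi => by rw [min_eq_left hi]
    · ext ω
      simp only [Set.mem_preimage, Set.mem_ofPred_eq]
      exact forall₂_congr fun i hi => by rw [min_eq_left hi]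
  · have hiff : (∀ z, ¬ G.graph.Adj y z) ↔ ∀ z, ¬ G'.graph.Adj (e y) z := by
      refine ⟨fun h z hz => ?_, fun h z hz => h (e z) (e.map_adj_iff.2 hz)⟩
      obtain ⟨w, rfl⟩ := e.surjective z
      exact h w (e.map_adj_iff.1 hz)
    refine ⟨fun z hz => ?_, e.injective.injOn, fun z hz => ?_⟩
    · rcases hz with hz | ⟨rfl, hz⟩
      · exact Or.inl (e.map_adj_iff.2 hz)
      · exact Or.inr ⟨rfl, hiff.1 hz⟩
    · obtain ⟨w, rfl⟩ := e.surjective z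
      rcases hz with hz | ⟨hwz, hz⟩
      · exact ⟨w, Or.inl (e.map_adj_iff.1 hz), rfl⟩
      · exact ⟨w, Or.inr ⟨e.injective hwz, hiff.2 hz⟩, rfl⟩

/-- Ball isomorphisms preserve the transition probabilities. -/
theorem prob_map {G G' : LFGraph} {φ : G.V → G'.V} {n : ℕ} {x : G.V}
    (hφ : ∀ y, G.graph.dist x y < n → Set.BijOn φ (G.stepSet y) (G'.stepSet (φ y)))
    (hinj : Set.InjOn φ (G.ball x n)) {y : G.V} (hy : y ∈ G.ball x n) :
    G'.prob n (φ x) (φ y) = G.prob n x y := by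
  have h := congrArg (fun μ => μ {ω : ℕ → G'.V | ω n = φ y}) (walk_map_min φ n x hφ)
  have hφm : Measurable φ := measurable_from_top
  have hm1 : Measurable fun (ω : ℕ → G.V) i => φ (ω (min i n)) :=
    measurable_pi_lambda _ fun i => hφm.comp (measurable_pi_apply _)
  have hm2 : Measurable fun (ω : ℕ → G'.V) i => ω (min i n) :=
    measurable_pi_lambda _ fun i => measurable_pi_apply _
  rw [Measure.map_apply hm1 (G'.measurableSet_coord _ _),
    Measure.map_apply hm2 (G'.measurableSet_coord _ _)] at h
  simp only [Set.preimage_ofPred_eq, min_self] at h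
  rw [prob, prob, measureReal_def, measureReal_def, ← h]
  congr 1
  refine measure_congr ?_
  filter_upwards [G.walk_ae_zero x, G.walk_ae_isPath x] with ω h0 hp
  refine propext ⟨fun hω => ?_, fun hω => congrArg φ hω⟩
  refine hinj ?_ hy hω
  have := hp.dist_zero_le n
  rwa [h0] at this

theorem BallIso.entropy_eq {G G' : LFGraph} {x : G.V} {x' : G'.V} {n : ℕ}
    (h : BallIso G G' (fun _ => x) (fun _ => x') n 0) : G.entropy x n = G'.entropy x' n := by
  obtain ⟨φ, hφ, hbij, -, hstep, -⟩ := h.exists_map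
  have hx : φ x = x' := hφ 0 le_rfl
  rw [G.entropy_eq_sum n x _ subset_rfl, G'.entropy_eq_sum n x' _ subset_rfl]
  refine Finset.sum_nbij φ (fun y hy => G'.mem_ballFin.2 (hbij.mapsTo (G.mem_ballFin.1 hy)))
    (fun y hy z hz => hbij.injOn (G.mem_ballFin.1 hy) (G.mem_ballFin.1 hz))
    (fun z hz => ?_) fun y hy => ?_
  · obtain ⟨y, hy, rfl⟩ := hbij.surjOn (G'.mem_ballFin.1 hz)
    exact ⟨y, G.mem_ballFin.2 hy, rfl⟩
  · rw [← hx, prob_map hstep hbij.injOn (G.mem_ballFin.1 hy)]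

end LFGraph

/-! ### The local topologies -/

theorem exists_of_sInf_lt {p : ℕ → Prop} (h0 : p 0) {R : ℕ}
    (h : sInf {t : ℝ | ∃ r : ℕ, t = 1 / ((r : ℝ) + 1) ∧ p r} < 1 / ((R : ℝ) + 1)) :
    ∃ r, R ≤ r ∧ p r := by
  have hne : {t : ℝ | ∃ r : ℕ, t = 1 / ((r : ℝ) + 1) ∧ p r}.Nonempty :=
    ⟨1 / (((0 : ℕ) : ℝ) + 1), 0, rfl, h0⟩
  obtain ⟨t, ⟨r, rfl, hr⟩, hlt⟩ := exists_lt_of_csInf_lt hne h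
  refine ⟨r, ?_, hr⟩
  rw [one_div_lt_one_div (by positivity) (by positivity)] at hlt
  have : (R : ℝ) < r := by linarith
  exact_mod_cast this.le

theorem sInf_lt_of_le {p : ℕ → Prop} {r : ℕ} (hr : p r) {ε : ℝ} (hε : 1 / ((r : ℝ) + 1) < ε) :
    sInf {t : ℝ | ∃ r : ℕ, t = 1 / ((r : ℝ) + 1) ∧ p r} < ε := by
  have hb : BddBelow {t : ℝ | ∃ r : ℕ, t = 1 / ((r : ℝ) + 1) ∧ p r} := by
    refine ⟨0, ?_⟩
    rintro _ ⟨r, rfl, -⟩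
    positivity
  have hm : 1 / ((r : ℝ) + 1) ∈ {t : ℝ | ∃ r : ℕ, t = 1 / ((r : ℝ) + 1) ∧ p r} := ⟨r, rfl, hr⟩
  exact (csInf_le hb hm).trans_lt hε

namespace RootedGraph

/-- The rooted graphs `g` and `g'` have isomorphic balls of radius `r` around the root. -/
def Near (r : ℕ) (g g' : RootedGraph) : Prop :=
  LFGraph.BallIso g.rep.toLFGraph g'.rep.toLFGraph
    (fun _ => g.rep.root) (fun _ => g'.rep.root) r 0

theorem Near.mono {r r' : ℕ} {g g' : RootedGraph} (h : Near r g g') (hr : r' ≤ r) :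
    Near r' g g' :=
  LFGraph.BallIso.mono h le_rfl hr (by simp)

theorem near_of_dloc_lt {R : ℕ} {g g' : RootedGraph} (h : dloc g g' < 1 / ((R : ℝ) + 1)) :
    Near R g g' := by
  obtain ⟨r, hr, h⟩ := exists_of_sInf_lt (p := fun r => Near r g g') (LFGraph.ballIso_zero _ _) h
  exact Near.mono h hr

theorem Near.dloc_lt {r : ℕ} {g g' : RootedGraph} (h : Near r g g') {ε : ℝ}
    (hε : 1 / ((r : ℝ) + 1) < ε) : dloc g g' < ε :=
  sInf_lt_of_le (p := fun r => Near r g g') h hε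

/-- A function that depends only on the ball of a fixed radius around the root is measurable. -/
theorem measurable_of_near {β : Type*} [MeasurableSpace β] {F : RootedGraph → β} (R : ℕ)
    (h : ∀ g g', Near R g g' → F g = F g') : Measurable F := fun s _ => by
  refine IsOpen.measurableSet fun g hg => ⟨1 / ((R : ℝ) + 1), by positivity, fun g' hg' => ?_⟩
  rw [Set.mem_preimage, ← h g g' (near_of_dloc_lt hg')]
  exact hg

/-- The isomorphism class of the graph `G` rooted at `x`. -/
def mk (G : LFGraph) (x : G.V) : RootedGraph :=
  Quotient.mk RootedRep.setoid { toLFGraph := G, root := x }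

theorem mk_rep (g : RootedGraph) : mk g.rep.toLFGraph g.rep.root = g := Quotient.out_eq g

theorem exists_iso_mk (G : LFGraph) (x : G.V) :
    ∃ e : G.graph ≃g (mk G x).rep.graph, e x = (mk G x).rep.root :=
  Setoid.symm (Quotient.mk_out (s := RootedRep.setoid) { toLFGraph := G, root := x })

theorem measurable_entropy (n : ℕ) : Measurable fun g : RootedGraph => g.entropy n :=
  measurable_of_near n fun _ _ h => LFGraph.BallIso.entropy_eq h

theorem entropy_mk (G : LFGraph) (x : G.V) (n : ℕ) : (mk G x).entropy n = G.entropy x n := by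
  obtain ⟨e, he⟩ := exists_iso_mk G x
  exact (LFGraph.BallIso.entropy_eq
    (LFGraph.ballIso_of_iso e (fun _ _ => he) (by simp))).symm

theorem measurable_ballCard (n : ℕ) : Measurable fun g : RootedGraph => g.ballCard n :=
  measurable_of_near n fun g g' h => by
    obtain ⟨φ, -, hbij, -⟩ := LFGraph.BallIso.exists_map h
    rw [ballCard, ballCard, ← hbij.image_eq, hbij.injOn.ncard_image]

end RootedGraph

namespace PathGraph

/-- The graphs with a path `q` and `q'` have isomorphic balls of radius `r` around the starting
points, compatibly with the first `r` steps of the paths. -/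
def Near (r : ℕ) (q q' : PathGraph) : Prop :=
  LFGraph.BallIso q.rep.toLFGraph q'.rep.toLFGraph q.rep.path q'.rep.path r r

theorem Near.mono {r r' : ℕ} {q q' : PathGraph} (h : Near r q q') (hr : r' ≤ r) :
    Near r' q q' :=
  LFGraph.BallIso.mono h hr hr fun i hi => (q.rep.isPath.dist_zero_le i).trans hi

theorem near_of_dloc_lt {R : ℕ} {q q' : PathGraph} (h : dloc q q' < 1 / ((R : ℝ) + 1)) :
    Near R q q' := by
  obtain ⟨r, hr, h⟩ := exists_of_sInf_lt (p := fun r => Near r q q') (LFGraph.ballIso_zero _ _) h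
  exact Near.mono h hr

theorem Near.dloc_lt {r : ℕ} {q q' : PathGraph} (h : Near r q q') {ε : ℝ}
    (hε : 1 / ((r : ℝ) + 1) < ε) : dloc q q' < ε :=
  sInf_lt_of_le (p := fun r => Near r q q') h hε

theorem Near.symm {r : ℕ} {q q' : PathGraph} (h : Near r q q') : Near r q' q :=
  LFGraph.BallIso.symm h

theorem Near.trans {r : ℕ} {q q' q'' : PathGraph} (h : Near r q q') (h' : Near r q' q'') :
    Near r q q'' :=
  LFGraph.BallIso.trans h h'

theorem near_refl (r : ℕ) (q : PathGraph) : Near r q q :=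
  LFGraph.ballIso_of_iso SimpleGraph.Iso.refl (fun _ _ => rfl)
    fun i hi => (q.rep.isPath.dist_zero_le i).trans hi

theorem measurable_of_near {β : Type*} [MeasurableSpace β] {F : PathGraph → β} (R : ℕ)
    (h : ∀ q q', Near R q q' → F q = F q') : Measurable F := fun s _ => by
  refine IsOpen.measurableSet fun g hg => ⟨1 / ((R : ℝ) + 1), by positivity, fun g' hg' => ?_⟩
  rw [Set.mem_preimage, ← h g g' (near_of_dloc_lt hg')]
  exact hg

theorem exists_near_subset {U : Set PathGraph} (hU : IsOpen U) {q : PathGraph} (hq : q ∈ U) :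
    ∃ R, ∀ q', Near R q q' → q' ∈ U := by
  obtain ⟨ε, hε, h⟩ := hU q hq
  obtain ⟨R, hR⟩ := exists_nat_one_div_lt hε
  exact ⟨R, fun q' hq' => h q' (hq'.dloc_lt hR)⟩

theorem exists_iso_mk (G : LFGraph) (ω : {ω : ℕ → G.V // G.IsPath ω}) :
    ∃ e : G.graph ≃g (mk G ω).rep.graph, ∀ n, e (ω.1 n) = (mk G ω).rep.path n :=
  Setoid.symm (Quotient.mk_out (s := PathRep.setoid)
    { toLFGraph := G, path := ω.1, isPath := ω.2 })

theorem mk_rep (q : PathGraph) : mk q.rep.toLFGraph ⟨q.rep.path, q.rep.isPath⟩ = q :=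
  Quotient.out_eq q

/-- Nearness can be tested on any representatives. -/
theorem near_mk_iff {G G' : LFGraph} {ω : {ω : ℕ → G.V // G.IsPath ω}}
    {ω' : {ω : ℕ → G'.V // G'.IsPath ω}} {r : ℕ} :
    Near r (mk G ω) (mk G' ω') ↔ LFGraph.BallIso G G' ω.1 ω'.1 r r := by
  obtain ⟨e, he⟩ := exists_iso_mk G ω
  obtain ⟨e', he'⟩ := exists_iso_mk G' ω'
  have h := LFGraph.ballIso_of_iso (r := r) (k := r) e (fun i _ => he i)
    fun i hi => (ω.2.dist_zero_le i).trans hi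
  have h' := LFGraph.ballIso_of_iso (r := r) (k := r) e' (fun i _ => he' i)
    fun i hi => (ω'.2.dist_zero_le i).trans hi
  exact ⟨fun hn => h.trans (LFGraph.BallIso.trans hn h'.symm),
    fun hn => h.symm.trans (hn.trans h')⟩

theorem displacement_mk (G : LFGraph) (ω : {ω : ℕ → G.V // G.IsPath ω}) (n : ℕ) :
    (mk G ω).displacement n = G.graph.dist (ω.1 0) (ω.1 n) := by
  obtain ⟨e, he⟩ := exists_iso_mk G ω
  obtain ⟨φ, hφ, -, hd, -⟩ := LFGraph.BallIso.exists_map (LFGraph.ballIso_of_iso (r := n) (k := n) e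
    (fun i _ => he i) fun i hi => (ω.2.dist_zero_le i).trans hi)
  rw [displacement, ← hd _ (ω.2.dist_zero_le n), hφ n le_rfl]

theorem displacement_le (q : PathGraph) (n : ℕ) : q.displacement n ≤ n :=
  q.rep.isPath.dist_zero_le n

theorem measurable_displacement (n : ℕ) : Measurable fun q : PathGraph => q.displacement n :=
  measurable_of_near n fun q q' h => by
    obtain ⟨φ, hφ, -, hd, -⟩ := LFGraph.BallIso.exists_map h
    rw [displacement, displacement, ← hd _ (q.rep.isPath.dist_zero_le n), hφ n le_rfl]

theorem shift_mk (G : LFGraph) (ω : {ω : ℕ → G.V // G.IsPath ω}) :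
    shift (mk G ω) = mk G ⟨fun n => ω.1 (n + 1), fun n => ω.2 (n + 1)⟩ := rfl

theorem rootAt_mk (G : LFGraph) (ω : {ω : ℕ → G.V // G.IsPath ω}) (n : ℕ) :
    rootAt n (mk G ω) = RootedGraph.mk G (ω.1 n) := rfl

theorem shift_iterate_mk (G : LFGraph) (ω : {ω : ℕ → G.V // G.IsPath ω}) (k : ℕ) :
    shift^[k] (mk G ω) = mk G ⟨fun n => ω.1 (n + k), fun n => by
      have := ω.2 (n + k)
      rwa [add_right_comm] at this⟩ := by
  induction k with
  | zero => rfl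
  | succ k ih =>
    rw [Function.iterate_succ_apply', ih, shift_mk]
    simp only [Nat.add_right_comm _ 1 k]
    rfl

theorem continuous_shift : Continuous shift := by
  refine continuous_def.2 fun U hU q hq => ?_
  obtain ⟨R, hR⟩ := exists_near_subset hU hq
  refine ⟨1 / (((R + 1 : ℕ) : ℝ) + 1), by positivity, fun q' hq' => hR _ ?_⟩
  have h := near_of_dloc_lt hq'
  rw [← q.mk_rep, ← q'.mk_rep] at h ⊢
  rw [shift_mk, shift_mk, near_mk_iff]
  rw [near_mk_iff] at h
  have h1 := q.rep.isPath.dist_zero_le 1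
  have := LFGraph.BallIso.restrict (m := 1) (k' := R) (r' := R) h (by omega)
    (by simp only; omega) fun i hi => (q.rep.isPath.dist_le 1 i).trans hi
  simpa only [add_comm] using this

theorem continuous_rootAt_zero : Continuous (rootAt 0) := by
  refine continuous_def.2 fun U hU q hq => ?_
  obtain ⟨ε, hε, h⟩ := hU _ hq
  obtain ⟨R, hR⟩ := exists_nat_one_div_lt hε
  refine ⟨1 / ((R : ℝ) + 1), by positivity, fun q' hq' => h _ (RootedGraph.Near.dloc_lt ?_ hR)⟩
  have h := near_of_dloc_lt hq'
  have key : ∀ q : PathGraph, ∃ e : q.rep.graph ≃g (rootAt 0 q).rep.graph,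
      e (q.rep.path 0) = (rootAt 0 q).rep.root := fun q => by
    have := RootedGraph.exists_iso_mk q.rep.toLFGraph (q.rep.path 0)
    rwa [← rootAt_mk q.rep.toLFGraph ⟨q.rep.path, q.rep.isPath⟩ 0, mk_rep] at this
  obtain ⟨e, he⟩ := key q
  obtain ⟨e', he'⟩ := key q'
  have h1 := LFGraph.ballIso_of_iso (r := R) (k := 0) (ω := fun _ => q.rep.path 0) e
    (fun _ _ => he) (by simp)
  have h1' := LFGraph.ballIso_of_iso (r := R) (k := 0) (ω := fun _ => q'.rep.path 0) e'
    (fun _ _ => he') (by simp)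
  have h2 : LFGraph.BallIso q.rep.toLFGraph q'.rep.toLFGraph (fun _ => q.rep.path 0)
      (fun _ => q'.rep.path 0) R 0 := by
    obtain ⟨e, he⟩ := h
    exact ⟨e, fun i _ => he 0 zero_le⟩
  exact h1.symm.trans (h2.trans h1')

theorem measurable_shift : Measurable shift := continuous_shift.measurable

theorem rootAt_eq_shift_iterate (n : ℕ) : rootAt n = rootAt 0 ∘ shift^[n] := by
  funext q
  rw [← q.mk_rep, Function.comp_apply, shift_iterate_mk, rootAt_mk, rootAt_mk]
  simp

theorem measurable_rootAt (n : ℕ) : Measurable (rootAt n) := by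
  rw [rootAt_eq_shift_iterate]
  exact continuous_rootAt_zero.measurable.comp (measurable_shift.iterate n)

/-! ### A countable base of the Borel `σ`-algebra -/

/-- The closed ball of radius `1 / (r + 1)` around `q`. -/
def nbhd (r : ℕ) (q : PathGraph) : Set PathGraph := {q' | Near r q q'}

theorem nbhd_eq_of_near {r : ℕ} {q q' : PathGraph} (h : Near r q q') : nbhd r q = nbhd r q' :=
  Set.ext fun _ => ⟨fun h' => h.symm.trans h', fun h' => h.trans h'⟩

theorem measurableSet_nbhd (r : ℕ) (q : PathGraph) : MeasurableSet (nbhd r q) :=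
  measurableSet_setOfPred.2 <| measurable_of_near r fun _ _ h =>
    propext ⟨fun h' => h'.trans h, fun h' => h'.trans h.symm⟩

/-- There are countably many finite graphs with a finite path, up to isomorphism. -/
theorem countable_range_nbhd (r : ℕ) : (Set.range (nbhd r)).Countable := by
  have hcode : ∀ q : PathGraph,
      ∃ c : Σ n : ℕ, Set (Fin n × Fin n) × (Fin (r + 1) → Fin n),
        ∃ e : q.rep.toLFGraph.ball (q.rep.path 0) r ≃ Fin c.1,
          (∀ y z : q.rep.toLFGraph.ball (q.rep.path 0) r,
            q.rep.graph.Adj y z ↔ (e y, e z) ∈ c.2.1) ∧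
          ∀ i : Fin (r + 1), ∃ h : q.rep.path i ∈ q.rep.toLFGraph.ball (q.rep.path 0) r,
            e ⟨q.rep.path i, h⟩ = c.2.2 i := by
    intro q
    have := (q.rep.toLFGraph.ball_finite (q.rep.path 0) r).to_subtype
    obtain ⟨n, ⟨e⟩⟩ := Finite.exists_equiv_fin (q.rep.toLFGraph.ball (q.rep.path 0) r)
    have hi : ∀ i : Fin (r + 1), q.rep.path i ∈ q.rep.toLFGraph.ball (q.rep.path 0) r := fun i =>
      (q.rep.isPath.dist_zero_le i).trans (Nat.lt_succ_iff.1 i.2)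
    refine ⟨⟨n, {p | q.rep.graph.Adj (e.symm p.1) (e.symm p.2)}, fun i => e ⟨_, hi i⟩⟩, e,
      fun y z => ?_, fun i => ⟨hi i, rfl⟩⟩
    simp
  choose code e hadj hpath using hcode
  have hnear : ∀ q q', code q = code q' → Near r q q' := by
    intro q q' h
    have key : ∀ c c' : Σ n : ℕ, Set (Fin n × Fin n) × (Fin (r + 1) → Fin n), c = c' →
        ∃ f : Fin c.1 ≃ Fin c'.1, (∀ i j, (i, j) ∈ c.2.1 ↔ (f i, f j) ∈ c'.2.1) ∧
          ∀ i, f (c.2.2 i) = c'.2.2 i := by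
      rintro c _ rfl
      exact ⟨Equiv.refl _, fun _ _ => Iff.rfl, fun _ => rfl⟩
    obtain ⟨f, hf, hfp⟩ := key _ _ h
    refine ⟨{ toEquiv := (e q).trans (f.trans (e q').symm)
              map_rel_iff' := fun {y z} => ?_ }, fun i hi => ?_⟩
    · have h1 := hadj q y z
      have h2 := hadj q' ((e q').symm (f (e q y))) ((e q').symm (f (e q z)))
      rw [Equiv.apply_symm_apply, Equiv.apply_symm_apply, ← hf, ← h1] at h2
      exact h2
    · obtain ⟨hm, hv⟩ := hpath q ⟨i, Nat.lt_succ_iff.2 hi⟩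
      obtain ⟨hm', hv'⟩ := hpath q' ⟨i, Nat.lt_succ_iff.2 hi⟩
      refine ⟨hm, ?_⟩
      change (((e q').symm (f (e q ⟨q.rep.path i, hm⟩)) : q'.rep.toLFGraph.ball _ r) : q'.rep.V) = _
      rw [hv, hfp, ← hv', Equiv.symm_apply_apply]
  refine (Set.countable_range
    fun c => {q' | ∃ q, code q = c ∧ Near r q q'}).mono ?_
  rintro _ ⟨q, rfl⟩
  refine ⟨code q, Set.ext fun q' => ⟨?_, fun h => ⟨q, rfl, h⟩⟩⟩
  rintro ⟨p, hp, hpq⟩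
  exact (hnear q p hp.symm).trans hpq

theorem isPiSystem_nbhd : IsPiSystem {C | ∃ r q, C = nbhd r q} := by
  rintro _ ⟨r, q, rfl⟩ _ ⟨r', q', rfl⟩ ⟨p, hp, hp'⟩
  rw [nbhd_eq_of_near hp, nbhd_eq_of_near hp']
  rcases le_total r r' with h | h
  · exact ⟨r', p, Set.inter_eq_right.2 fun x hx => Near.mono hx h⟩
  · exact ⟨r, p, Set.inter_eq_left.2 fun x hx => Near.mono hx h⟩

theorem measurableSpace_eq_generateFrom :
    (inferInstance : MeasurableSpace PathGraph) =
      MeasurableSpace.generateFrom {C | ∃ r q, C = nbhd r q} := by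
  refine le_antisymm (MeasurableSpace.generateFrom_le fun U hU => ?_)
    (MeasurableSpace.generateFrom_le ?_)
  · have hc : ({C | ∃ r q, C = nbhd r q} : Set (Set PathGraph)).Countable := by
      have : ({C | ∃ r q, C = nbhd r q} : Set (Set PathGraph)) = ⋃ r, Set.range (nbhd r) := by
        ext; simp [eq_comm]
      rw [this]
      exact Set.countable_iUnion countable_range_nbhd
    have : U = ⋃₀ {C | (∃ r q, C = nbhd r q) ∧ C ⊆ U} := by
      refine subset_antisymm (fun q hq => ?_) (Set.sUnion_subset fun C hC => hC.2)
      obtain ⟨R, hR⟩ := exists_near_subset hU hq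
      exact ⟨nbhd R q, ⟨⟨R, q, rfl⟩, fun q' hq' => hR q' hq'⟩, near_refl R q⟩
    rw [this]
    exact MeasurableSet.sUnion (hc.mono fun C hC => hC.1)
      fun C hC => MeasurableSpace.measurableSet_generateFrom hC.1
  · rintro _ ⟨r, q, rfl⟩
    exact measurableSet_nbhd r q

end PathGraph

/-! ### The law of the graph with the walk -/

theorem measurableSet_of_restrict {V : Type*} [Countable V] [MeasurableSpace V]
    [DiscreteMeasurableSpace V] (R : ℕ) (T : Set (Finset.Iic R → V)) :
    MeasurableSet (Finset.restrict (π := fun _ => V) (Finset.Iic R) ⁻¹' T) :=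
  Finset.measurable_restrict _ (Set.to_countable T).measurableSet

theorem PathGraph.measurable_mk (G : LFGraph) : Measurable (PathGraph.mk G) := by
  refine measurable_of_isOpen fun U hU => ?_
  let T : ∀ R : ℕ, Set (Finset.Iic R → G.V) := fun R =>
    {y | ∀ ω : {ω : ℕ → G.V // G.IsPath ω}, (∀ i, ω.1 i.1 = y i) → PathGraph.mk G ω ∈ U}
  have h : PathGraph.mk G ⁻¹' U =
      Subtype.val ⁻¹' ⋃ R, Finset.restrict (π := fun _ => G.V) (Finset.Iic R) ⁻¹' T R := by
    ext ω
    simp only [Set.mem_preimage, Set.mem_iUnion]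
    constructor
    · intro hω
      obtain ⟨R, hR⟩ := PathGraph.exists_near_subset hU hω
      refine ⟨R, fun ω' hω' => hR _ (PathGraph.near_mk_iff.2 ?_)⟩
      exact LFGraph.ballIso_of_iso SimpleGraph.Iso.refl
        (fun i hi => (hω' ⟨i, Finset.mem_Iic.2 hi⟩).symm)
        fun i hi => (ω.2.dist_zero_le i).trans hi
    · rintro ⟨R, hR⟩
      exact hR ω fun _ => rfl
  rw [h]
  exact measurable_subtype_coe (MeasurableSet.iUnion fun R => measurableSet_of_restrict R (T R))

namespace LFGraph

variable (G : LFGraph)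

theorem exists_isPath : ∃ ω : ℕ → G.V, G.IsPath ω := by
  obtain ⟨x⟩ := G.connected.nonempty
  exact (G.walk_ae_isPath x).exists

open Classical in
/-- The graph `G` with a path `ω`; sequences that are not paths, which the walk avoids almost
surely, are replaced by a fixed path. -/
def toPath (ω : ℕ → G.V) : PathGraph :=
  PathGraph.mk G ⟨if G.IsPath ω then ω else G.exists_isPath.choose, by
    split_ifs with h
    · exact h
    · exact G.exists_isPath.choose_spec⟩

theorem toPath_eq {ω : ℕ → G.V} (h : G.IsPath ω) : G.toPath ω = PathGraph.mk G ⟨ω, h⟩ := by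
  simp only [toPath, if_pos h]

theorem measurable_toPath : Measurable G.toPath :=
  (PathGraph.measurable_mk G).comp
    ((Measurable.ite G.measurableSet_isPath measurable_id measurable_const).subtype_mk)

/-- The law of `G` with the path of the walk started from `x`. -/
def pathLaw (x : G.V) : Measure PathGraph := (G.walk x).map G.toPath

instance (x : G.V) : IsProbabilityMeasure (G.pathLaw x) :=
  Measure.isProbabilityMeasure_map G.measurable_toPath.aemeasurable

theorem pathLaw_iso {G G' : LFGraph} (e : G.graph ≃g G'.graph) (x : G.V) :
    G.pathLaw x = G'.pathLaw (e x) := by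
  have hm : Measurable fun (ω : ℕ → G.V) i => e (ω i) :=
    measurable_pi_lambda _ fun i => (measurable_from_top (f := e)).comp (measurable_pi_apply _)
  have hae := G'.walk_ae_isPath (e x)
  rw [← walk_map_iso e, ae_map_iff hm.aemeasurable G'.measurableSet_isPath] at hae
  rw [pathLaw, pathLaw, ← walk_map_iso e, Measure.map_map G'.measurable_toPath hm]
  refine Measure.map_congr ?_
  filter_upwards [G.walk_ae_isPath x, hae] with ω hω hω'
  rw [Function.comp_apply, toPath_eq _ hω, toPath_eq _ hω']
  exact Quotient.sound ⟨e, fun _ => rfl⟩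

theorem lintegral_walk (x : G.V) {f : (ℕ → G.V) → ENNReal} (hf : Measurable f) :
    ∫⁻ ω, f ω ∂G.walk x = ∑ z ∈ G.stepFin x,
      ((G.stepFin x).card : ENNReal)⁻¹ * ∫⁻ ω, f (cons x ω) ∂G.walk z := by
  conv_lhs => rw [walk_eq_sum]
  rw [lintegral_finsetSum_measure]
  refine Finset.sum_congr rfl fun z _ => ?_
  rw [lintegral_smul_measure, smul_eq_mul, lintegral_map hf (measurable_cons x)]

theorem integral_walk (f : G.V → ℝ) (n : ℕ) (x : G.V) :
    Integrable (fun ω => f (ω n)) (G.walk x) ∧ ∫ ω, f (ω n) ∂G.walk x = G.avg^[n] f x := by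
  have hm : ∀ n, Measurable fun ω : ℕ → G.V => f (ω n) := fun n =>
    (measurable_from_top (f := f)).comp (measurable_pi_apply n)
  induction n generalizing x with
  | zero =>
    have h : (fun ω : ℕ → G.V => f (ω 0)) =ᵐ[G.walk x] fun _ => f x := by
      filter_upwards [G.walk_ae_zero x] with ω hω
      rw [hω]
    exact ⟨(integrable_const _).congr h.symm, by rw [integral_congr_ae h]; simp⟩
  | succ n ih =>
    have hint : ∀ z ∈ G.stepFin x, Integrable (fun ω : ℕ → G.V => f (ω (n + 1)))
        (((G.stepFin x).card : ENNReal)⁻¹ • (G.walk z).map (cons x)) := fun z _ => by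
      refine Integrable.smul_measure ?_ (by simpa using (G.stepFin_card_pos x).ne')
      rw [integrable_map_measure (hm _).aestronglyMeasurable (measurable_cons x).aemeasurable]
      exact (ih z).1
    rw [walk_eq_sum]
    refine ⟨integrable_finsetSum_measure.2 hint, ?_⟩
    rw [integral_finsetSum_measure hint, Function.iterate_succ_apply', avg, Finset.sum_div]
    refine Finset.sum_congr rfl fun z _ => ?_
    rw [integral_smul_measure, integral_map (measurable_cons x).aemeasurable
      (hm _).aestronglyMeasurable, ← (ih z).2, ENNReal.toReal_inv, ENNReal.toReal_natCast,
      smul_eq_mul, mul_comm, ← div_eq_mul_inv]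
    rfl

theorem ae_pathLaw_iff (x : G.V) {p : PathGraph → Prop} (hp : MeasurableSet {q | p q}) :
    (∀ᵐ q ∂G.pathLaw x, p q) ↔ ∀ᵐ ω ∂G.walk x, p (G.toPath ω) :=
  ae_map_iff G.measurable_toPath.aemeasurable hp

end LFGraph

namespace RootedGraph

theorem pathLaw_eq (g : RootedGraph) : g.pathLaw = g.rep.toLFGraph.pathLaw g.rep.root := by
  have hp := g.rep.toLFGraph.measurableSet_isPath
  ext A hA
  rw [RootedGraph.pathLaw, Measure.map_apply (PathGraph.measurable_mk _) hA,
    LFGraph.pathLaw, Measure.map_apply (LFGraph.measurable_toPath _) hA]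
  refine ((MeasurableEmbedding.subtype_coe hp).comap_apply _ _).trans (measure_congr ?_)
  filter_upwards [g.rep.toLFGraph.walk_ae_isPath g.rep.root] with ω hω
  refine propext ⟨?_, fun h => ⟨⟨ω, hω⟩, ?_, rfl⟩⟩
  · rintro ⟨⟨ω', hω'⟩, hA', rfl⟩
    change LFGraph.toPath _ _ ∈ A
    rw [LFGraph.toPath_eq _ hω']
    exact hA'
  · change LFGraph.toPath _ _ ∈ A at h
    rwa [LFGraph.toPath_eq _ hω] at h

theorem pathLaw_mk (G : LFGraph) (x : G.V) : (mk G x).pathLaw = G.pathLaw x := by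
  obtain ⟨e, he⟩ := exists_iso_mk G x
  rw [pathLaw_eq, ← he, LFGraph.pathLaw_iso e]

instance (g : RootedGraph) : IsProbabilityMeasure g.pathLaw := by
  rw [pathLaw_eq]; infer_instance

/-- The probability of a basic set depends on a ball around the root only. -/
theorem pathLaw_nbhd_eq {r : ℕ} {g g' : RootedGraph} (h : Near r g g') (q : PathGraph) :
    g.pathLaw (PathGraph.nbhd r q) = g'.pathLaw (PathGraph.nbhd r q) := by
  obtain ⟨φ, hφ, hbij, -, hstep, e, he⟩ := LFGraph.BallIso.exists_map h
  have hroot : φ g.rep.root = g'.rep.root := hφ 0 le_rfl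
  let F : Set (ℕ → g'.rep.V) := {ω | LFGraph.BallIso q.rep.toLFGraph g'.rep.toLFGraph q.rep.path
    (fun i => ω (min i r)) r r}
  have hF : MeasurableSet F := by
    have : F = Finset.restrict (π := fun _ => g'.rep.V) (Finset.Iic r) ⁻¹'
        {y | LFGraph.BallIso q.rep.toLFGraph g'.rep.toLFGraph q.rep.path
          (fun i => y ⟨min i r, Finset.mem_Iic.2 (min_le_right _ _)⟩) r r} := rfl
    rw [this]
    exact measurableSet_of_restrict r _
  have hmem : ∀ (G : LFGraph) (ω : {ω : ℕ → G.V // G.IsPath ω}),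
      G.toPath ω.1 ∈ PathGraph.nbhd r q ↔ LFGraph.BallIso q.rep.toLFGraph G q.rep.path ω.1 r r := by
    intro G ω
    rw [LFGraph.toPath_eq G ω.2]
    change PathGraph.Near r q _ ↔ _
    nth_rw 1 [← q.mk_rep]
    exact PathGraph.near_mk_iff
  have hm1 : Measurable fun (ω : ℕ → g.rep.V) i => φ (ω (min i r)) :=
    measurable_pi_lambda _ fun i => (measurable_from_top (f := φ)).comp (measurable_pi_apply _)
  have hm2 : Measurable fun (ω : ℕ → g'.rep.V) i => ω (min i r) :=
    measurable_pi_lambda _ fun i => measurable_pi_apply _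
  have hwalk := congrArg (fun μ => μ F) (LFGraph.walk_map_min φ r g.rep.root hstep)
  rw [Measure.map_apply hm1 hF, Measure.map_apply hm2 hF, hroot] at hwalk
  rw [pathLaw_eq, pathLaw_eq, LFGraph.pathLaw, LFGraph.pathLaw,
    Measure.map_apply (LFGraph.measurable_toPath _) (PathGraph.measurableSet_nbhd r q),
    Measure.map_apply (LFGraph.measurable_toPath _) (PathGraph.measurableSet_nbhd r q)]
  have e1 : LFGraph.toPath _ ⁻¹' PathGraph.nbhd r q =ᵐ[g.rep.toLFGraph.walk g.rep.root]
      (fun (ω : ℕ → g.rep.V) i => φ (ω (min i r))) ⁻¹' F := by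
    filter_upwards [g.rep.toLFGraph.walk_ae_zero g.rep.root,
      g.rep.toLFGraph.walk_ae_isPath g.rep.root] with ω h0 hp
    have hball : ∀ i ≤ r, ω i ∈ g.rep.toLFGraph.ball g.rep.root r := fun i hi => by
      have := (hp.dist_zero_le i).trans hi
      rwa [h0] at this
    have hiso : LFGraph.BallIso g.rep.toLFGraph g'.rep.toLFGraph ω
        (fun i => φ (ω (min (min i r) r))) r r := by
      unfold LFGraph.BallIso
      have h00 : φ (ω (min (min 0 r) r)) = g'.rep.root := by simp [h0, hroot]
      beta_reduce
      rw [h00, h0]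
      refine ⟨e, fun i hi => ⟨hball i hi, ?_⟩⟩
      rw [min_eq_left hi, min_eq_left hi, he _ (hball i hi)]
    exact propext ((hmem _ ⟨ω, hp⟩).trans (show _ ↔ LFGraph.BallIso q.rep.toLFGraph
      g'.rep.toLFGraph q.rep.path (fun i => φ (ω (min (min i r) r))) r r from
      ⟨fun h => h.trans hiso, fun h => h.trans hiso.symm⟩))
  have e2 : LFGraph.toPath _ ⁻¹' PathGraph.nbhd r q =ᵐ[g'.rep.toLFGraph.walk g'.rep.root]
      (fun (ω : ℕ → g'.rep.V) i => ω (min i r)) ⁻¹' F := by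
    filter_upwards [g'.rep.toLFGraph.walk_ae_isPath g'.rep.root] with ω hp
    have hiso : LFGraph.BallIso g'.rep.toLFGraph g'.rep.toLFGraph ω
        (fun i => ω (min (min i r) r)) r r :=
      LFGraph.ballIso_of_iso SimpleGraph.Iso.refl
        (fun i hi => by rw [min_eq_left hi, min_eq_left hi]; rfl)
        fun i hi => (hp.dist_zero_le i).trans hi
    exact propext ((hmem _ ⟨ω, hp⟩).trans (show _ ↔ LFGraph.BallIso q.rep.toLFGraph
      g'.rep.toLFGraph q.rep.path (fun i => ω (min (min i r) r)) r r from
      ⟨fun h => h.trans hiso, fun h => h.trans hiso.symm⟩))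
  rw [measure_congr e1, measure_congr e2, hwalk]

theorem measurable_pathLaw : Measurable RootedGraph.pathLaw := by
  refine Measurable.measure_of_isPiSystem_of_isProbabilityMeasure
    PathGraph.measurableSpace_eq_generateFrom PathGraph.isPiSystem_nbhd ?_
  rintro _ ⟨r, q, rfl⟩
  exact measurable_of_near r fun g g' h => pathLaw_nbhd_eq h q

/-- The law of the graph with the walk, as a Markov kernel. -/
def pathKernel : Kernel RootedGraph PathGraph := ⟨RootedGraph.pathLaw, measurable_pathLaw⟩

instance : IsMarkovKernel pathKernel := ⟨fun g => inferInstanceAs (IsProbabilityMeasure g.pathLaw)⟩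

end RootedGraph

/-! ### Stationarity -/

section Stationary

variable {P : Measure RootedGraph}

theorem pathLaw_eq_bind (P : Measure RootedGraph) :
    pathLaw P = P.bind RootedGraph.pathKernel := rfl

instance [IsProbabilityMeasure P] : IsProbabilityMeasure (pathLaw P) := by
  rw [pathLaw_eq_bind]; infer_instance

theorem lintegral_pathLaw (P : Measure RootedGraph) {f : PathGraph → ENNReal} (hf : Measurable f) :
    ∫⁻ q, f q ∂pathLaw P =
      ∫⁻ g, ∫⁻ ω, f (g.rep.toLFGraph.toPath ω) ∂g.rep.toLFGraph.walk g.rep.root ∂P := by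
  rw [pathLaw, Measure.lintegral_bind RootedGraph.measurable_pathLaw.aemeasurable hf.aemeasurable]
  refine lintegral_congr fun g => ?_
  rw [RootedGraph.pathLaw_eq, LFGraph.pathLaw, lintegral_map hf (LFGraph.measurable_toPath _)]

theorem integral_pathLaw [IsProbabilityMeasure P] {f : PathGraph → ℝ} (hf : Measurable f)
    (hint : Integrable f (pathLaw P)) :
    ∫ q, f q ∂pathLaw P =
      ∫ g, ∫ ω, f (g.rep.toLFGraph.toPath ω) ∂g.rep.toLFGraph.walk g.rep.root ∂P := by
  rw [pathLaw_eq_bind, Measure.comp_eq_comp_const_apply] at hint ⊢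
  rw [Kernel.integral_comp hint, Kernel.const_apply]
  refine integral_congr_ae (ae_of_all _ fun g => ?_)
  change ∫ q, f q ∂g.pathLaw = _
  rw [RootedGraph.pathLaw_eq, LFGraph.pathLaw, integral_map
    (LFGraph.measurable_toPath _).aemeasurable hf.aestronglyMeasurable]

theorem ae_pathLaw_iff {p : PathGraph → Prop} (hp : MeasurableSet {q | p q}) :
    (∀ᵐ q ∂pathLaw P, p q) ↔
      ∀ᵐ g ∂P, ∀ᵐ ω ∂g.rep.toLFGraph.walk g.rep.root, p (g.rep.toLFGraph.toPath ω) := by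
  rw [pathLaw_eq_bind, Measure.ae_comp_iff hp]
  refine eventually_congr (ae_of_all _ fun g => ?_)
  change (∀ᵐ q ∂g.pathLaw, p q) ↔ _
  rw [RootedGraph.pathLaw_eq, LFGraph.ae_pathLaw_iff _ _ hp]

/-- Stationarity for expectations. -/
theorem IsStationary.integral_eq [IsProbabilityMeasure P] (h : IsStationary P) {n : ℕ} (hn : 1 ≤ n)
    {F : RootedGraph → ℝ} (hF : Measurable F) (hint : Integrable F P) :
    ∫ g, g.rep.toLFGraph.avg^[n] (fun y => F (RootedGraph.mk g.rep.toLFGraph y)) g.rep.root ∂P =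
      ∫ g, F g ∂P := by
  have hm := PathGraph.measurable_rootAt n
  have hint' := hint
  rw [← h n hn, integrable_map_measure hF.aestronglyMeasurable hm.aemeasurable] at hint'
  conv_rhs => rw [← h n hn, integral_map hm.aemeasurable hF.aestronglyMeasurable]
  change _ = ∫ q, (F ∘ PathGraph.rootAt n) q ∂_
  rw [integral_pathLaw (hF.comp hm) hint']
  refine integral_congr_ae (ae_of_all _ fun g => ?_)
  simp only
  rw [← (LFGraph.integral_walk _ _ _ _).2]
  refine integral_congr_ae ?_
  filter_upwards [g.rep.toLFGraph.walk_ae_isPath g.rep.root] with ω hω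
  rw [LFGraph.toPath_eq _ hω]
  rfl

/-- An almost sure property of a stationary random graph holds from the point of view of every
vertex simultaneously. -/
theorem IsStationary.ae_forall (h : IsStationary P) {p : RootedGraph → Prop}
    (hp : MeasurableSet {g | p g}) (hae : ∀ᵐ g ∂P, p g) :
    ∀ᵐ g ∂P, ∀ x, p (RootedGraph.mk g.rep.toLFGraph x) := by
  have h1 : ∀ n : ℕ, ∀ᵐ g ∂P, ∀ y, 0 < g.rep.toLFGraph.prob (n + 1) g.rep.root y →
      p (RootedGraph.mk g.rep.toLFGraph y) := by
    intro n
    have hm := PathGraph.measurable_rootAt (n + 1)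
    have hae' := hae
    rw [← h (n + 1) (by omega), ae_map_iff hm.aemeasurable hp] at hae'
    rw [ae_pathLaw_iff (p := fun q => p (PathGraph.rootAt (n + 1) q)) (hm hp)] at hae'
    filter_upwards [hae'] with g hg y hy
    by_contra hneg
    refine hy.ne' ?_
    rw [LFGraph.prob, measureReal_def, ENNReal.toReal_eq_zero_iff]
    left
    have hne : ∀ᵐ ω ∂g.rep.toLFGraph.walk g.rep.root, ¬ ω (n + 1) = y := by
      filter_upwards [hg, g.rep.toLFGraph.walk_ae_isPath g.rep.root] with ω hω hpath heq
      rw [LFGraph.toPath_eq _ hpath, PathGraph.rootAt_mk] at hω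
      simp only [heq] at hω
      exact hneg hω
    simpa [ae_iff] using hne
  filter_upwards [ae_all_iff.2 h1, hae] with g hg hg0 x
  rcases Nat.eq_zero_or_pos (g.rep.graph.dist g.rep.root x) with h0 | hpos
  · have : g.rep.root = x := g.rep.connected.dist_eq_zero_iff.1 h0
    rw [← this, RootedGraph.mk_rep]
    exact hg0
  · refine hg (g.rep.graph.dist g.rep.root x - 1) x (LFGraph.prob_dist_pos _ ?_)
    omega

/-- The law of a stationary random graph with its walk is invariant under the shift. -/
theorem IsStationary.measurePreserving_shift (h : IsStationary P) :
    MeasurePreserving PathGraph.shift (pathLaw P) (pathLaw P) := by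
  refine ⟨PathGraph.measurable_shift, ?_⟩
  ext A hA
  have hΦ : Measurable fun g : RootedGraph => g.pathLaw A :=
    (Measure.measurable_coe hA).comp RootedGraph.measurable_pathLaw
  have hm := PathGraph.measurable_rootAt 1
  have e1 : pathLaw P A = ∫⁻ g, g.pathLaw A ∂P :=
    Measure.bind_apply hA RootedGraph.measurable_pathLaw.aemeasurable
  have e2 : ∫⁻ g, g.pathLaw A ∂P = ∫⁻ q, (PathGraph.rootAt 1 q).pathLaw A ∂pathLaw P := by
    conv_lhs => rw [← h 1 le_rfl, lintegral_map hΦ hm]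
  rw [Measure.map_apply PathGraph.measurable_shift hA, e1, e2,
    lintegral_pathLaw P (f := fun q => (PathGraph.rootAt 1 q).pathLaw A) (hΦ.comp hm)]
  rw [pathLaw, Measure.bind_apply (PathGraph.measurable_shift hA)
    RootedGraph.measurable_pathLaw.aemeasurable]
  refine lintegral_congr fun g => ?_
  set G := g.rep.toLFGraph
  have hl : g.pathLaw (PathGraph.shift ⁻¹' A) =
      G.walk g.rep.root (G.toPath ⁻¹' (PathGraph.shift ⁻¹' A)) := by
    rw [RootedGraph.pathLaw_eq, LFGraph.pathLaw,
      Measure.map_apply G.measurable_toPath (PathGraph.measurable_shift hA)]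
  have hr : ∫⁻ ω, (G.toPath ω |> PathGraph.rootAt 1).pathLaw A ∂G.walk g.rep.root =
      ∫⁻ ω, (RootedGraph.mk G (ω 1)).pathLaw A ∂G.walk g.rep.root := by
    refine lintegral_congr_ae ?_
    filter_upwards [G.walk_ae_isPath g.rep.root] with ω hω
    rw [LFGraph.toPath_eq _ hω, PathGraph.rootAt_mk]
  have hmeas : Measurable fun ω : ℕ → G.V => (RootedGraph.mk G (ω 1)).pathLaw A :=
    (measurable_from_top (f := fun y => (RootedGraph.mk G y).pathLaw A)).comp (measurable_pi_apply 1)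
  refine hl.trans (Eq.trans ?_ hr.symm)
  rw [G.walk_apply _ (G.measurable_toPath (PathGraph.measurable_shift hA)),
    G.lintegral_walk _ hmeas]
  refine Finset.sum_congr rfl fun z hz => congrArg _ ?_
  have hz0 : ∫⁻ ω, (RootedGraph.mk G (LFGraph.cons g.rep.root ω 1)).pathLaw A ∂G.walk z =
      (RootedGraph.mk G z).pathLaw A := by
    have : ∀ᵐ ω ∂G.walk z, (RootedGraph.mk G (LFGraph.cons g.rep.root ω 1)).pathLaw A =
        (RootedGraph.mk G z).pathLaw A := by
      filter_upwards [G.walk_ae_zero z] with ω hω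
      rw [← hω]
      rfl
    rw [lintegral_congr_ae this]
    simp
  rw [hz0, RootedGraph.pathLaw_mk, LFGraph.pathLaw, Measure.map_apply G.measurable_toPath hA]
  refine measure_congr ?_
  filter_upwards [G.walk_ae_zero z, G.walk_ae_isPath z] with ω h0 hω
  have hc : G.IsPath (LFGraph.cons g.rep.root ω) := by
    intro n
    cases n with
    | zero =>
      change ω 0 ∈ G.stepSet g.rep.root
      rw [h0]
      exact G.mem_stepFin.1 hz
    | succ n => exact hω n
  change (PathGraph.shift (G.toPath (LFGraph.cons g.rep.root ω)) ∈ A) = (G.toPath ω ∈ A)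
  rw [LFGraph.toPath_eq _ hc, LFGraph.toPath_eq _ hω, PathGraph.shift_mk]
  rfl

end Stationary

/-! ### The mean ergodic theorem -/

/-- The mean ergodic theorem for a contraction `U` of a Hilbert space, with the limit characterised
by its inner products with the fixed vectors of `U`. -/
theorem exists_tendsto_birkhoffAverage {E : Type*} [NormedAddCommGroup E] [InnerProductSpace ℝ E]
    [CompleteSpace E] (U : E →L[ℝ] E) (hU : ‖U‖ ≤ 1) (x : E) :
    ∃ g : E, U g = g ∧ (∀ u, U u = u → inner ℝ u g = inner ℝ u x) ∧
      Tendsto (birkhoffAverage ℝ U _root_.id · x) atTop (𝓝 g) := by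
  have hlim := ContinuousLinearMap.tendsto_birkhoffAverage_orthogonalProjection U hU x
  refine ⟨_, ?_, fun u hu => ?_, hlim⟩
  · have h := ((U.eqLocus (1 : E →L[ℝ] E)).orthogonalProjectionOnto x).2
    rw [LinearMap.mem_eqLocus] at h
    exact h
  · have hu' : u ∈ U.eqLocus (1 : E →L[ℝ] E) := by
      rw [LinearMap.mem_eqLocus]
      exact hu
    exact Submodule.inner_orthogonalProjectionOnto_eq_of_mem_left ⟨u, hu'⟩ x

section MeanErgodic

variable {Ω : Type*} [MeasurableSpace Ω] {μ : Measure Ω} {T : Ω → Ω}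

/-- The Koopman operator of a measure preserving map. -/
def koopman (hT : MeasurePreserving T μ μ) : Lp ℝ 2 μ →L[ℝ] Lp ℝ 2 μ :=
  (Lp.compMeasurePreservingₗᵢ ℝ T hT).toContinuousLinearMap

theorem norm_koopman_le (hT : MeasurePreserving T μ μ) : ‖koopman hT‖ ≤ 1 := by
  unfold koopman
  exact LinearIsometry.norm_toContinuousLinearMap_le _

theorem koopman_toLp (hT : MeasurePreserving T μ μ) {g : Ω → ℝ} (hg : MemLp g 2 μ) :
    koopman hT (hg.toLp g) = (hg.comp_measurePreserving hT).toLp (g ∘ T) :=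
  Lp.toLp_compMeasurePreserving hg hT

theorem koopman_iterate_toLp (hT : MeasurePreserving T μ μ) {f : Ω → ℝ} (hf : MemLp f 2 μ)
    (n : ℕ) : ∃ h : MemLp (f ∘ T^[n]) 2 μ, (koopman hT)^[n] (hf.toLp f) = h.toLp _ := by
  induction n with
  | zero => exact ⟨hf, rfl⟩
  | succ n ih =>
    obtain ⟨h, hn⟩ := ih
    refine ⟨h.comp_measurePreserving hT, ?_⟩
    rw [Function.iterate_succ_apply', hn, koopman_toLp]
    rfl

theorem birkhoffSum_koopman_toLp (hT : MeasurePreserving T μ μ) {f : Ω → ℝ} (hf : MemLp f 2 μ)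
    (N : ℕ) : ∃ h : MemLp (birkhoffSum T f N) 2 μ,
      birkhoffSum (koopman hT) _root_.id N (hf.toLp f) = h.toLp _ := by
  induction N with
  | zero =>
    have h0 : birkhoffSum T f 0 = 0 := funext fun ω => birkhoffSum_zero T f ω
    refine ⟨h0 ▸ MemLp.zero, ?_⟩
    rw [birkhoffSum_zero, ← MemLp.toLp_zero (MemLp.zero : MemLp (0 : Ω → ℝ) 2 μ)]
    congr 1
  | succ N ih =>
    obtain ⟨h, hN⟩ := ih
    obtain ⟨h', hN'⟩ := koopman_iterate_toLp hT hf N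
    have e : birkhoffSum T f (N + 1) = birkhoffSum T f N + f ∘ T^[N] :=
      funext fun ω => birkhoffSum_succ T f N ω
    refine ⟨e ▸ h.add h', ?_⟩
    rw [birkhoffSum_succ, hN, _root_.id, hN', ← MemLp.toLp_add]
    congr 1
    exact e.symm

/-- Birkhoff averages of a square integrable function converge in probability to its mean. -/
theorem tendstoInMeasure_birkhoffAverage [IsProbabilityMeasure μ] (hT : Ergodic T μ) {f : Ω → ℝ}
    (hf : MemLp f 2 μ) :
    TendstoInMeasure μ (fun N => birkhoffAverage ℝ T f N) atTop fun _ => ∫ ω, f ω ∂μ := by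
  have hmp := hT.toMeasurePreserving
  obtain ⟨g, hgfix, hginner, hlim⟩ := exists_tendsto_birkhoffAverage (koopman hmp)
    (norm_koopman_le hmp) (hf.toLp f)
  -- the fixed vectors of the Koopman operator are the constants
  have hgae : g ∘ T =ᵐ[μ] g := by
    have h1 := Lp.coeFn_compMeasurePreserving g hmp
    have h2 : Lp.compMeasurePreserving T hmp g = g := hgfix
    rw [h2] at h1
    exact h1.symm
  obtain ⟨c, hc⟩ := hT.quasiErgodic.ae_eq_const_of_ae_eq_comp_ae (Lp.aestronglyMeasurable g) hgae
  -- the mean is the inner product with the fixed vector `1`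
  have hone : MemLp (fun _ : Ω => (1 : ℝ)) 2 μ := memLp_const 1
  have hcf : c = ∫ ω, f ω ∂μ := by
    have h2 := hginner (hone.toLp _) (koopman_toLp hmp hone)
    have e1 : ∀ u : Lp ℝ 2 μ, inner ℝ (hone.toLp _ : Lp ℝ 2 μ) u = ∫ ω, u ω ∂μ := by
      intro u
      rw [L2.inner_def]
      refine integral_congr_ae ?_
      filter_upwards [hone.coeFn_toLp] with ω hω
      rw [hω]
      simp
    rw [e1, e1, integral_congr_ae hc, integral_congr_ae hf.coeFn_toLp] at h2
    simpa using h2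
  have hlim' := tendstoInMeasure_of_tendsto_Lp hlim
  refine hlim'.congr (fun N => ?_) (hc.trans (by rw [hcf]; rfl))
  obtain ⟨h, hN⟩ := birkhoffSum_koopman_toLp hmp hf N
  rw [birkhoffAverage, hN]
  filter_upwards [Lp.coeFn_smul (N : ℝ)⁻¹ (h.toLp _), h.coeFn_toLp] with ω h1 h2
  rw [h1, Pi.smul_apply, h2, birkhoffAverage]

end MeanErgodic

/-! ### The walk does not exceed its speed -/

/-- Summing `d(x_0, x_{t+m}) ≤ d(x_0, x_t) + d(x_t, x_{t+m})` over `t < N`, all but `m` terms on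
either side cancel. Those at the lower end are at most `m`, and those at the upper end differ from
`d(x_0, x_N)` by at most `m`. -/
theorem mul_dist_le {G : LFGraph} {ω : ℕ → G.V} (hω : G.IsPath ω) (m N : ℕ) :
    m * G.graph.dist (ω 0) (ω N) ≤
      ∑ t ∈ Finset.range N, G.graph.dist (ω t) (ω (t + m)) + 2 * m ^ 2 := by
  set a : ℕ → ℕ := fun t => G.graph.dist (ω 0) (ω t) with ha
  have h1 : ∑ t ∈ Finset.range N, a (m + t) ≤
      ∑ t ∈ Finset.range N, a t + ∑ t ∈ Finset.range N, G.graph.dist (ω t) (ω (t + m)) := by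
    rw [← Finset.sum_add_distrib]
    refine Finset.sum_le_sum fun t _ => ?_
    rw [add_comm m t]
    exact G.dist_triangle _ _ _
  have h2 := Finset.sum_range_add a m N
  have h3 := Finset.sum_range_add a N m
  rw [add_comm N m] at h3
  have h4 : ∑ t ∈ Finset.range m, a t ≤ m * m := by
    refine (Finset.sum_le_card_nsmul _ _ m fun t ht => ?_).trans (by simp)
    exact (hω.dist_zero_le t).trans (Finset.mem_range.1 ht).le
  have h5 : m * a N ≤ ∑ i ∈ Finset.range m, a (N + i) + m * m := by
    have : ∀ i ∈ Finset.range m, a N ≤ a (N + i) + m := fun i hi => by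
      have h6 := G.dist_triangle (ω 0) (ω (N + i)) (ω N)
      have h7 := hω.dist_le N i
      rw [SimpleGraph.dist_comm] at h7
      have := Finset.mem_range.1 hi
      simp only [ha]
      omega
    have := Finset.sum_le_sum this
    rw [Finset.sum_add_distrib] at this
    simpa using this
  have : m ^ 2 = m * m := sq m
  simp only [ha] at *
  omega

theorem PathGraph.displacement_shift_iterate (q : PathGraph) (m t : ℕ) :
    (PathGraph.shift^[t] q).displacement m = q.rep.graph.dist (q.rep.path t) (q.rep.path (t + m)) := by
  conv_lhs => rw [← q.mk_rep, PathGraph.shift_iterate_mk, PathGraph.displacement_mk]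
  simp only [zero_add]
  rw [add_comm m t]

theorem PathGraph.integrable_displacement (μ : Measure PathGraph) [IsFiniteMeasure μ] (n : ℕ) :
    Integrable (fun q : PathGraph => (q.displacement n : ℝ)) μ := by
  refine Integrable.of_bound (C := n)
    ((measurable_from_top (f := fun k : ℕ => (k : ℝ))).comp
      (PathGraph.measurable_displacement n)).aestronglyMeasurable (ae_of_all _ fun q => ?_)
  rw [Real.norm_natCast]
  exact_mod_cast q.displacement_le n

variable {P : Measure RootedGraph}

/-- The mean displacement of the walk at time `n`. -/
def meanDisplacement (P : Measure RootedGraph) (n : ℕ) : ℝ :=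
  ∫ q, (q.displacement n : ℝ) ∂pathLaw P

theorem meanDisplacement_nonneg (P : Measure RootedGraph) (n : ℕ) : 0 ≤ meanDisplacement P n :=
  integral_nonneg fun _ => Nat.cast_nonneg _

theorem meanDisplacement_div_le [IsProbabilityMeasure P] (n : ℕ) :
    meanDisplacement P n / n ≤ 1 := by
  refine div_le_one_of_le₀ ?_ (Nat.cast_nonneg _)
  have := integral_mono (PathGraph.integrable_displacement (pathLaw P) n) (integrable_const (n : ℝ))
    fun q => Nat.cast_le.2 (q.displacement_le n)
  rw [integral_const, probReal_univ, one_smul] at this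
  exact this

theorem isBoundedUnder_le_of_le {u : ℕ → ℝ} {b : ℝ} (h : ∀ n, u n ≤ b) :
    IsBoundedUnder (· ≤ ·) atTop u := isBoundedUnder_of ⟨b, h⟩

theorem isCoboundedUnder_le_of_nonneg {u : ℕ → ℝ} (h : ∀ n, 0 ≤ u n) :
    IsCoboundedUnder (· ≤ ·) atTop u :=
  IsBoundedUnder.isCoboundedUnder_le (isBoundedUnder_of ⟨0, h⟩)

theorem speed_nonneg [IsProbabilityMeasure P] : 0 ≤ speed P :=
  le_limsup_of_frequently_le (Frequently.of_forall fun n =>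
    div_nonneg (meanDisplacement_nonneg P n) (Nat.cast_nonneg n))
    (isBoundedUnder_le_of_le meanDisplacement_div_le)

/-- The walk on an ergodic stationary random graph does not exceed the speed `s` by a positive
factor, with probability tending to one. -/
theorem tendsto_measure_displacement [IsProbabilityMeasure P] (hstat : IsStationary P)
    (herg : IsErgodic P) {a : ℝ} (ha : speed P < a) :
    Tendsto (fun N : ℕ => (pathLaw P).real {q | a * N < q.displacement N}) atTop (𝓝 0) := by
  obtain ⟨b, hb, hba⟩ := exists_between ha
  have hev := eventually_lt_of_limsup_lt hb (isBoundedUnder_le_of_le meanDisplacement_div_le)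
  obtain ⟨m, hm, hm1⟩ := (hev.and (eventually_ge_atTop 1)).exists
  have hm0 : (0 : ℝ) < m := Nat.cast_pos.2 hm1
  rw [div_lt_iff₀ hm0] at hm
  have hT : Ergodic PathGraph.shift (pathLaw P) := ⟨hstat.measurePreserving_shift, herg⟩
  set f : PathGraph → ℝ := fun q => (q.displacement m : ℝ) with hf
  have hfm : MemLp f 2 (pathLaw P) := by
    refine MemLp.of_bound (C := m)
      ((measurable_from_top (f := fun k : ℕ => (k : ℝ))).comp
      (PathGraph.measurable_displacement m)).aestronglyMeasurable (ae_of_all _ fun q => ?_)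
    rw [hf, Real.norm_natCast]
    exact_mod_cast q.displacement_le m
  have hconv := tendstoInMeasure_iff_measureReal_dist.1 (tendstoInMeasure_birkhoffAverage hT hfm)
    (m * (a - b) / 2) (by have := sub_pos.2 hba; positivity)
  refine tendsto_of_tendsto_of_tendsto_of_le_of_le' tendsto_const_nhds hconv
    (Eventually.of_forall fun _ => measureReal_nonneg) ?_
  have hN : ∀ᶠ N : ℕ in atTop, 4 * (m : ℝ) / (a - b) ≤ N :=
    tendsto_natCast_atTop_atTop.eventually (eventually_ge_atTop _)
  filter_upwards [hN, eventually_ge_atTop 1] with N hN hN1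
  have hN0 : (0 : ℝ) < N := Nat.cast_pos.2 hN1
  refine measureReal_mono (fun q hq => ?_)
  have hq' : a * N < q.displacement N := hq
  have hdet := mul_dist_le q.rep.isPath m N
  have hsum : (∑ t ∈ Finset.range N, q.rep.graph.dist (q.rep.path t) (q.rep.path (t + m)) : ℕ) =
      birkhoffSum PathGraph.shift f N q := by
    rw [birkhoffSum, Nat.cast_sum]
    refine Finset.sum_congr rfl fun t _ => ?_
    rw [hf]
    simp only
    rw [PathGraph.displacement_shift_iterate]
  have hdet' : (m : ℝ) * q.displacement N ≤ birkhoffSum PathGraph.shift f N q + 2 * (m : ℝ) ^ 2 := by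
    rw [← hsum, PathGraph.displacement]
    exact_mod_cast hdet
  rw [div_le_iff₀ (sub_pos.2 hba)] at hN
  change m * (a - b) / 2 ≤ dist _ _
  refine le_trans ?_ (le_abs_self _)
  rw [birkhoffAverage, smul_eq_mul, le_sub_iff_add_le]
  have hmean : ∫ q, f q ∂pathLaw P ≤ b * m := hm.le
  rw [inv_mul_eq_div, le_div_iff₀ hN0]
  have h1 : (m : ℝ) * (a * N) ≤ m * q.displacement N := mul_le_mul_of_nonneg_left hq'.le hm0.le
  have h2 : (∫ q, f q ∂pathLaw P) * N ≤ b * m * N := mul_le_mul_of_nonneg_right hmean hN0.le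
  have h3 : m * (4 * (m : ℝ)) ≤ m * (N * (a - b)) := mul_le_mul_of_nonneg_left hN hm0.le
  nlinarith

/-! ### Functionals of the walk as functions of the rooted graph -/

theorem RootedGraph.measurable_integral_pathLaw {f : PathGraph → ℝ} (hf : Measurable f) :
    Measurable fun g : RootedGraph => ∫ q, f q ∂g.pathLaw :=
  (hf.stronglyMeasurable.integral_kernel (κ := RootedGraph.pathKernel)).measurable

/-- The expectation of a function of the displacement, through the transition probabilities. -/
theorem LFGraph.integral_displacement (G : LFGraph) (φ : ℕ → ℝ) (n : ℕ) (x : G.V)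
    (t : Finset G.V) (ht : G.ballFin x n ⊆ t) :
    ∫ q, φ (q.displacement n) ∂G.pathLaw x = ∑ y ∈ t, G.prob n x y * φ (G.graph.dist x y) := by
  have hm : Measurable fun q : PathGraph => φ (q.displacement n) :=
    (measurable_from_top (f := φ)).comp (PathGraph.measurable_displacement n)
  rw [LFGraph.pathLaw, integral_map G.measurable_toPath.aemeasurable hm.aestronglyMeasurable,
    ← G.avg_iterate _ n x t ht, ← (G.integral_walk (fun y => φ (G.graph.dist x y)) n x).2]
  refine integral_congr_ae ?_
  filter_upwards [G.walk_ae_zero x, G.walk_ae_isPath x] with ω h0 hω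
  rw [LFGraph.toPath_eq _ hω, PathGraph.displacement_mk, ← h0]

theorem integral_integral_displacement (P : Measure RootedGraph) [IsProbabilityMeasure P]
    (φ : ℕ → ℝ) (n : ℕ) :
    Integrable (fun g : RootedGraph => ∫ q, φ (q.displacement n) ∂g.pathLaw) P ∧
      ∫ g, ∫ q, φ (q.displacement n) ∂g.pathLaw ∂P =
        ∫ q, φ (q.displacement n) ∂pathLaw P := by
  have hm : Measurable fun q : PathGraph => φ (q.displacement n) :=
    (measurable_from_top (f := φ)).comp (PathGraph.measurable_displacement n)
  have hint : Integrable (fun q : PathGraph => φ (q.displacement n)) (pathLaw P) := by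
    refine Integrable.of_bound (C := ∑ k ∈ Finset.range (n + 1), |φ k|) hm.aestronglyMeasurable
      (ae_of_all _ fun q => ?_)
    exact Finset.single_le_sum (f := fun k => |φ k|) (fun _ _ => abs_nonneg _)
      (Finset.mem_range.2 (Nat.lt_succ_of_le (q.displacement_le n)))
  rw [pathLaw_eq_bind, Measure.comp_eq_comp_const_apply] at hint ⊢
  refine ⟨?_, ?_⟩
  · have := hint.integral_comp
    rwa [Kernel.const_apply] at this
  · rw [Kernel.integral_comp hint, Kernel.const_apply]
    rfl

namespace RootedGraph

/-- The entropy gained in the first step, see `LFGraph.gain`, as a function of the rooted graph. -/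
def gain (n : ℕ) (g : RootedGraph) : ℝ :=
  g.entropy (n + 1) - ∫ q, (PathGraph.rootAt 1 q).entropy n ∂g.pathLaw

theorem measurable_gain (n : ℕ) : Measurable (gain n) :=
  (measurable_entropy (n + 1)).sub
    (measurable_integral_pathLaw ((measurable_entropy n).comp (PathGraph.measurable_rootAt 1)))

theorem gain_mk (n : ℕ) (G : LFGraph) (x : G.V) : (mk G x).gain n = G.gain n x := by
  have hm : Measurable fun q : PathGraph => (PathGraph.rootAt 1 q).entropy n :=
    (measurable_entropy n).comp (PathGraph.measurable_rootAt 1)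
  rw [gain, LFGraph.gain, entropy_mk, pathLaw_mk, LFGraph.pathLaw,
    integral_map G.measurable_toPath.aemeasurable hm.aestronglyMeasurable]
  congr 1
  refine Eq.trans ?_ (G.integral_walk (fun z => G.entropy z n) 1 x).2
  refine integral_congr_ae ?_
  filter_upwards [G.walk_ae_isPath x] with ω hω
  rw [LFGraph.toPath_eq _ hω, PathGraph.rootAt_mk, entropy_mk]

theorem gain_eq_rep (n : ℕ) (g : RootedGraph) : g.gain n = g.rep.toLFGraph.gain n g.rep.root := by
  conv_lhs => rw [← mk_rep g, gain_mk]

theorem gain_nonneg (n : ℕ) (g : RootedGraph) : 0 ≤ g.gain n := by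
  rw [gain_eq_rep]; exact LFGraph.gain_nonneg _ _ _

theorem gain_antitone (g : RootedGraph) : Antitone fun n => g.gain n := by
  simp only [gain_eq_rep]
  exact LFGraph.gain_antitone _ _

theorem entropy_nonneg (n : ℕ) (g : RootedGraph) : 0 ≤ g.entropy n := LFGraph.entropy_nonneg _ _ _

theorem ballCard_eq (g : RootedGraph) (n : ℕ) :
    g.ballCard n = (g.rep.toLFGraph.ballFin g.rep.root n).card := (LFGraph.card_ballFin _ _ _).symm

theorem entropy_le_log_ballCard (n : ℕ) (g : RootedGraph) :
    g.entropy n ≤ Real.log (g.ballCard n) := by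
  rw [ballCard_eq]; exact LFGraph.entropy_le_log_card _ _ _

theorem log_ballCard_nonneg (n : ℕ) (g : RootedGraph) : 0 ≤ Real.log (g.ballCard n) :=
  Real.log_natCast_nonneg _

theorem log_ballCard_le {K : ℕ} (hK : 1 ≤ K) {g : RootedGraph}
    (h : ∀ x, g.rep.toLFGraph.degree x ≤ K) (n : ℕ) :
    Real.log (g.ballCard n) ≤ n * Real.log (K + 1) := by
  rw [ballCard_eq, ← Real.log_pow]
  refine Real.log_le_log (Nat.cast_pos.2 (LFGraph.card_ballFin_pos _ _ _)) ?_
  exact_mod_cast g.rep.toLFGraph.card_ballFin_le hK h g.rep.root n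

end RootedGraph

/-! ### Expected entropy and expected volume -/

theorem HasMeanEntropy.nonneg {P : Measure RootedGraph} {h : ℝ} (hh : HasMeanEntropy P h) : 0 ≤ h :=
  ge_of_tendsto' hh fun n =>
    div_nonneg (integral_nonneg fun g => g.entropy_nonneg n) (Nat.cast_nonneg _)

section Bounded

variable {P : Measure RootedGraph} [IsProbabilityMeasure P] {K : ℕ}

theorem integrable_log_ballCard (hK : 1 ≤ K)
    (hdeg : ∀ᵐ g ∂P, ∀ x, g.rep.toLFGraph.degree x ≤ K) (n : ℕ) :
    Integrable (fun g : RootedGraph => Real.log (g.ballCard n)) P := by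
  refine Integrable.of_bound (C := n * Real.log (K + 1))
    ((measurable_from_top (f := fun k : ℕ => Real.log k)).comp
      (RootedGraph.measurable_ballCard n)).aestronglyMeasurable ?_
  filter_upwards [hdeg] with g hg
  rw [Real.norm_of_nonneg (g.log_ballCard_nonneg n)]
  exact RootedGraph.log_ballCard_le hK hg n

theorem integrable_entropy (hK : 1 ≤ K)
    (hdeg : ∀ᵐ g ∂P, ∀ x, g.rep.toLFGraph.degree x ≤ K) (n : ℕ) :
    Integrable (fun g : RootedGraph => g.entropy n) P := by
  refine (integrable_log_ballCard hK hdeg n).mono'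
    (RootedGraph.measurable_entropy n).aestronglyMeasurable (ae_of_all _ fun g => ?_)
  rw [Real.norm_of_nonneg (g.entropy_nonneg n)]
  exact g.entropy_le_log_ballCard n

theorem integral_log_ballCard_div_le (hK : 1 ≤ K)
    (hdeg : ∀ᵐ g ∂P, ∀ x, g.rep.toLFGraph.degree x ≤ K) (n : ℕ) :
    (∫ g, Real.log (g.ballCard n) ∂P) / n ≤ Real.log (K + 1) := by
  have hL : 0 ≤ Real.log (K + 1) := Real.log_nonneg (by simp)
  refine div_le_of_le_mul₀ (Nat.cast_nonneg _) hL ?_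
  have := integral_mono_ae (integrable_log_ballCard hK hdeg n)
    (integrable_const (n * Real.log (K + 1)))
    (hdeg.mono fun g hg => RootedGraph.log_ballCard_le hK hg n)
  rw [integral_const, probReal_univ, one_smul] at this
  linarith

/-! ### The mean entropy -/

/-- By stationarity the position after the first step looks like the root, so the expected entropy
gain is an increment of the expected entropy. -/
theorem integral_gain (hK : 1 ≤ K) (hdeg : ∀ᵐ g ∂P, ∀ x, g.rep.toLFGraph.degree x ≤ K)
    (hstat : IsStationary P) (n : ℕ) :
    Integrable (RootedGraph.gain n) P ∧
      ∫ g, g.gain n ∂P = expEntropy P (n + 1) - expEntropy P n := by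
  have hi := integrable_entropy hK hdeg
  have hle : ∀ g : RootedGraph, g.gain n ≤ g.entropy (n + 1) := fun g =>
    sub_le_self _ (integral_nonneg fun q => RootedGraph.entropy_nonneg _ _)
  have hg : Integrable (RootedGraph.gain n) P :=
    (hi (n + 1)).mono' (RootedGraph.measurable_gain n).aestronglyMeasurable <| ae_of_all _ fun g => by
      rw [Real.norm_of_nonneg (g.gain_nonneg n)]
      exact hle g
  refine ⟨hg, ?_⟩
  have h := hstat.integral_eq le_rfl (RootedGraph.measurable_entropy n) (hi n)
  have heq : ∀ g : RootedGraph, g.rep.toLFGraph.avg^[1]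
      (fun y => (RootedGraph.mk g.rep.toLFGraph y).entropy n) g.rep.root =
        g.entropy (n + 1) - g.gain n := fun g => by
    rw [RootedGraph.gain_eq_rep, LFGraph.gain, RootedGraph.entropy, Function.iterate_one]
    simp only [RootedGraph.entropy_mk]
    ring
  simp only [heq] at h
  rw [integral_sub (hi (n + 1)) hg] at h
  rw [expEntropy, expEntropy, ← h]
  ring

/-- The mean entropy exists, and it is the limit of the expected entropy gain. -/
theorem exists_hasMeanEntropy (hK : 1 ≤ K) (hdeg : ∀ᵐ g ∂P, ∀ x, g.rep.toLFGraph.degree x ≤ K)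
    (hstat : IsStationary P) :
    ∃ h : ℝ, HasMeanEntropy P h ∧ Tendsto (fun n => ∫ g, g.gain n ∂P) atTop (𝓝 h) := by
  have hanti : Antitone fun n => ∫ g, g.gain n ∂P := fun m n hmn =>
    integral_mono (integral_gain hK hdeg hstat n).1 (integral_gain hK hdeg hstat m).1
      fun g => g.gain_antitone hmn
  have hbdd : BddBelow (Set.range fun n => ∫ g, g.gain n ∂P) := by
    refine ⟨0, ?_⟩
    rintro _ ⟨n, rfl⟩
    exact integral_nonneg fun g => g.gain_nonneg n
  have hlim := tendsto_atTop_ciInf hanti hbdd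
  refine ⟨_, hlim.cesaro.congr fun n => ?_, hlim⟩
  have h0 : expEntropy P 0 = 0 := by
    simp [expEntropy, RootedGraph.entropy, LFGraph.entropy_zero]
  rw [Finset.sum_congr rfl fun i _ => (integral_gain hK hdeg hstat i).2, Finset.sum_range_sub,
    h0, sub_zero, inv_mul_eq_div]

/-! ### The lower bound by the speed -/

theorem sq_meanDisplacement_le (hK : 1 ≤ K)
    (hdeg : ∀ᵐ g ∂P, ∀ x, g.rep.toLFGraph.degree x ≤ K) {n : ℕ} (hn : 0 < n) :
    meanDisplacement P n ^ 2 / (2 * n) - Real.log (2 * √K) ≤ expEntropy P n := by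
  set D := meanDisplacement P n
  obtain ⟨hint, heq⟩ := integral_integral_displacement P (fun k : ℕ => (k : ℝ)) n
  have hle := integral_mono_ae
    ((((hint.const_mul (2 * D)).sub (integrable_const (D ^ 2))).div_const (2 * n)).sub
      (integrable_const (Real.log (2 * √K)))) (integrable_entropy hK hdeg n)
    (hdeg.mono fun g hg => by
      -- the choice `c = D` is optimal after integration
      have := g.rep.toLFGraph.entropy_ge hK hg hn g.rep.root D
      rw [← g.rep.toLFGraph.integral_displacement (fun k : ℕ => (k : ℝ)) n _ _ subset_rfl,
        ← RootedGraph.pathLaw_eq] at this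
      exact this)
  simp only [Pi.sub_apply] at hle
  rw [integral_sub _ (integrable_const _), integral_div, integral_sub _ (integrable_const _),
    integral_const_mul, heq] at hle
  · simp only [integral_const, probReal_univ, one_smul] at hle
    change (2 * D * D - D ^ 2) / (2 * n) - _ ≤ expEntropy P n at hle
    rwa [show 2 * D * D - D ^ 2 = D ^ 2 by ring] at hle
  · exact hint.const_mul _
  · exact ((hint.const_mul (2 * D)).sub (integrable_const (D ^ 2))).div_const (2 * n)

theorem sq_speed_div_two_le (hK : 1 ≤ K) (hdeg : ∀ᵐ g ∂P, ∀ x, g.rep.toLFGraph.degree x ≤ K)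
    {h : ℝ} (hh : HasMeanEntropy P h) : speed P ^ 2 / 2 ≤ h := by
  have hu : Tendsto (fun n : ℕ => √(2 * (expEntropy P n / n + Real.log (2 * √K) / n))) atTop
      (𝓝 √(2 * (h + 0))) :=
    ((hh.add (tendsto_const_div_atTop_nhds_zero_nat _)).const_mul 2).sqrt
  have hle : ∀ᶠ n : ℕ in atTop, meanDisplacement P n / n ≤
      √(2 * (expEntropy P n / n + Real.log (2 * √K) / n)) := by
    filter_upwards [eventually_gt_atTop 0] with n hn
    have hn' : (0 : ℝ) < n := Nat.cast_pos.2 hn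
    refine Real.le_sqrt_of_sq_le ?_
    have := sq_meanDisplacement_le hK hdeg hn
    rw [sub_le_iff_le_add, div_le_iff₀ (by positivity)] at this
    rw [div_pow, div_le_iff₀ (by positivity)]
    calc meanDisplacement P n ^ 2 ≤ (expEntropy P n + Real.log (2 * √K)) * (2 * n) := this
      _ = _ := by field_simp
  have hs : speed P ≤ √(2 * (h + 0)) := by
    rw [← hu.limsup_eq]
    exact limsup_le_limsup hle (isCoboundedUnder_le_of_nonneg fun n =>
      div_nonneg (meanDisplacement_nonneg P n) (Nat.cast_nonneg n)) hu.isBoundedUnder_le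
  have h0 := hh.nonneg
  have := pow_le_pow_left₀ speed_nonneg hs 2
  rw [Real.sq_sqrt (by linarith)] at this
  linarith

/-! ### The upper bound by volume growth and speed -/

/-- The position at time `n` has entropy at most that of the uniform measure on the ball of radius
`r`, up to the event that it lies outside of this ball. There the bounded degree gives the bound
`n log (K + 1)` for the entropy. -/
theorem expEntropy_le (hK : 1 ≤ K) (hdeg : ∀ᵐ g ∂P, ∀ x, g.rep.toLFGraph.degree x ≤ K)
    (n r : ℕ) :
    expEntropy P n ≤ 2 + ∫ g, Real.log (g.ballCard r) ∂P +
      n * Real.log (K + 1) * (pathLaw P).real {q | r < q.displacement n} := by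
  classical
  let φ : ℕ → ℝ := fun k => if r < k then 1 else 0
  obtain ⟨hint, heq⟩ := integral_integral_displacement P φ n
  have htail : ∫ q, φ (q.displacement n) ∂pathLaw P =
      (pathLaw P).real {q | r < q.displacement n} := by
    have hm : MeasurableSet {q : PathGraph | r < q.displacement n} :=
      PathGraph.measurable_displacement n measurableSet_Ioi
    rw [← integral_indicator_one hm]
    refine integral_congr_ae (ae_of_all _ fun q => ?_)
    simp [φ, Set.indicator_apply]
  have hi := integrable_log_ballCard hK hdeg r
  have hle := integral_mono_ae (integrable_entropy hK hdeg n)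
    (((integrable_const (2 : ℝ)).add hi).add (hint.const_mul (n * Real.log (K + 1))))
    (hdeg.mono fun g hg => by
      set G := g.rep.toLFGraph
      have h1 := G.entropy_le_log_ball n r g.rep.root
      have h2 := RootedGraph.log_ballCard_le hK hg n
      rw [RootedGraph.ballCard_eq] at h2
      have h3 : ∫ q, φ (q.displacement n) ∂g.pathLaw =
          1 - ∑ y ∈ G.ballFin g.rep.root r, G.prob n g.rep.root y := by
        set B := G.ballFin g.rep.root r
        have hB : B ⊆ G.ballFin g.rep.root n ∪ B := Finset.subset_union_right
        rw [RootedGraph.pathLaw_eq, G.integral_displacement φ n g.rep.root _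
            (Finset.subset_union_left (s₂ := B)),
          ← G.sum_prob n g.rep.root _ (Finset.subset_union_left (s₂ := B)),
          ← Finset.sum_sdiff hB, ← Finset.sum_sdiff hB, add_sub_cancel_right,
          Finset.sum_eq_zero (s := B), add_zero]
        · refine Finset.sum_congr rfl fun y hy => ?_
          have := (Finset.mem_sdiff.1 hy).2
          rw [LFGraph.mem_ballFin, not_le] at this
          simp only [φ, if_pos this, mul_one]
        · intro y hy
          rw [LFGraph.mem_ballFin] at hy
          simp only [φ, if_neg hy.not_gt, mul_zero]
      have h4 : 0 ≤ ∫ q, φ (q.displacement n) ∂g.pathLaw :=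
        integral_nonneg fun q => by simp only [φ]; split_ifs <;> simp
      rw [← h3] at h1
      have h5 := mul_le_mul_of_nonneg_left h2 h4
      simp only [Pi.add_apply]
      rw [RootedGraph.ballCard_eq]
      change G.entropy g.rep.root n ≤ _
      linarith)
  simp only [Pi.add_apply] at hle
  have hsum : Integrable (fun g : RootedGraph => 2 + Real.log (g.ballCard r)) P :=
    (integrable_const (2 : ℝ)).add hi
  rw [integral_add hsum (hint.const_mul _), integral_add (integrable_const _) hi,
    integral_const_mul, heq, htail, integral_const, probReal_univ,
    one_smul] at hle
  exact hle

theorem le_volumeGrowth_mul_speed (hK : 1 ≤ K)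
    (hdeg : ∀ᵐ g ∂P, ∀ x, g.rep.toLFGraph.degree x ≤ K) (hstat : IsStationary P)
    (herg : IsErgodic P) {h : ℝ} (hh : HasMeanEntropy P h) :
    h ≤ volumeGrowth P * speed P := by
  have key : ∀ ε : ℝ, 0 < ε → h ≤ (volumeGrowth P + ε) * (speed P + ε) := by
    intro ε hε
    set a := speed P + ε with ha
    set w := volumeGrowth P + ε with hw
    have ha0 : 0 < a := by have := speed_nonneg (P := P); linarith
    have hr := (tendsto_nat_ceil_mul_div_atTop ha0.le).comp
      (tendsto_natCast_atTop_atTop (R := ℝ))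
    have hr' : Tendsto (fun n : ℕ => ⌈a * n⌉₊) atTop atTop :=
      tendsto_nat_ceil_atTop.comp (tendsto_natCast_atTop_atTop.const_mul_atTop ha0)
    have hvol := hr'.eventually <| (eventually_lt_of_limsup_lt (show volumeGrowth P < w by linarith)
      (isBoundedUnder_le_of_le (integral_log_ballCard_div_le hK hdeg))).and (eventually_gt_atTop 0)
    have hlim := (((tendsto_const_div_atTop_nhds_zero_nat (2 : ℝ)).add (hr.const_mul w)).add
      ((tendsto_measure_displacement hstat herg (show speed P < a by linarith)).const_mul
        (Real.log (K + 1))))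
    rw [mul_zero, zero_add, add_zero] at hlim
    refine le_of_tendsto_of_tendsto hh hlim ?_
    filter_upwards [hvol, eventually_gt_atTop 0] with n ⟨hv, hrn⟩ hn
    have hn' : (0 : ℝ) < n := Nat.cast_pos.2 hn
    rw [div_lt_iff₀ (Nat.cast_pos.2 hrn)] at hv
    have hE := expEntropy_le hK hdeg n ⌈a * n⌉₊
    have hmono : (pathLaw P).real {q | ⌈a * n⌉₊ < q.displacement n} ≤
        (pathLaw P).real {q | a * n < q.displacement n} :=
      measureReal_mono fun q hq => (Nat.le_ceil _).trans_lt (Nat.cast_lt.2 hq)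
    have hL : 0 ≤ n * Real.log (K + 1) := mul_nonneg hn'.le (Real.log_nonneg (by simp))
    have := mul_le_mul_of_nonneg_left hmono hL
    simp only [Function.comp_apply]
    rw [div_le_iff₀ hn']
    have hexp : (2 / (n : ℝ) + w * (⌈a * n⌉₊ / n) +
        Real.log (K + 1) * (pathLaw P).real {q | a * n < q.displacement n}) * n =
        2 + w * ⌈a * n⌉₊ + n * Real.log (K + 1) *
          (pathLaw P).real {q | a * n < q.displacement n} := by
      field_simp
    rw [hexp]
    linarith
  have hcont : Tendsto (fun ε : ℝ => (volumeGrowth P + ε) * (speed P + ε)) (𝓝[>] 0)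
      (𝓝 ((volumeGrowth P + 0) * (speed P + 0))) :=
    ((by fun_prop : Continuous fun ε : ℝ => (volumeGrowth P + ε) * (speed P + ε)).tendsto
      0).mono_left nhdsWithin_le_nhds
  rw [add_zero, add_zero] at hcont
  exact ge_of_tendsto hcont (eventually_mem_nhdsWithin.mono key)

/-! ### Vanishing mean entropy -/

/-- If the mean entropy vanishes, then so does the limit of the entropy gain at the root, almost
surely, and by stationarity at all other vertices as well. -/
theorem ae_isLiouville (hK : 1 ≤ K) (hdeg : ∀ᵐ g ∂P, ∀ x, g.rep.toLFGraph.degree x ≤ K)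
    (hstat : IsStationary P) (hlim : Tendsto (fun n => ∫ g, g.gain n ∂P) atTop (𝓝 0)) :
    ∀ᵐ g ∂P, g.rep.toLFGraph.IsLiouville := by
  have hroot : ∀ᵐ g : RootedGraph ∂P, Tendsto (fun n => g.gain n) atTop (𝓝 0) :=
    tendsto_of_integral_tendsto_of_antitone (F := fun _ => 0)
      (fun n => (integral_gain hK hdeg hstat n).1) (integrable_const 0) (by simpa using hlim)
      (ae_of_all _ fun g => g.gain_antitone) (ae_of_all _ fun g n => g.gain_nonneg n)
  have hall := hstat.ae_forall
    (measurableSet_tendsto (𝓝 (0 : ℝ)) RootedGraph.measurable_gain) hroot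
  filter_upwards [hall] with g hg
  refine g.rep.toLFGraph.isLiouville_of_gain_tendsto fun x => ?_
  simpa only [RootedGraph.gain_mk] using hg x

end Bounded

end RandomGraph

theorem proposition3p5 (P : MeasureTheory.Measure RandomGraph.RootedGraph)
    [MeasureTheory.IsProbabilityMeasure P]
    (hstat : RandomGraph.IsStationary P) (herg : RandomGraph.IsErgodic P)
    (M : ℝ) (hM : 0 < M)
    (hdeg : ∀ᵐ g ∂P, ∀ x, (g.rep.toLFGraph.degree x : ℝ) ≤ M) :
    (∀ n : ℕ, MeasureTheory.Integrable (fun g : RandomGraph.RootedGraph => g.entropy n) P ∧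
      MeasureTheory.Integrable (fun q : RandomGraph.PathGraph => (q.displacement n : ℝ))
        (RandomGraph.pathLaw P) ∧
      MeasureTheory.Integrable
        (fun g : RandomGraph.RootedGraph => Real.log (g.ballCard n)) P) ∧
    ∃ h : ℝ, RandomGraph.HasMeanEntropy P h ∧
      RandomGraph.speed P ^ 2 / 2 ≤ h ∧
      h ≤ RandomGraph.volumeGrowth P * RandomGraph.speed P ∧
      (h = 0 ↔ RandomGraph.speed P = 0) ∧
      (RandomGraph.speed P = 0 ∨ RandomGraph.volumeGrowth P = 0 →
        ∀ᵐ g ∂P, g.rep.toLFGraph.IsLiouville) := by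
  have hK : 1 ≤ ⌈M⌉₊ := Nat.one_le_ceil_iff.2 hM
  have hdegK : ∀ᵐ g ∂P, ∀ x, g.rep.toLFGraph.degree x ≤ ⌈M⌉₊ :=
    hdeg.mono fun g hg x => Nat.cast_le.1 ((hg x).trans (Nat.le_ceil M))
  refine ⟨fun n => ⟨RandomGraph.integrable_entropy hK hdegK n,
    RandomGraph.PathGraph.integrable_displacement _ n,
    RandomGraph.integrable_log_ballCard hK hdegK n⟩, ?_⟩
  obtain ⟨h, hh, hgain⟩ := RandomGraph.exists_hasMeanEntropy hK hdegK hstat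
  have hlow := RandomGraph.sq_speed_div_two_le hK hdegK hh
  have hup := RandomGraph.le_volumeGrowth_mul_speed hK hdegK hstat herg hh
  have hzero : RandomGraph.speed P = 0 ∨ RandomGraph.volumeGrowth P = 0 → h = 0 := fun h0 =>
    le_antisymm (by rcases h0 with h0 | h0 <;> simpa [h0] using hup) hh.nonneg
  refine ⟨h, hh, hlow, hup, ⟨fun h0 => ?_, fun h0 => hzero (Or.inl h0)⟩, fun h0 => ?_⟩
  · rw [h0] at hlow
    have := sq_nonneg (RandomGraph.speed P)
    exact pow_eq_zero_iff two_ne_zero |>.1 (by linarith)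
  · rw [hzero h0] at hgain
    exact RandomGraph.ae_isLiouville hK hdegK hstat hgain

end
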